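/- Let $k$ be a commutative ring. Monoidal categories are assumed $k$-linear with tensor product $k$-linear in each variable, and functors between $k$-linear categories are assumed $k$-linear; monoidal functors are strong, and morphisms between them are monoidal natural transformations. Let $(\mathbf a,\otimes,\mathbf 1)$ be an essentially small monoidal category, $\mathsf{PSh}\,\mathbf a$ the category of $k$-linear functors $\mathbf a^{\mathrm{op}}\to\mathsf{Mod}_k$ and $\mathtt Y:\mathbf a\to\mathsf{PSh}\,\mathbf a$ the Yoneda embedding. *Topologies.* A sieve on $X\in\mathbf a$ is a $k$-linear subfunctor $R\subset\mathbf a(-,X)$. A ($k$-linear Grothendieck) topology $\mathcal T$ assigns to each $X$ a set $\mathcal T(X)$ of sieves on $X$ such that: $\mathbf a(-,X)\in\mathcal T(X)$; if $R\in\mathcal T(X)$ and $f:B\to X$, then $f^{-1}R\in\mathcal T(B)$; and if $R\in\mathcal T(X)$ and $S$ is a sieve on $X$ with $f^{-1}S\in\mathcal T(B)$ for all $B$ and all $f\in R(B)$, then $S\in\mathcal T(X)$. A presheaf $F\in\mathsf{PSh}\,\mathbf a$ is a $\mathcal T$-sheaf if $F(X)\simeq\mathrm{Nat}(\mathbf a(-,X),F)\to\mathrm{Nat}(R,F)$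 is an isomorphism for all $X$ and $R\in\mathcal T(X)$; $\mathsf{Sh}(\mathbf a,\mathcal T)\subset\mathsf{PSh}\,\mathbf a$ is the full subcategory of sheaves. The topology $\mathcal T$ is *monoidal* if for every $\mathcal T$-sheaf $F$ and every $A\in\mathbf a$ the presheaves $F(A\otimes-)$ and $F(-\otimes A)$ are $\mathcal T$-sheaves. *Pretopologies.* A formal morphism $\amalg_{i}A_i\to\amalg_jB_j$ between formal coproducts of small families of objects of $\mathbf a$ is an element of $\prod_i\bigoplus_j\mathbf a(A_i,B_j)$, with composition by matrix multiplication. A formal sequence is a pair of formal morphisms $\amalg_\gamma Z_\gamma\xrightarrow{p}\amalg_\beta Y_\beta\xrightarrow{q}X$ with $X\in\mathbf a$ and $q\circ p=0$. For a class $\mathcal S$ of formal sequences, $\mathcal Co(\mathcal S)=\mathcal Co^1(\mathcal S)$ is the class of the morphisms $q$ occurring in its members, $\mathcal Co^0(\mathcal S)$ is the class of identity morphisms of $\mathbf a$, and for $i>1$ the class $\mathcal Co^i(\mathcal S)$ consists of the composites $\amalg_\alpha\amalg_\delta W_\delta(\alpha)\to\amalg_\alpha V_\alpha\to X$ of some $\amalg_\alpha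 V_\alpha\to X$ in $\mathcal Co^{i-1}(\mathcal S)$ with morphisms $\amalg_\delta W_\delta(\alpha)\to V_\alpha$ in $\mathcal Co(\mathcal S)$; put $\widetilde{\mathcal Co}(\mathcal S)=\bigcup_{i\ge0}\mathcal Co^i(\mathcal S)$. The class $\mathcal S$ is a *pretopology* if 1. for each $q:\amalg_\beta Y_\beta\to X$ in $\mathcal Co(\mathcal S)$ and $f:A\to X$ in $\mathbf a$ there are $q':\amalg_\delta C_\delta\to A$ in $\widetilde{\mathcal Co}(\mathcal S)$ and a formal morphism $f':\amalg_\delta C_\delta\to\amalg_\beta Y_\beta$ with $q\circ f'=f\circ q'$; 2. for each sequence $(p,q)$ in $\mathcal S$ as above and each formal morphism $f:A\to\amalg_\beta Y_\beta$ with $A\in\mathbf a$ and $q\circ f=0$ there are $q':\amalg_\alpha B_\alpha\to A$ in $\widetilde{\mathcal Co}(\mathcal S)$ and a formal morphism $f':\amalg_\alpha B_\alpha\to\amalg_\gamma Z_\gamma$ with $p\circ f'=f\circ q'$. Then $\mathrm{top}(\mathcal S)$ is the topology whose covering sieves on $X$ are the sieves containing the sieve generated by some $r\in\widetilde{\mathcal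 Co}(\mathcal S)$ with target $X$. **Theorem.** Let $\mathcal T$ be a monoidal topology on $\mathbf a$ and let $\mathcal S$ be a pretopology (not necessarily closed under tensor products) with $\mathcal T=\mathrm{top}(\mathcal S)$. Let $\mathcal S_0\subset\mathcal S$ be a subclass such that each member of $\mathcal S$ is, up to isomorphism, of the form $A\otimes\sigma\otimes B$ with $\sigma\in\mathcal S_0$ and $A,B\in\mathbf a$. Then the inclusion $\mathsf{Sh}(\mathbf a,\mathcal T)\subset\mathsf{PSh}\,\mathbf a$ has a left adjoint $\mathtt S$, and $\mathsf{Sh}(\mathbf a,\mathcal T)$ has a biclosed monoidal structure (all functors $F\otimes-$ and $-\otimes F$ have right adjoints) for which $\mathtt Z=\mathtt S\circ\mathtt Y:\mathbf a\to\mathsf{Sh}(\mathbf a,\mathcal T)$ admits a monoidal structure. Moreover, for any such $\mathtt S$, biclosed monoidal structure on $\mathsf{Sh}(\mathbf a,\mathcal T)$ and monoidal structure on $\mathtt Z$, and for every ($k$-linear, locally small) cocomplete monoidal category $\mathbf B$ whose tensor product is cocontinuous in each variable, composition with the monoidal functor $\mathtt Z$ is a well-defined equivalence of categories $$-\circ\mathtt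 Z:\;[\mathsf{Sh}(\mathbf a,\mathcal T),\mathbf B]_{cc}^{\otimes}\;\xrightarrow{\ \sim\ }\;[\mathbf a,\mathbf B]_{\mathcal S_0}^{\otimes}.$$ Here the left side is the category of cocontinuous monoidal functors $\mathsf{Sh}(\mathbf a,\mathcal T)\to\mathbf B$, and the right side is the category of monoidal functors $h:\mathbf a\to\mathbf B$ for which $\bigoplus_\gamma h(Z_\gamma)\to\bigoplus_\beta h(Y_\beta)\to h(X)\to0$ is a cokernel diagram in $\mathbf B$ for every sequence $\amalg_\gamma Z_\gamma\to\amalg_\beta Y_\beta\to X$ in $\mathcal S_0$. -/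

import Mathlib

open CategoryTheory CategoryTheory.Limits CategoryTheory.MonoidalCategory Opposite

universe w u u'

noncomputable section

namespace LinearSite

/-! ### Sieves, topologies and sheaves on a `k`-linear category -/

section Topology

variable (k : Type w) [CommRing k] {a : Type u} [Category.{w} a] [Preadditive a] [Linear k a]

/-- A `k`-linear sieve on `X`: a `k`-linear subfunctor of `a(-, X)`. -/
@[ext]
structure LinSieve (X : a) where
  arrows (V : a) : Submodule k (V ⟶ X)
  precomp_mem {V W : a} (g : W ⟶ V) {f : V ⟶ X} (hf : f ∈ arrows V) : g ≫ f ∈ arrows W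

namespace LinSieve

variable {k}

/-- The maximal sieve `a(-, X)`. -/
def maximal (X : a) : LinSieve k X where
  arrows _ := ⊤
  precomp_mem _ _ _ := trivial

/-- The sieve `f⁻¹ R` on `B`, for a sieve `R` on `X` and `f : B ⟶ X`. -/
def pullback {X B : a} (R : LinSieve k X) (f : B ⟶ X) : LinSieve k B where
  arrows V := (R.arrows V).comap (Linear.rightComp k V f)
  precomp_mem g φ hφ := by
    simp only [Submodule.mem_comap, Linear.rightComp_apply, Category.assoc] at hφ ⊢
    exact R.precomp_mem g hφ

/-- The inclusion of sieves on `X`. -/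
instance (X : a) : LE (LinSieve k X) := ⟨fun R R' => ∀ V, R.arrows V ≤ R'.arrows V⟩

/-- A sieve, viewed as a presheaf of `k`-modules. -/
def toPresheaf {X : a} (R : LinSieve k X) : aᵒᵖ ⥤ ModuleCat.{w} k where
  obj V := ModuleCat.of k (R.arrows V.unop)
  map {V W} g := ModuleCat.ofHom
    ((Linear.leftComp k X g.unop).restrict fun _ hf => R.precomp_mem g.unop hf)

/-- The inclusion of a sieve on `X` into the representable presheaf `a(-, X)`. -/
def incl {X : a} (R : LinSieve k X) : R.toPresheaf ⟶ (linearYoneda k a).obj X where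
  app V := ModuleCat.ofHom (R.arrows V.unop).subtype

end LinSieve

variable (a)

/-- A `k`-linear Grothendieck topology on `a`. -/
structure Topology where
  covers (X : a) : Set (LinSieve k X)
  maximal_mem (X : a) : LinSieve.maximal X ∈ covers X
  pullback_mem {X B : a} {R : LinSieve k X} (hR : R ∈ covers X) (f : B ⟶ X) :
    R.pullback f ∈ covers B
  transitive {X : a} {S R : LinSieve k X} (hR : R ∈ covers X)
    (h : ∀ (B : a) (f : B ⟶ X), f ∈ R.arrows B → S.pullback f ∈ covers B) : S ∈ covers X

/-- The property of a functor `aᵒᵖ ⥤ Mod_k` to be `k`-linear. -/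
def IsLinearPresheaf : ObjectProperty (aᵒᵖ ⥤ ModuleCat.{w} k) := fun F =>
  (∀ ⦃X Y : a⦄ (f g : X ⟶ Y), F.map (f + g).op = F.map f.op + F.map g.op) ∧
    ∀ ⦃X Y : a⦄ (r : k) (f : X ⟶ Y), F.map (r • f).op = r • F.map f.op

/-- The category `PSh a` of `k`-linear functors `aᵒᵖ ⥤ Mod_k`. -/
abbrev PSh := (IsLinearPresheaf k a).FullSubcategory

/-- The Yoneda embedding `a ⥤ PSh a`. -/
def yonedaPSh : a ⥤ PSh k a :=
  ObjectProperty.lift _ (linearYoneda k a) fun X => by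
    refine ⟨fun Y Z f g => ?_, fun Y Z r f => ?_⟩
    · ext h
      exact Preadditive.add_comp _ _ _ f g h
    · ext h
      exact Linear.smul_comp _ _ _ r f h

variable {k a}

/-- `F` is a sheaf for `T`: for each covering sieve `R` on `X`, restriction along
`R ⟶ a(-, X)` is a bijection `Nat(a(-, X), F) → Nat(R, F)`. -/
def IsSheaf (T : Topology k a) (F : aᵒᵖ ⥤ ModuleCat.{w} k) : Prop :=
  ∀ (X : a) (R : LinSieve k X), R ∈ T.covers X →
    Function.Bijective fun φ : (linearYoneda k a).obj X ⟶ F => R.incl ≫ φ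

/-- The full subcategory `Sh(a, T)` of `PSh a` on the sheaves. -/
abbrev Sh (T : Topology k a) :=
  ObjectProperty.FullSubcategory fun F : PSh k a => IsSheaf T F.obj

/-- The inclusion `Sh(a, T) ⥤ PSh a`. -/
abbrev shIncl (T : Topology k a) : Sh T ⥤ PSh k a :=
  ObjectProperty.ι fun F : PSh k a => IsSheaf T F.obj

end Topology

/-! ### Formal sequences and pretopologies -/

section Pretopology

variable {a : Type u} [Category.{w} a] [Preadditive a]

/-- A morphism `∐ᵢ Aᵢ ⟶ ∐ⱼ Bⱼ` of formal coproducts: a row-finite matrix of morphisms. -/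
structure FormalHom {ι κ : Type w} (A : ι → a) (B : κ → a) where
  app (i : ι) (j : κ) : A i ⟶ B j
  finite (i : ι) : {j | app i j ≠ 0}.Finite

/-- A morphism `∐ᵢ Yᵢ ⟶ X` from a formal coproduct to a single object. -/
structure Family (X : a) where
  ι : Type w
  obj : ι → a
  map (i : ι) : obj i ⟶ X

namespace Family

/-- The identity of `X`, as a one-element family. -/
def id (X : a) : Family X := ⟨PUnit, fun _ => X, fun _ => 𝟙 X⟩

/-- The family of all composites `W(α)_δ ⟶ V_α ⟶ X`. -/
def comp {X : a} (v : Family X) (t : ∀ α, Family (v.obj α)) : Family X where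
  ι := Σ α, (t α).ι
  obj i := (t i.1).obj i.2
  map i := (t i.1).map i.2 ≫ v.map i.1

/-- The `k`-linear sieve generated by a family. -/
def sieve (k : Type w) [CommRing k] [Linear k a] {X : a} (v : Family X) : LinSieve k X where
  arrows V := Submodule.span k {f | ∃ (α : v.ι) (g : V ⟶ v.obj α), f = g ≫ v.map α}
  precomp_mem {V W} h f hf := by
    have : Submodule.span k {f | ∃ (α : v.ι) (g : V ⟶ v.obj α), f = g ≫ v.map α} ≤
        (Submodule.span k {f | ∃ (α : v.ι) (g : W ⟶ v.obj α), f = g ≫ v.map α}).comap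
          (Linear.leftComp k X h) := by
      rw [Submodule.span_le]
      rintro _ ⟨α, g, rfl⟩
      exact Submodule.subset_span ⟨α, h ≫ g, by simp⟩
    exact this hf

end Family

variable (a) in
/-- A formal sequence `∐_γ Z_γ --p--> ∐_β Y_β --q--> X` with `q ∘ p = 0`. Here `Y = q.obj`. -/
structure FormalSequence where
  X : a
  q : Family X
  κ : Type w
  Z : κ → a
  p : FormalHom Z q.obj
  zero (γ : κ) : ∑ᶠ β, p.app γ β ≫ q.map β = 0

/-- `Co S X q`: the morphism `q` with target `X` is the right one of a sequence in `S`. -/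
inductive Co (S : Set (FormalSequence a)) : ∀ X : a, Family X → Prop
  | mk (σ : FormalSequence a) (hσ : σ ∈ S) : Co S σ.X σ.q

/-- The classes `Coⁱ(S)` of `i`-fold iterated coverings. -/
inductive CoIter (S : Set (FormalSequence a)) : ℕ → ∀ X : a, Family X → Prop
  | zero (X : a) : CoIter S 0 X (Family.id X)
  | one {X : a} {q : Family X} (hq : Co S X q) : CoIter S 1 X q
  | step {n : ℕ} {X : a} {v : Family X} (hv : CoIter S (n + 1) X v)
      (t : ∀ α, Family (v.obj α)) (ht : ∀ α, Co S (v.obj α) (t α)) :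
      CoIter S (n + 2) X (v.comp t)

/-- The union of the classes `Coⁱ(S)`. -/
def CoTilde (S : Set (FormalSequence a)) (X : a) (r : Family X) : Prop := ∃ n, CoIter S n X r

/-- Grothendieck pretopologies, as classes of formal sequences. -/
structure IsPretopology (S : Set (FormalSequence a)) : Prop where
  /-- Every `q` in `Co(S)` can be pulled back along every `f : A ⟶ X`: there are `q'` over `A` and
  `f'` with `q ∘ f' = f ∘ q'`. -/
  pta {X : a} {q : Family X} (hq : Co S X q) {A : a} (f : A ⟶ X) :
    ∃ q' : Family A, CoTilde S A q' ∧ ∃ f' : FormalHom q'.obj q.obj,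
      ∀ δ, ∑ᶠ β, f'.app δ β ≫ q.map β = q'.map δ ≫ f
  /-- Every formal morphism `f : A ⟶ ∐_β Y_β` with `q ∘ f = 0` lifts locally along `p`: there are
  `q'` over `A` and `f'` with `p ∘ f' = f ∘ q'`. -/
  ptb {σ : FormalSequence a} (hσ : σ ∈ S) {A : a} (f : ∀ β, A ⟶ σ.q.obj β)
      (hf : {β | f β ≠ 0}.Finite) (h0 : ∑ᶠ β, f β ≫ σ.q.map β = 0) :
    ∃ q' : Family A, CoTilde S A q' ∧ ∃ f' : FormalHom q'.obj σ.Z,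
      ∀ α β, ∑ᶠ γ, f'.app α γ ≫ σ.p.app γ β = q'.map α ≫ f β

/-- The covering system `top(S)`: all sieves that contain the sieve generated by an
iterated covering. -/
def top (k : Type w) [CommRing k] [Linear k a] (S : Set (FormalSequence a)) (X : a) :
    Set (LinSieve k X) :=
  {R | ∃ r : Family X, CoTilde S X r ∧ r.sieve k ≤ R}

namespace FormalSequence

/-- The image of a formal sequence under an additive endofunctor. -/
def map (σ : FormalSequence a) (F : a ⥤ a) [F.Additive] : FormalSequence a where
  X := F.obj σ.X
  q := ⟨σ.q.ι, fun β => F.obj (σ.q.obj β), fun β => F.map (σ.q.map β)⟩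
  κ := σ.κ
  Z γ := F.obj (σ.Z γ)
  p := ⟨fun γ β => F.map (σ.p.app γ β), fun γ => (σ.p.finite γ).subset fun β hβ h =>
    hβ (by rw [h, F.map_zero])⟩
  zero γ := by
    have hfin : (Function.support fun β => σ.p.app γ β ≫ σ.q.map β).Finite :=
      (σ.p.finite γ).subset fun β hβ h => hβ (by simp only [h, zero_comp])
    have := (F.mapAddHom (X := σ.Z γ) (Y := σ.X)).map_finsum hfin
    rw [σ.zero γ, map_zero] at this
    simpa using this.symm

/-- The formal sequence `A ⊗ σ ⊗ B`. -/
def tensor [MonoidalCategory a] [MonoidalPreadditive a] (A : a) (σ : FormalSequence a) (B : a) :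
    FormalSequence a :=
  (σ.map (tensorLeft A)).map (tensorRight B)

/-- A (componentwise) isomorphism of formal sequences. -/
structure Iso (σ τ : FormalSequence a) where
  isoX : σ.X ≅ τ.X
  eY : σ.q.ι ≃ τ.q.ι
  isoY (β : σ.q.ι) : σ.q.obj β ≅ τ.q.obj (eY β)
  eZ : σ.κ ≃ τ.κ
  isoZ (γ : σ.κ) : σ.Z γ ≅ τ.Z (eZ γ)
  commq (β : σ.q.ι) : σ.q.map β ≫ isoX.hom = (isoY β).hom ≫ τ.q.map (eY β)
  commp (γ : σ.κ) (β : σ.q.ι) :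
    σ.p.app γ β ≫ (isoY β).hom = (isoZ γ).hom ≫ τ.p.app (eZ γ) (eY β)

end FormalSequence

/-- `h` sends `σ` to a cokernel diagram: `h(X)`, with the canonical map from `⨁ h(Y_β)`, is the
cokernel of the induced morphism `⨁ h(Z_γ) ⟶ ⨁ h(Y_β)`. -/
def SendsToCokernel {B : Type u'} [Category.{w} B] [Preadditive B] [HasColimits B]
    (h : a ⥤ B) (σ : FormalSequence a) : Prop :=
  ∃ e : Sigma.desc (fun γ => ∑ᶠ β, h.map (σ.p.app γ β) ≫ Sigma.ι (fun β => h.obj (σ.q.obj β)) β) ≫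
      Sigma.desc (fun β => h.map (σ.q.map β)) = (0 : ∐ (fun γ => h.obj (σ.Z γ)) ⟶ h.obj σ.X),
    Nonempty (IsColimit (CokernelCofork.ofπ _ e))

end Pretopology

/-! ### Monoidal topologies and monoidal functors -/

section Monoidal

variable {k : Type w} [CommRing k] {a : Type u} [Category.{w} a] [Preadditive a] [Linear k a]

/-- A topology is monoidal if `F(A ⊗ -)` and `F(- ⊗ A)` are sheaves, for each sheaf `F` and
each object `A`. -/
def Topology.IsMonoidal [MonoidalCategory a] (T : Topology k a) : Prop :=
  ∀ (F : Sh T) (A : a), IsSheaf T ((tensorLeft A).op ⋙ F.obj.obj) ∧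
    IsSheaf T ((tensorRight A).op ⋙ F.obj.obj)

/-- A sheafification functor `S`, left adjoint to the inclusion `Sh(a, T) ⥤ PSh a`, together with
a biclosed `k`-linear monoidal structure on `Sh(a, T)` and a monoidal structure on `Z = S ∘ Y`. -/
structure MonoidalSheafification [MonoidalCategory a] (T : Topology k a) where
  S : PSh k a ⥤ Sh T
  adj : S ⊣ shIncl T
  monoidalCategory : MonoidalCategory (Sh T)
  monoidalPreadditive : MonoidalPreadditive (Sh T)
  monoidalLinear : MonoidalLinear k (Sh T)
  leftClosed (F : Sh T) : (tensorLeft F).IsLeftAdjoint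
  rightClosed (F : Sh T) : (tensorRight F).IsLeftAdjoint
  monoidalZ : (yonedaPSh k a ⋙ S).Monoidal

namespace MonoidalSheafification

variable [MonoidalCategory a] {T : Topology k a} (M : MonoidalSheafification T)

/-- The functor `Z = S ∘ Y : a ⥤ Sh(a, T)`. -/
abbrev Z : a ⥤ Sh T := yonedaPSh k a ⋙ M.S

end MonoidalSheafification

section Functors

variable {C : Type*} [Category* C] [MonoidalCategory C]
  {D : Type*} [Category* D] [MonoidalCategory D]
  {E : Type*} [Category* E] [MonoidalCategory E]

/-- Precomposition with a monoidal functor `Z : C ⥤ D`, on monoidal functors `D ⥤ E` and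
monoidal natural transformations. -/
def precomp (Z : C ⥤ D) [Z.Monoidal] : LaxMonoidalFunctor D E ⥤ LaxMonoidalFunctor C E where
  obj H := LaxMonoidalFunctor.of (Z ⋙ H.toFunctor)
  map {H₁ H₂} η :=
    { hom := Functor.whiskerLeft Z η.hom
      isMonoidal := by
        have := η.isMonoidal
        exact inferInstanceAs (NatTrans.IsMonoidal (Functor.whiskerLeft Z η.hom)) }

variable (k)

/-- The `k`-linear (strong) monoidal functors: the structure morphisms `ε : 𝟙 ⟶ H 𝟙` and
`μ : H X ⊗ H Y ⟶ H (X ⊗ Y)` are isomorphisms. -/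
def IsLinearMonoidal [Preadditive D] [Preadditive E] [Linear k D] [Linear k E] :
    ObjectProperty (LaxMonoidalFunctor D E) := fun H =>
  H.toFunctor.Additive ∧ H.toFunctor.Linear k ∧ IsIso (Functor.LaxMonoidal.ε H.toFunctor) ∧
    ∀ X Y, IsIso (Functor.LaxMonoidal.μ H.toFunctor X Y)

/-- The `k`-linear cocontinuous monoidal functors. -/
def IsCocontinuousMonoidal [Preadditive D] [Preadditive E] [Linear k D] [Linear k E] :
    ObjectProperty (LaxMonoidalFunctor D E) := fun H =>
  IsLinearMonoidal k H ∧ PreservesColimitsOfSize.{w, w} H.toFunctor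

end Functors

/-- The `k`-linear monoidal functors `a ⥤ B` sending the sequences in `S₀` to cokernel diagrams. -/
def IsCokernelMonoidal (k : Type w) [CommRing k] [Linear k a] [MonoidalCategory a] {B : Type u'}
    [Category.{w} B] [Preadditive B] [Linear k B] [MonoidalCategory B] [HasColimits B]
    (S₀ : Set (FormalSequence a)) : ObjectProperty (LaxMonoidalFunctor a B) := fun h =>
  IsLinearMonoidal k h ∧ ∀ σ ∈ S₀, SendsToCokernel h.toFunctor σ

end Monoidal

end LinearSite

end

-- The engine is the relation between a functor `h : a ⥤ B` and its presheaves `Hom(h -, b)`. By the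
-- universal property of coproducts and cokernels, `h` sends a formal sequence to a cokernel diagram
-- if and only if every `Hom(h -, b)` is left exact on it. For a pretopology `S` with `T = top(S)`,
-- left exactness on all sequences of `S` is the sheaf condition (`isSheafAt_of_isExactAt`,
-- `isExactAt_of_isSheafAt`). So `h` is exact on `S` precisely when each `Hom(h -, b)` is a sheaf,
-- that is, of the form `Hom(Z -, R)` for a sheaf `R`; the latter is the condition `HasRep`.
--
-- Everything else is formal and uses two facts about `Z : a ⥤ D`. It is linearly dense: each `F` is
-- the colimit of `Z` weighted by `Hom(Z -, F)`. And `HasRep` holds for the functors in question.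
-- Given `h` with `HasRep`, let `L F` be the colimit of `h` weighted by `Hom(Z -, F)`. Then `Hom(L
-- F, b) = Hom(F, R)`, so `L` is a left adjoint, hence cocontinuous, and `L (Z x) ≅ h x` by the
-- Yoneda argument. Density makes a natural transformation out of a cocontinuous functor on `D` the
-- same as its restriction along `Z`. This is the equivalence without tensor products.
--
-- For tensor products, weighted cocones are replaced by bilinear ones, natural families `Hom(Z x,
-- F) × Hom(Z y, G) → Hom(h (x ⊗ y), b)`. Cocontinuity of the tensor product of `B` makes `L F ⊗ L
-- G` the universal vertex of such families. The same holds for `F ⊗ G` and `Z`, and `HasRep`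
-- transports that statement to `L (F ⊗ G)`; comparing the two universal objects gives the monoidal
-- structure of `L`. Its axioms are checked on products of sections, where they become axioms of
-- `h`, `Z` and `a`.
--
-- The tensor product of sheaves is constructed by the same universal property (`TensorSystem`), a
-- localised Day convolution. Monoidality of `T` says that the presheaves `Hom(Z (x ⊗ -), G)` and
-- `Hom(Z (- ⊗ x), G)` are sheaves, hence represented, and this is what yields associativity, units
-- and `Z x ⊗ Z y ≅ Z (x ⊗ y)`. The internal homs are presheaves of weighted cocones, which are
-- limits of sheaves. Sheafification exists because `PSh a` is locally presentable and sheaves are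
-- the objects local for a small set of sieve inclusions.
--
-- Exactness on `S₀` is enough: a monoidal `h` turns `A ⊗ σ ⊗ B` into `h A ⊗ h σ ⊗ h B`, and
-- tensoring in `B` preserves cokernel diagrams.

universe v₁ u₁ v₂ u₂ v₃ u₃

set_option linter.unusedSectionVars false

noncomputable section

namespace LinearSite

/-! ### Weighted cocones and linearly dense functors -/

section WCocone

variable (k : Type w) [CommRing k] {a : Type u} [Category.{w} a]
  {D : Type u₁} [Category.{v₁} D] [Preadditive D] [Linear k D]
  {E : Type u₂} [Category.{v₂} E] [Preadditive E] [Linear k E]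
  {E' : Type u₃} [Category.{v₃} E'] [Preadditive E'] [Linear k E']

/-- A `k`-linear natural family of maps `Hom(Z x, F) → Hom(h x, b)`: a cocone under `h` with
vertex `b`, weighted by the presheaf `Hom(Z -, F)`. -/
@[ext]
structure WCocone (Z : a ⥤ D) (h : a ⥤ E) (F : D) (b : E) where
  app {x : a} (s : Z.obj x ⟶ F) : h.obj x ⟶ b
  -- A single identity encodes additivity, homogeneity and naturality. The case `r = 1`, `f = 𝟙`, `s
  -- = t = 0` forces `app 0 = 0`, and the three properties are then special cases. No linear
  -- structure on `a` is needed.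
  lin {x y : a} (r : k) (s : Z.obj x ⟶ F) (f : x ⟶ y) (t : Z.obj y ⟶ F) :
    app (r • s + Z.map f ≫ t) = r • app s + h.map f ≫ app t

namespace WCocone

variable {k} {Z : a ⥤ D} {h : a ⥤ E} {F : D} {b c : E}

lemma app_zero (u : WCocone k Z h F b) (x : a) : u.app (0 : Z.obj x ⟶ F) = 0 := by
  have := u.lin (1 : k) (0 : Z.obj x ⟶ F) (𝟙 x) 0
  simpa using this

lemma app_comp (u : WCocone k Z h F b) {x y : a} (f : x ⟶ y) (t : Z.obj y ⟶ F) :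
    u.app (Z.map f ≫ t) = h.map f ≫ u.app t := by
  have := u.lin (0 : k) (0 : Z.obj x ⟶ F) f t
  simpa using this

lemma app_add (u : WCocone k Z h F b) {x : a} (s t : Z.obj x ⟶ F) :
    u.app (s + t) = u.app s + u.app t := by
  have := u.lin (1 : k) s (𝟙 x) t
  simpa using this

lemma app_smul (u : WCocone k Z h F b) {x : a} (r : k) (s : Z.obj x ⟶ F) :
    u.app (r • s) = r • u.app s := by
  have := u.lin r s (𝟙 x) 0
  simpa [app_zero] using this

/-- Composition with a morphism out of the vertex. -/
@[simps]
def postcomp (u : WCocone k Z h F b) (g : b ⟶ c) : WCocone k Z h F c where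
  app s := u.app s ≫ g
  lin r s f t := by simp [u.lin]

/-- Restriction along a morphism into the weight. -/
@[simps]
def precomp (u : WCocone k Z h F b) {F' : D} (g : F' ⟶ F) : WCocone k Z h F' b where
  app s := u.app (s ≫ g)
  lin r s f t := by simp [u.lin]

/-- The image of a weighted cocone under a `k`-linear functor. -/
@[simps]
def mapFunctor (u : WCocone k Z h F b) (G : E ⥤ E') [G.Additive] [G.Linear k] :
    WCocone k Z (h ⋙ G) F (G.obj b) where
  app s := G.map (u.app s)
  lin r s f t := by simp [u.lin]

/-- Composition with a natural transformation of the diagram. -/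
@[simps]
def ofNatTrans (u : WCocone k Z h F b) {h' : a ⥤ E} (θ : h' ⟶ h) : WCocone k Z h' F b where
  app {x} s := θ.app x ≫ u.app s
  lin r s f t := by simp [u.lin]

variable (k Z F) in
/-- The tautological weighted cocone. -/
@[simps]
def refl : WCocone k Z Z F F where
  app s := s
  lin _ _ _ _ := rfl

/-- A weighted cocone is universal if it exhibits its vertex as a weighted colimit. -/
def IsUniversal (u : WCocone k Z h F b) : Prop :=
  ∀ ⦃c : E⦄ (v : WCocone k Z h F c), ∃! g : b ⟶ c, ∀ ⦃x : a⦄ (s : Z.obj x ⟶ F),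
    u.app s ≫ g = v.app s

namespace IsUniversal

variable {u : WCocone k Z h F b} (hu : u.IsUniversal)
include hu

/-- The morphism out of a weighted colimit that a weighted cocone induces. -/
def desc (v : WCocone k Z h F c) : b ⟶ c := (hu v).choose

@[simp]
lemma fac (v : WCocone k Z h F c) {x : a} (s : Z.obj x ⟶ F) : u.app s ≫ hu.desc v = v.app s :=
  (hu v).choose_spec.1 s

lemma hom_ext {f g : b ⟶ c} (hfg : ∀ ⦃x : a⦄ (s : Z.obj x ⟶ F), u.app s ≫ f = u.app s ≫ g) :
    f = g :=
  (hu (u.postcomp g)).unique hfg fun _ _ => rfl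

end IsUniversal

end WCocone

/-! #### Existence of weighted colimits -/

section Existence

variable {k}

namespace WCocone

variable [EssentiallySmall.{w} a] {Z : a ⥤ D} {h : a ⥤ E} {F : D} {b : E}

/-- The embedding of a small skeleton. -/
abbrev skel (a : Type u) [Category.{w} a] [EssentiallySmall.{w} a] : SmallModel.{w} a ⥤ a :=
  (equivSmallModel.{w} a).inverse

/-- The isomorphism of `x` with an object of the small skeleton. -/
abbrev skelIso (x : a) : (skel a).obj ((equivSmallModel.{w} a).functor.obj x) ≅ x :=
  ((equivSmallModel.{w} a).unitIso.app x).symm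

/-- Naturality along the isomorphism of `x` with a skeletal object determines the component at `x`.
This keeps the generators and relations below small. -/
lemma ext_skel {u v : WCocone k Z h F b}
    (huv : ∀ (x : SmallModel.{w} a) (s : Z.obj ((skel a).obj x) ⟶ F), u.app s = v.app s) :
    u = v := by
  ext x s
  have h₁ := u.app_comp (skelIso x).hom s
  have h₂ := v.app_comp (skelIso x).hom s
  rw [huv, h₂] at h₁
  exact ((cancel_epi _).1 h₁).symm

/-- Extension of a weighted cocone from a small skeleton. -/
def extend (u : WCocone k (skel a ⋙ Z) (skel a ⋙ h) F b) : WCocone k Z h F b where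
  app {x} s := h.map (skelIso x).inv ≫
    u.app (x := (equivSmallModel.{w} a).functor.obj x) (Z.map (skelIso x).hom ≫ s)
  lin {x y} r s f t := by
    -- The embedding of the skeleton is full, so the conjugate of `f` by the comparison isomorphisms
    -- comes from a morphism of the skeleton, to which the linearity of `u` applies.
    obtain ⟨g, hg⟩ := (skel a).map_surjective ((skelIso x).hom ≫ f ≫ (skelIso y).inv)
    have e : Z.map (skelIso x).hom ≫ (r • s + Z.map f ≫ t) =
        r • (Z.map (skelIso x).hom ≫ s) + Z.map ((skel a).map g) ≫ Z.map (skelIso y).hom ≫ t := by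
      simp only [hg, ← Functor.map_comp_assoc]
      simp
    rw [e]
    refine (congrArg _ (u.lin r (Z.map (skelIso x).hom ≫ s) g (Z.map (skelIso y).hom ≫ t))).trans ?_
    simp only [Functor.comp_map, hg, ← Functor.map_comp_assoc, Preadditive.comp_add]
    simp

lemma extend_app (u : WCocone k (skel a ⋙ Z) (skel a ⋙ h) F b) (x : SmallModel.{w} a)
    (s : Z.obj ((skel a).obj x) ⟶ F) : u.extend.app s = u.app s := by
  obtain ⟨g, hg⟩ := (skel a).map_surjective (skelIso ((skel a).obj x)).hom
  have := u.app_comp g s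
  simp only [Functor.comp_map, hg] at this
  simp only [extend]
  rw [this, ← Functor.map_comp_assoc]
  simp

end WCocone

/-! #### Generators and relations -/

section Presentation

open WCocone

lemma hasColimitsOfShape_discrete_of_small (J : Type*) [Small.{w} J]
    (C : Type*) [Category* C] [HasColimitsOfSize.{w, w} C] : HasColimitsOfShape (Discrete J) C :=
  hasColimitsOfShape_of_equivalence (Discrete.equivalence (equivShrink.{w} J)).symm

lemma preservesColimitsOfShape_discrete_of_small (J : Type*) [Small.{w} J]
    {C C' : Type*} [Category* C] [Category* C'] (G : C ⥤ C') [PreservesColimitsOfSize.{w, w} G] :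
    PreservesColimitsOfShape (Discrete J) G :=
  preservesColimitsOfShape_of_equiv (Discrete.equivalence (equivShrink.{w} J)).symm G

lemma hasCokernel_of_hasColimitsOfSize {C : Type*} [Category* C] [Preadditive C]
    [HasColimitsOfSize.{w, w} C] {X Y : C} (f : X ⟶ Y) : HasCokernel f := by
  have : HasColimitsOfShape WalkingParallelPair C :=
    hasColimitsOfShape_of_equivalence (ULiftHomULiftCategory.equiv.{w, w} WalkingParallelPair).symm
  infer_instance

lemma preservesColimit_parallelPair_of_size {C C' : Type*} [Category* C] [Category* C']
    (G : C ⥤ C') [PreservesColimitsOfSize.{w, w} G] :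
    PreservesColimitsOfShape WalkingParallelPair G :=
  preservesColimitsOfShape_of_equiv
    (ULiftHomULiftCategory.equiv.{w, w} WalkingParallelPair).symm G

variable [EssentiallySmall.{w} a] (Z : a ⥤ D) (h : a ⥤ E) (F : D)

/-- Generators of the presheaf `Hom(Z -, F)`. -/
abbrev Gen := Σ x : SmallModel.{w} a, Z.obj ((skel a).obj x) ⟶ F

variable (k) in
/-- Relations between the generators of the presheaf `Hom(Z -, F)`. -/
structure Rel where
  {x y : SmallModel.{w} a}
  r : k
  s : Z.obj ((skel a).obj x) ⟶ F
  f : (skel a).obj x ⟶ (skel a).obj y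
  t : Z.obj ((skel a).obj y) ⟶ F

/-- A relation is a tuple whose entries range over small types. Smallness is what makes the
coproduct over all relations available in a cocomplete category. -/
instance [LocallySmall.{w} D] : Small.{w} (Rel k Z F) :=
  small_of_injective (β := Σ (x y : SmallModel.{w} a) (_ : k)
    (_ : Z.obj ((skel a).obj x) ⟶ F) (_ : (skel a).obj x ⟶ (skel a).obj y),
      Z.obj ((skel a).obj y) ⟶ F)
    (f := fun R => ⟨R.x, R.y, R.r, R.s, R.f, R.t⟩) (by
      rintro ⟨⟩ ⟨⟩ h
      cases h
      rfl)

variable [HasCoproduct fun i : Gen Z F => h.obj ((skel a).obj i.1)]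

/-- The coproduct of the diagram over the generators. -/
abbrev genCoprod : E := ∐ fun i : Gen Z F => h.obj ((skel a).obj i.1)

variable {Z F} in
/-- The inclusion at a section. -/
abbrev genι {x : SmallModel.{w} a} (s : Z.obj ((skel a).obj x) ⟶ F) :
    h.obj ((skel a).obj x) ⟶ genCoprod Z h F :=
  Sigma.ι (fun i : Gen Z F => h.obj ((skel a).obj i.1)) ⟨x, s⟩

variable {Z F} in
/-- The defect of linearity of the inclusions. -/
def relHom (R : Rel k Z F) : h.obj ((skel a).obj R.x) ⟶ genCoprod Z h F :=
  genι h (R.r • R.s + Z.map R.f ≫ R.t) - (R.r • genι h R.s + h.map R.f ≫ genι h R.t)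

variable {Z h F} in
/-- The weighted cocone that a morphism annihilating the relations defines. -/
def WCocone.ofGen {c : E} (g : genCoprod Z h F ⟶ c)
    (hg : ∀ R : Rel k Z F, relHom h R ≫ g = 0) : WCocone k Z h F c :=
  extend
    { app := fun s => genι h s ≫ g
      lin := fun {x y} r s f t => by
        have := hg ⟨r, s, (skel a).map f, t⟩
        rw [relHom, Preadditive.sub_comp, sub_eq_zero] at this
        refine Eq.trans this ?_
        rw [Preadditive.add_comp, Linear.smul_comp, Category.assoc]
        rfl }

variable {Z h F} in
lemma WCocone.ofGen_app {c : E} (g : genCoprod Z h F ⟶ c)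
    (hg : ∀ R : Rel k Z F, relHom h R ≫ g = 0) {x : SmallModel.{w} a}
    (s : Z.obj ((skel a).obj x) ⟶ F) : (WCocone.ofGen g hg).app s = genι h s ≫ g :=
  extend_app _ _ _

variable {Z h F} in
/-- The morphism out of the coproduct over the generators that a weighted cocone defines. -/
def WCocone.genDesc {c : E} (u : WCocone k Z h F c) : genCoprod Z h F ⟶ c :=
  Sigma.desc fun i => u.app i.2

variable {Z h F} in
lemma WCocone.genι_genDesc {c : E} (u : WCocone k Z h F c) {x : SmallModel.{w} a}
    (s : Z.obj ((skel a).obj x) ⟶ F) : genι h s ≫ u.genDesc = u.app s := by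
  simp [genDesc]

variable {Z h F} in
lemma WCocone.relHom_genDesc {c : E} (u : WCocone k Z h F c) (R : Rel k Z F) :
    relHom h R ≫ u.genDesc = 0 := by
  simp only [relHom, Preadditive.sub_comp, Preadditive.add_comp, Linear.smul_comp, Category.assoc,
    genι_genDesc, u.lin, sub_self]

variable {Z h F} in
-- A cocone amounts to a morphism out of the coproduct over the generators that kills every
-- relation. Universality is therefore the cokernel property of `u.genDesc`.
lemma WCocone.isUniversal_iff {b : E} (u : WCocone k Z h F b) :
    u.IsUniversal ↔ ∀ (c : E) (g : genCoprod Z h F ⟶ c), (∀ R : Rel k Z F, relHom h R ≫ g = 0) →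
      ∃! g' : b ⟶ c, u.genDesc ≫ g' = g := by
  refine ⟨fun hu c g hg => ?_, fun H c v => ?_⟩
  · refine ⟨hu.desc (WCocone.ofGen g hg), ?_, fun g' hg' => hu.hom_ext fun x s => ?_⟩
    · refine Sigma.hom_ext _ _ fun i => ?_
      have := ofGen_app g hg i.2
      simp only [genDesc]
      simpa using this
    · rw [hu.fac]
      refine congrFun (congrArg (fun v : WCocone k Z h F c => fun s => v.app (x := x) s)
        (ext_skel (u := u.postcomp g') (v := WCocone.ofGen g hg) fun x s => ?_)) s
      rw [postcomp_app, ofGen_app, ← hg', ← Category.assoc, genι_genDesc]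
  · obtain ⟨g', hg', hu⟩ := H c v.genDesc v.relHom_genDesc
    have key : ∀ g' : b ⟶ c, u.genDesc ≫ g' = v.genDesc ↔ u.postcomp g' = v := by
      refine fun g' => ⟨fun h => ext_skel fun x s => ?_, fun h => ?_⟩
      · rw [postcomp_app, ← genι_genDesc, Category.assoc, h, genι_genDesc]
      · subst h
        exact Sigma.hom_ext _ _ fun i => by simp [genDesc]
    refine ⟨g', fun x s => ?_, fun g'' hg'' => hu g'' ((key g'').2 ?_)⟩
    · rw [← (key g').1 hg']; rfl
    · ext x s; exact hg'' s

variable {Z h F} in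
lemma desc_relHom_comp_eq_zero_iff [HasCoproduct fun R : Rel k Z F => h.obj ((skel a).obj R.x)]
    {c : E} (g : genCoprod Z h F ⟶ c) :
    Sigma.desc (fun R : Rel k Z F => relHom h R) ≫ g = 0 ↔
      ∀ R : Rel k Z F, relHom h R ≫ g = 0 :=
  ⟨fun H R => by
    have := Sigma.ι (fun R : Rel k Z F => h.obj ((skel a).obj R.x)) R ≫= H
    simpa using this, fun H => Sigma.hom_ext _ _ fun R => by simpa using H R⟩

end Presentation

section

open WCocone

variable [EssentiallySmall.{w} a] [LocallySmall.{w} D] {Z : a ⥤ D} {h : a ⥤ E} {F : D}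

/-- Weighted colimits exist in a cocomplete category. -/
theorem exists_universal_wcocone [HasColimitsOfSize.{w, w} E] (Z : a ⥤ D) (h : a ⥤ E) (F : D) :
    ∃ (b : E) (u : WCocone k Z h F b), u.IsUniversal := by
  have := hasColimitsOfShape_discrete_of_small.{w} (Gen Z F) E
  have := hasColimitsOfShape_discrete_of_small.{w} (Rel k Z F) E
  -- The weighted colimit is the cokernel of `ρ`: generators modulo relations.
  let ρ : (∐ fun R : Rel k Z F => h.obj ((skel a).obj R.x)) ⟶ genCoprod Z h F :=
    Sigma.desc fun R => relHom h R
  have := hasCokernel_of_hasColimitsOfSize.{w} ρ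
  have hρ : ∀ (c : E) (g : genCoprod Z h F ⟶ c),
      ρ ≫ g = 0 ↔ ∀ R : Rel k Z F, relHom h R ≫ g = 0 := fun c g => desc_relHom_comp_eq_zero_iff g
  refine ⟨cokernel ρ, WCocone.ofGen (cokernel.π ρ) ((hρ _ _).1 (by simp)), ?_⟩
  rw [isUniversal_iff]
  have e : (WCocone.ofGen (cokernel.π ρ) ((hρ _ _).1 (by simp))).genDesc = cokernel.π ρ :=
    Sigma.hom_ext _ _ fun i => by
      have := ofGen_app (cokernel.π ρ) ((hρ _ _).1 (by simp)) i.2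
      simpa [genDesc] using this
  intro c g hg
  rw [e]
  exact ⟨cokernel.desc ρ g ((hρ _ _).2 hg), by simp, fun g' hg' => by
    rw [← cancel_epi (cokernel.π ρ), hg']; simp⟩

/-- Cocontinuous linear functors preserve weighted colimits. -/
theorem WCocone.IsUniversal.mapFunctor [HasColimitsOfSize.{w, w} E] {b : E}
    {u : WCocone k Z h F b} (hu : u.IsUniversal) (G : E ⥤ E') [G.Additive] [G.Linear k]
    [PreservesColimitsOfSize.{w, w} G] : (u.mapFunctor G).IsUniversal := by
  have := hasColimitsOfShape_discrete_of_small.{w} (Gen Z F) E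
  have := hasColimitsOfShape_discrete_of_small.{w} (Rel k Z F) E
  have := preservesColimitsOfShape_discrete_of_small.{w} (Gen Z F) G
  have := preservesColimitsOfShape_discrete_of_small.{w} (Rel k Z F) G
  have := preservesColimit_parallelPair_of_size.{w} G
  let ρ : (∐ fun R : Rel k Z F => h.obj ((skel a).obj R.x)) ⟶ genCoprod Z h F :=
    Sigma.desc fun R => relHom h R
  have hρ : ∀ (c : E) (g : genCoprod Z h F ⟶ c),
      ρ ≫ g = 0 ↔ ∀ R : Rel k Z F, relHom h R ≫ g = 0 := fun c g => desc_relHom_comp_eq_zero_iff g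
  -- Universality exhibits `b` as the cokernel of `ρ`. The functor `G` preserves this cokernel and
  -- both coproducts, so `G.obj b` has the same presentation by generators and relations in `E'`.
  have hu' := (isUniversal_iff u).1 hu
  have hcok : IsColimit (CokernelCofork.ofπ u.genDesc ((hρ _ _).2 u.relHom_genDesc)) :=
    CokernelCofork.IsColimit.ofπ _ _
      (fun g hg => (hu' _ g ((hρ _ _).1 hg)).choose)
      (fun g hg => (hu' _ g ((hρ _ _).1 hg)).choose_spec.1)
      (fun g hg g' hg' => (hu' _ g ((hρ _ _).1 hg)).choose_spec.2 g' hg')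
  have hcok' := CokernelCofork.mapIsColimit _ hcok G
  have hgen := isColimitCofanMkObjOfIsColimit G _ _
    (coproductIsCoproduct fun i : Gen Z F => h.obj ((skel a).obj i.1))
  have hrel := isColimitCofanMkObjOfIsColimit G _ _
    (coproductIsCoproduct fun R : Rel k Z F => h.obj ((skel a).obj R.x))
  intro c v
  let g : G.obj (genCoprod Z h F) ⟶ c := Cofan.IsColimit.desc hgen fun i => v.app i.2
  have hg : ∀ {x : SmallModel.{w} a} (s : Z.obj ((skel a).obj x) ⟶ F),
      G.map (genι h s) ≫ g = v.app s := fun {x} s => Cofan.IsColimit.fac hgen _ ⟨x, s⟩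
  have hg0 : G.map ρ ≫ g = 0 := by
    refine Cofan.IsColimit.hom_ext hrel _ _ fun R => ?_
    have : G.map (relHom h R) ≫ g = 0 := by
      simp only [relHom, G.map_sub, G.map_add, G.map_smul, G.map_comp, Preadditive.sub_comp,
        Preadditive.add_comp, Linear.smul_comp, Category.assoc, hg, v.lin, Functor.comp_map,
        sub_self]
    simpa [ρ, ← Functor.map_comp_assoc] using this
  have key : ∀ g' : G.obj b ⟶ c, G.map u.genDesc ≫ g' = g ↔
      ∀ ⦃x : a⦄ (s : Z.obj x ⟶ F), (u.mapFunctor G).app s ≫ g' = v.app s := by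
    refine fun g' => ⟨fun hg' => ?_, fun hg' => Cofan.IsColimit.hom_ext hgen _ _ fun i => ?_⟩
    · have : (u.mapFunctor G).postcomp g' = v := ext_skel fun x s => by
        rw [postcomp_app, mapFunctor_app, ← genι_genDesc, G.map_comp, Category.assoc, hg', hg]
      intro x s
      rw [← this]; rfl
    · have h₁ := hg i.2
      have h₂ := hg' i.2
      rw [mapFunctor_app, ← genι_genDesc, G.map_comp, Category.assoc, ← h₁] at h₂
      exact h₂
  obtain ⟨g', hg'⟩ := CokernelCofork.IsColimit.desc' hcok' g hg0
  refine ⟨g', (key g').1 hg', fun g'' hg'' => ?_⟩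
  exact Cofork.IsColimit.hom_ext hcok' (((key g'').2 hg'').trans hg'.symm)

end

end Existence

end WCocone

end LinearSite

end

noncomputable section

namespace LinearSite

/-! ### Representability of weighted cocones -/

section Rep

variable {k : Type w} [CommRing k] {a : Type u} [Category.{w} a]
  {D : Type u₁} [Category.{v₁} D] [Preadditive D] [Linear k D]
  {E : Type u₂} [Category.{v₂} E] [Preadditive E] [Linear k E]

variable (k) in
/-- A functor `Z` is linearly dense if each object `F` is the colimit of `Z` weighted by
`Hom(Z -, F)`. -/
def IsLinDense (Z : a ⥤ D) : Prop := ∀ F : D, (WCocone.refl k Z F).IsUniversal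

/-- A weighted cocone represents the presheaf `Hom(h -, b)` if all its components
`Hom(Z x, R) → Hom(h x, b)` are bijections. -/
def WCocone.IsRep {Z : a ⥤ D} {h : a ⥤ E} {R : D} {b : E} (u : WCocone k Z h R b) : Prop :=
  ∀ x : a, Function.Bijective fun s : Z.obj x ⟶ R => u.app s

variable (k) in
/-- All presheaves `Hom(h -, b)` are represented by objects of `D`. -/
def HasRep (Z : a ⥤ D) (h : a ⥤ E) : Prop :=
  ∀ b : E, ∃ (R : D) (u : WCocone k Z h R b), u.IsRep

/-- A class of sections of `F`. -/
abbrev Sections (Z : a ⥤ D) (F : D) := ∀ ⦃x : a⦄, (Z.obj x ⟶ F) → Prop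

/-- A class of sections is generating if it is jointly epimorphic. -/
def Sections.Generates {Z : a ⥤ D} {F : D} (P : Sections Z F) : Prop :=
  ∀ ⦃K : D⦄ (f g : F ⟶ K), (∀ ⦃x : a⦄ (s : Z.obj x ⟶ F), P s → s ≫ f = s ≫ g) → f = g

variable {Z : a ⥤ D} {h : a ⥤ E} {F R : D} {b : E}

lemma IsLinDense.hom_ext (hZ : IsLinDense k Z) {F G : D} {f g : F ⟶ G}
    (hfg : ∀ ⦃x : a⦄ (s : Z.obj x ⟶ F), s ≫ f = s ≫ g) : f = g :=
  (hZ F).hom_ext hfg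

lemma IsLinDense.generates_all (hZ : IsLinDense k Z) (F : D) :
    Sections.Generates (Z := Z) (F := F) fun _ _ => True :=
  fun _ _ _ H => hZ.hom_ext fun _ s => H s trivial

variable (Z) in
/-- The class that consists of the universal section of `Z x`. -/
inductive Sections.Id (x : a) : Sections Z (Z.obj x)
  | mk : Sections.Id x (𝟙 (Z.obj x))

lemma Sections.generates_id (x : a) : (Sections.Id Z x).Generates := fun K f g H => by
  simpa using H _ .mk

/-- Transported through the bijections of `u`, the cocone `v` becomes a cocone under `Z` itself with
vertex `R`, and density turns such a cocone into a morphism `F ⟶ R`. -/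
lemma WCocone.IsRep.exists_lift (hZ : IsLinDense k Z) {u : WCocone k Z h R b} (hu : u.IsRep)
    (v : WCocone k Z h F b) : ∃ f : F ⟶ R, u.precomp f = v := by
  have inv : ∀ {x : a} (g : h.obj x ⟶ b), u.app ((hu x).surjective g).choose = g :=
    fun g => ((hu _).surjective g).choose_spec
  let w : WCocone k Z Z F R :=
    { app := fun {x} s => ((hu x).surjective (v.app s)).choose
      lin := fun r s f t => (hu _).injective (by simp only [u.lin, inv, v.lin]) }
  refine ⟨(hZ F).desc w, ?_⟩
  ext x s
  have := (hZ F).fac w s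
  simp only [refl_app] at this
  rw [precomp_app, this]
  exact inv _

/-- Both cocones are morphisms from `F` to the same representing object, and a generating class of
sections separates those. It lets identities be tested on identity sections or on products of
sections. -/
lemma HasRep.wcocone_ext (hZ : IsLinDense k Z) (hh : HasRep k Z h) {P : Sections Z F}
    (hP : P.Generates) {v v' : WCocone k Z h F b}
    (H : ∀ ⦃x : a⦄ (s : Z.obj x ⟶ F), P s → v.app s = v'.app s) : v = v' := by
  obtain ⟨R, u, hu⟩ := hh b
  obtain ⟨f, rfl⟩ := hu.exists_lift hZ v
  obtain ⟨g, rfl⟩ := hu.exists_lift hZ v'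
  rw [hP f g fun x s hs => (hu x).injective (H s hs)]

/-- This is the existence half of a Yoneda lemma for `Hom(h -, b)`. It holds although `Z` need not
be fully faithful, because the presheaf has the form `Hom(Z -, R)`. The uniqueness half is
`HasRep.wcocone_ext` applied to the identity section. -/
lemma HasRep.exists_app_id (hh : HasRep k Z h) {x : a} (g : h.obj x ⟶ b) :
    ∃ v : WCocone k Z h (Z.obj x) b, v.app (𝟙 _) = g := by
  obtain ⟨R, u, hu⟩ := hh b
  obtain ⟨s, hs⟩ := (hu x).surjective g
  exact ⟨u.precomp s, by simpa using hs⟩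

/-- The linear combination of a weighted cocone with the restriction of another one along a natural
transformation. -/
@[simps]
def WCocone.linComb {h' : a ⥤ E} (c : k) (u : WCocone k Z h F b) (θ : h ⟶ h')
    (v : WCocone k Z h' F b) : WCocone k Z h F b where
  app {x} s := c • u.app s + θ.app x ≫ v.app s
  lin {x y} r s f t := by
    simp only [u.lin, v.lin, smul_add, Preadditive.comp_add, Linear.comp_smul,
      NatTrans.naturality_assoc, smul_smul, mul_comm c]
    abel

end Rep

/-! ### Bilinear cocones -/

section BCocone

variable (k : Type w) [CommRing k] {a : Type u} [Category.{w} a] [MonoidalCategory a]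
  {D : Type u₁} [Category.{v₁} D] [Preadditive D] [Linear k D]
  {E : Type u₂} [Category.{v₂} E] [Preadditive E] [Linear k E]

/-- A `k`-bilinear natural family of maps `Hom(Z x, F) × Hom(Z y, G) → Hom(h (x ⊗ y), b)`. -/
@[ext]
structure BCocone (Z : a ⥤ D) (h : a ⥤ E) (F G : D) (b : E) where
  app {x y : a} (s : Z.obj x ⟶ F) (t : Z.obj y ⟶ G) : h.obj (x ⊗ y) ⟶ b
  lin_left {x x' y : a} (r : k) (s : Z.obj x ⟶ F) (f : x ⟶ x') (s' : Z.obj x' ⟶ F)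
    (t : Z.obj y ⟶ G) : app (r • s + Z.map f ≫ s') t = r • app s t + h.map (f ▷ y) ≫ app s' t
  lin_right {x y y' : a} (r : k) (s : Z.obj x ⟶ F) (t : Z.obj y ⟶ G) (f : y ⟶ y')
    (t' : Z.obj y' ⟶ G) : app s (r • t + Z.map f ≫ t') = r • app s t + h.map (x ◁ f) ≫ app s t'

namespace BCocone

variable {k} {Z : a ⥤ D} {h : a ⥤ E} {F G : D} {b c : E}

/-- A bilinear cocone with its second argument fixed. -/
@[simps]
def atRight (u : BCocone k Z h F G b) {y : a} (t : Z.obj y ⟶ G) :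
    WCocone k Z (tensorRight y ⋙ h) F b where
  app s := u.app s t
  lin r s f s' := u.lin_left r s f s' t

/-- A bilinear cocone with its first argument fixed. -/
@[simps]
def atLeft (u : BCocone k Z h F G b) {x : a} (s : Z.obj x ⟶ F) :
    WCocone k Z (tensorLeft x ⋙ h) G b where
  app t := u.app s t
  lin r t f t' := u.lin_right r s t f t'

/-- Composition with a morphism out of the vertex. -/
@[simps]
def postcomp (u : BCocone k Z h F G b) (g : b ⟶ c) : BCocone k Z h F G c where
  app s t := u.app s t ≫ g
  lin_left r s f s' t := by simp [u.lin_left]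
  lin_right r s t f t' := by simp [u.lin_right]

/-- Restriction along morphisms into the two arguments. -/
@[simps]
def precomp (u : BCocone k Z h F G b) {F' G' : D} (f : F' ⟶ F) (g : G' ⟶ G) :
    BCocone k Z h F' G' b where
  app s t := u.app (s ≫ f) (t ≫ g)
  lin_left r s f s' t := by simp [u.lin_left]
  lin_right r s t f t' := by simp [u.lin_right]

/-- A bilinear cocone is universal if every other one factors uniquely through it. -/
def IsUniversal (u : BCocone k Z h F G b) : Prop :=
  ∀ ⦃c : E⦄ (v : BCocone k Z h F G c), ∃! g : b ⟶ c, ∀ ⦃x y : a⦄ (s : Z.obj x ⟶ F)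
    (t : Z.obj y ⟶ G), u.app s t ≫ g = v.app s t

namespace IsUniversal

variable {u : BCocone k Z h F G b} (hu : u.IsUniversal)
include hu

/-- The morphism induced by a bilinear cocone. -/
def desc (v : BCocone k Z h F G c) : b ⟶ c := (hu v).choose

@[simp]
lemma fac (v : BCocone k Z h F G c) {x y : a} (s : Z.obj x ⟶ F) (t : Z.obj y ⟶ G) :
    u.app s t ≫ hu.desc v = v.app s t :=
  (hu v).choose_spec.1 s t

@[simp]
lemma fac_assoc (v : BCocone k Z h F G c) {x y : a} (s : Z.obj x ⟶ F) (t : Z.obj y ⟶ G) {d : E}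
    (g : c ⟶ d) : u.app s t ≫ hu.desc v ≫ g = v.app s t ≫ g := by
  rw [← Category.assoc, hu.fac]

lemma hom_ext {f g : b ⟶ c} (hfg : ∀ ⦃x y : a⦄ (s : Z.obj x ⟶ F) (t : Z.obj y ⟶ G),
    u.app s t ≫ f = u.app s t ≫ g) : f = g :=
  (hu (u.postcomp g)).unique hfg fun _ _ _ _ => rfl

end IsUniversal

/-- Weighted cocones out of a representing object of bilinear cocones. -/
lemma IsUniversal.exists_wcocone (hh : HasRep k Z h) {T : D}
    {u : BCocone k Z Z F G T} (hu : u.IsUniversal) (v : BCocone k Z h F G b) :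
    ∃ w : WCocone k Z h T b, ∀ ⦃x y : a⦄ (s : Z.obj x ⟶ F) (t : Z.obj y ⟶ G),
      w.app (u.app s t) = v.app s t := by
  obtain ⟨R, ρ, hρ⟩ := hh b
  have inv : ∀ {x : a} (g : h.obj x ⟶ b), ρ.app ((hρ x).surjective g).choose = g :=
    fun g => ((hρ _).surjective g).choose_spec
  let v' : BCocone k Z Z F G R :=
    { app := fun s t => ((hρ _).surjective (v.app s t)).choose
      lin_left := fun r s f s' t => (hρ _).injective (by simp only [ρ.lin, inv, v.lin_left])
      lin_right := fun r s t f t' => (hρ _).injective (by simp only [ρ.lin, inv, v.lin_right]) }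
  refine ⟨ρ.precomp (hu.desc v'), fun x y s t => ?_⟩
  rw [WCocone.precomp_app, hu.fac]
  exact inv _

lemma IsUniversal.wcocone_ext (hZ : IsLinDense k Z) (hh : HasRep k Z h) {T : D}
    {u : BCocone k Z Z F G T} (hu : u.IsUniversal) {w w' : WCocone k Z h T b}
    (H : ∀ ⦃x y : a⦄ (s : Z.obj x ⟶ F) (t : Z.obj y ⟶ G), w.app (u.app s t) = w'.app (u.app s t)) :
    w = w' := by
  obtain ⟨R, ρ, hρ⟩ := hh b
  obtain ⟨f, rfl⟩ := hρ.exists_lift hZ w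
  obtain ⟨g, rfl⟩ := hρ.exists_lift hZ w'
  rw [hu.hom_ext fun x y s t => (hρ _).injective (H s t)]

end BCocone

variable {k} in
-- The universal bilinear cocone is an iterated weighted colimit: first in the second variable for
-- each fixed `x`, which gives a functor of `x`, then in the first.
theorem exists_universal_bcocone [EssentiallySmall.{w} a] [LocallySmall.{w} D]
    [HasColimitsOfSize.{w, w} E] (Z : a ⥤ D) (h : a ⥤ E) (F G : D) :
    ∃ (b : E) (u : BCocone k Z h F G b), u.IsUniversal := by
  choose L v hv using fun x : a => exists_universal_wcocone (k := k) Z (tensorLeft x ⋙ h) G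
  let w {x x' : a} (f : x ⟶ x') : WCocone k Z (tensorLeft x ⋙ h) G (L x') :=
    (v x').ofNatTrans (Functor.whiskerRight ((curriedTensor a).map f) h)
  have hw {x x' y : a} (f : x ⟶ x') (t : Z.obj y ⟶ G) :
      (v x).app t ≫ (hv x).desc (w f) = h.map (f ▷ y) ≫ (v x').app t := (hv x).fac _ t
  let Lf : a ⥤ E :=
    { obj := L
      map := fun {x x'} f => (hv x).desc (w f)
      map_id := fun x => (hv x).hom_ext fun y t => by simp [hw]
      map_comp := fun {x x' x''} f g => (hv x).hom_ext fun y t => by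
        rw [hw, ← Category.assoc, hw, Category.assoc, hw, comp_whiskerRight, h.map_comp,
          Category.assoc] }
  obtain ⟨c, U, hU⟩ := exists_universal_wcocone (k := k) Z Lf F
  refine ⟨c, ⟨fun {x y} s t => (v x).app t ≫ U.app s, fun {x x' y} r s f s' t => ?_,
    fun {x y y'} r s t f t' => ?_⟩, fun d β => ?_⟩
  · have : (v x).app t ≫ Lf.map f = h.map (f ▷ y) ≫ (v x').app t := hw f t
    simp [U.lin, reassoc_of% this]
  · simp [(v x).lin]
  · let β' : WCocone k Z Lf F d :=
      { app := fun {x} s => (hv x).desc (β.atLeft s)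
        lin := fun {x x'} r s f s' => (hv x).hom_ext fun y t => by
          have : (v x).app t ≫ Lf.map f = h.map (f ▷ y) ≫ (v x').app t := hw f t
          simp [β.lin_left, reassoc_of% this] }
    refine ⟨hU.desc β', fun x y s t => ?_, fun g hg => hU.hom_ext fun x s => ?_⟩
    · simp [β']
    · rw [hU.fac]
      exact (hv x).hom_ext fun y t => by
        have := hg s t
        rw [Category.assoc] at this
        simpa [β'] using this

end BCocone

end LinearSite

end
noncomputable section

namespace LinearSite

/-! ### The tensor product of a linearly dense functor -/

section TensorSystem

variable (k : Type w) [CommRing k] {a : Type u} [Category.{w} a] [MonoidalCategory a]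
  {D : Type u₁} [Category.{v₁} D] [Preadditive D] [Linear k D]

/-- A linearly dense functor with universal bilinear cocones, such that the presheaves
`Hom(Z (x ⊗ -), G)` and `Hom(Z (- ⊗ x), G)` are represented. -/
structure TensorSystem (Z : a ⥤ D) where
  dense : IsLinDense k Z
  repLeft (x : a) : HasRep k Z (tensorLeft x ⋙ Z)
  repRight (x : a) : HasRep k Z (tensorRight x ⋙ Z)
  obj (F G : D) : D
  tm (F G : D) : BCocone k Z Z F G (obj F G)
  univ (F G : D) : (tm F G).IsUniversal

namespace TensorSystem

variable {k} {Z : a ⥤ D} (τ : TensorSystem k Z)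

/-- The tensor product of two sections. -/
abbrev mul {F G : D} {x y : a} (s : Z.obj x ⟶ F) (t : Z.obj y ⟶ G) : Z.obj (x ⊗ y) ⟶ τ.obj F G :=
  (τ.tm F G).app s t

lemma map_comp_mul {F G : D} {x x' y y' : a} (f : x ⟶ x') (g : y ⟶ y') (s : Z.obj x' ⟶ F)
    (t : Z.obj y' ⟶ G) : τ.mul (Z.map f ≫ s) (Z.map g ≫ t) = Z.map (f ⊗ₘ g) ≫ τ.mul s t := by
  have h₁ := ((τ.tm F G).atRight (Z.map g ≫ t)).app_comp f s
  have h₂ := ((τ.tm F G).atLeft s).app_comp g t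
  simp only [BCocone.atRight_app, BCocone.atLeft_app, Functor.comp_map,
    curriedTensor_obj_map, Functor.flip_obj_map, curriedTensor_map_app] at h₁ h₂
  rw [mul, h₁, h₂, ← Category.assoc, ← Z.map_comp, MonoidalCategory.tensorHom_def]

lemma map_comp_mul_left {F G : D} {x x' y : a} (f : x ⟶ x') (s : Z.obj x' ⟶ F)
    (t : Z.obj y ⟶ G) : τ.mul (Z.map f ≫ s) t = Z.map (f ▷ y) ≫ τ.mul s t := by
  simpa using τ.map_comp_mul f (𝟙 y) s t

lemma map_comp_mul_right {F G : D} {x y y' : a} (g : y ⟶ y') (s : Z.obj x ⟶ F)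
    (t : Z.obj y' ⟶ G) : τ.mul s (Z.map g ≫ t) = Z.map (x ◁ g) ≫ τ.mul s t := by
  simpa using τ.map_comp_mul (𝟙 x) g s t

/-- Tensor products of generating sections. -/
inductive TmSections {F G : D} (P : Sections Z F) (Q : Sections Z G) : Sections Z (τ.obj F G)
  | mk {x y : a} {s : Z.obj x ⟶ F} {t : Z.obj y ⟶ G} (hs : P s) (ht : Q t) :
    TmSections P Q (τ.mul s t)

/-- With one section fixed, a morphism out of the tensor product is a weighted cocone under `Z (- ⊗
y)` or `Z (x ⊗ -)`. Both kinds are determined on generating sections by `repRight` and `repLeft`, so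
the two variables can be treated one after the other. -/
lemma generates_tm {F G : D} {P : Sections Z F} {Q : Sections Z G} (hP : P.Generates)
    (hQ : Q.Generates) : (TmSections τ P Q).Generates := by
  intro K f g H
  refine (τ.univ F G).hom_ext fun x y s t => ?_
  have h₁ : ∀ ⦃y : a⦄ (t : Z.obj y ⟶ G), Q t →
      ((τ.tm F G).postcomp f).atRight t = ((τ.tm F G).postcomp g).atRight t := fun y t ht =>
    (τ.repRight y).wcocone_ext τ.dense hP fun x s hs => H _ (.mk hs ht)
  have h₂ : ((τ.tm F G).postcomp f).atLeft s = ((τ.tm F G).postcomp g).atLeft s :=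
    (τ.repLeft x).wcocone_ext τ.dense hQ fun y t ht =>
      congrArg (fun w : WCocone k Z (tensorRight y ⋙ Z) F K => w.app s) (h₁ t ht)
  exact congrArg (fun w : WCocone k Z (tensorLeft x ⋙ Z) G K => w.app t) h₂

/-- The tensor product of morphisms. -/
def map {F F' G G' : D} (f : F ⟶ F') (g : G ⟶ G') : τ.obj F G ⟶ τ.obj F' G' :=
  (τ.univ F G).desc ((τ.tm F' G').precomp f g)

@[simp]
lemma mul_map {F F' G G' : D} (f : F ⟶ F') (g : G ⟶ G') {x y : a} (s : Z.obj x ⟶ F)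
    (t : Z.obj y ⟶ G) : τ.mul s t ≫ τ.map f g = τ.mul (s ≫ f) (t ≫ g) :=
  (τ.univ F G).fac _ _ _

@[simp]
lemma mul_map_assoc {F F' G G' K : D} (f : F ⟶ F') (g : G ⟶ G') {x y : a} (s : Z.obj x ⟶ F)
    (t : Z.obj y ⟶ G) (p : τ.obj F' G' ⟶ K) :
    τ.mul s t ≫ τ.map f g ≫ p = τ.mul (s ≫ f) (t ≫ g) ≫ p := by
  rw [← Category.assoc, mul_map]

/-- The tensor product `F ⊗ Z y` corepresents weighted cocones under `Z (- ⊗ y)`. -/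
lemma exists_desc_right {F K : D} {y : a} (w : WCocone k Z (tensorRight y ⋙ Z) F K) :
    ∃ f : τ.obj F (Z.obj y) ⟶ K, ∀ ⦃x : a⦄ (s : Z.obj x ⟶ F), τ.mul s (𝟙 _) ≫ f = w.app s := by
  -- For fixed `s` the value `w.app s` is prescribed at the identity section of `Z y` and extended
  -- to a cocone in the second variable. Extensions are unique, and this gives linearity in `s`.
  choose p hp using fun (x : a) (s : Z.obj x ⟶ F) =>
    (τ.repLeft x).exists_app_id (x := y) (b := K) (w.app s)
  let β : BCocone k Z Z F (Z.obj y) K :=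
    { app := fun {x y'} s t => (p x s).app t
      lin_left := fun {x x' y'} r s f s' t => by
        let q := (p x s).linComb r (Functor.whiskerRight ((curriedTensor a).map f) Z) (p x' s')
        have : p x (r • s + Z.map f ≫ s') = q :=
          (τ.repLeft x).wcocone_ext τ.dense (Sections.generates_id y) fun _ _ hs => by
            cases hs
            simp [hp, q, w.lin]
        rw [this]; rfl
      lin_right := fun r s t f t' => (p _ s).lin r t f t' }
  exact ⟨(τ.univ _ _).desc β, fun x s => by rw [(τ.univ _ _).fac]; exact hp x s⟩

/-- The tensor product `Z x ⊗ G` corepresents weighted cocones under `Z (x ⊗ -)`. -/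
lemma exists_desc_left {G K : D} {x : a} (w : WCocone k Z (tensorLeft x ⋙ Z) G K) :
    ∃ f : τ.obj (Z.obj x) G ⟶ K, ∀ ⦃y : a⦄ (t : Z.obj y ⟶ G), τ.mul (𝟙 _) t ≫ f = w.app t := by
  choose p hp using fun (y : a) (t : Z.obj y ⟶ G) =>
    (τ.repRight y).exists_app_id (x := x) (b := K) (w.app t)
  let β : BCocone k Z Z (Z.obj x) G K :=
    { app := fun {x' y} s t => (p y t).app s
      lin_left := fun r s f s' t => (p _ t).lin r s f s'
      lin_right := fun {x' y y'} r s t f t' => by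
        let q := (p y t).linComb r (Functor.whiskerRight ((curriedTensor a).flip.map f) Z) (p y' t')
        have : p y (r • t + Z.map f ≫ t') = q :=
          (τ.repRight y).wcocone_ext τ.dense (Sections.generates_id x) fun _ _ hs => by
            cases hs
            simp [hp, q, w.lin]
        rw [this]; rfl }
  exact ⟨(τ.univ _ _).desc β, fun y t => by rw [(τ.univ _ _).fac]; exact hp y t⟩

/-- A `k`-trilinear natural family of maps. -/
structure TCocone (Z : a ⥤ D) (F G H K : D) where
  app {x y z : a} (s : Z.obj x ⟶ F) (t : Z.obj y ⟶ G) (r : Z.obj z ⟶ H) :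
    Z.obj ((x ⊗ y) ⊗ z) ⟶ K
  lin₁ {x x' y z : a} (c : k) (s : Z.obj x ⟶ F) (f : x ⟶ x') (s' : Z.obj x' ⟶ F)
    (t : Z.obj y ⟶ G) (r : Z.obj z ⟶ H) :
    app (c • s + Z.map f ≫ s') t r = c • app s t r + Z.map (f ▷ y ▷ z) ≫ app s' t r
  lin₂ {x y y' z : a} (c : k) (s : Z.obj x ⟶ F) (t : Z.obj y ⟶ G) (f : y ⟶ y')
    (t' : Z.obj y' ⟶ G) (r : Z.obj z ⟶ H) :
    app s (c • t + Z.map f ≫ t') r = c • app s t r + Z.map ((x ◁ f) ▷ z) ≫ app s t' r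
  lin₃ {x y z z' : a} (c : k) (s : Z.obj x ⟶ F) (t : Z.obj y ⟶ G) (r : Z.obj z ⟶ H)
    (f : z ⟶ z') (r' : Z.obj z' ⟶ H) :
    app s t (c • r + Z.map f ≫ r') = c • app s t r + Z.map ((x ⊗ y) ◁ f) ≫ app s t r'

variable {F G H K : D}

/-- For fixed `r` the family is bilinear in `s` and `t` with values in the represented presheaf
`Hom(Z (- ⊗ z), K)`, so it factors through `F ⊗ G`. Uniqueness of the factorisation makes the result
linear in `r`. -/
lemma exists_desc_left_assoc (v : TCocone (k := k) Z F G H K) :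
    ∃ f : τ.obj (τ.obj F G) H ⟶ K, ∀ ⦃x y z : a⦄ (s : Z.obj x ⟶ F) (t : Z.obj y ⟶ G)
      (r : Z.obj z ⟶ H), τ.mul (τ.mul s t) r ≫ f = v.app s t r := by
  choose p hp using fun (z : a) (r : Z.obj z ⟶ H) =>
    (τ.univ F G).exists_wcocone (τ.repRight z) (b := K)
      ⟨fun s t => v.app s t r, fun c s f s' t => v.lin₁ c s f s' t r,
        fun c s t f t' => v.lin₂ c s t f t' r⟩
  let β : BCocone k Z Z (τ.obj F G) H K :=
    { app := fun {x' y} s t => (p y t).app s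
      lin_left := fun r s f s' t => (p _ t).lin r s f s'
      lin_right := fun {x' y y'} r s t f t' => by
        let q := (p y t).linComb r (Functor.whiskerRight ((curriedTensor a).flip.map f) Z) (p y' t')
        have : p y (r • t + Z.map f ≫ t') = q :=
          (τ.univ F G).wcocone_ext τ.dense (τ.repRight y) fun _ _ s t => by
            simp [hp, q, v.lin₃]
        rw [this]; rfl }
  exact ⟨(τ.univ _ _).desc β, fun x y z s t r => by rw [(τ.univ _ _).fac]; exact hp z r s t⟩

lemma exists_desc_right_assoc (v : TCocone (k := k) Z F G H K) :
    ∃ f : τ.obj F (τ.obj G H) ⟶ K, ∀ ⦃x y z : a⦄ (s : Z.obj x ⟶ F) (t : Z.obj y ⟶ G)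
      (r : Z.obj z ⟶ H), τ.mul s (τ.mul t r) ≫ f = Z.map (α_ x y z).inv ≫ v.app s t r := by
  -- Trilinear families are bracketed on the left, so the associator of `a` enters before the last
  -- two variables can be merged.
  choose p hp using fun (x : a) (s : Z.obj x ⟶ F) =>
    (τ.univ G H).exists_wcocone (τ.repLeft x) (b := K)
      ⟨fun {y z} t r => Z.map (α_ x y z).inv ≫ v.app s t r, fun c t f t' r => by
        simp only [v.lin₂, Preadditive.comp_add, Linear.comp_smul, ← Z.map_comp_assoc,
          Functor.comp_map, curriedTensor_obj_map]
        congr 3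
        simp, fun c t r f r' => by
        simp only [v.lin₃, Preadditive.comp_add, Linear.comp_smul, ← Z.map_comp_assoc,
          Functor.comp_map, curriedTensor_obj_map]
        congr 3
        simp⟩
  let β : BCocone k Z Z F (τ.obj G H) K :=
    { app := fun {x y'} s t => (p x s).app t
      lin_left := fun {x x' y'} r s f s' t => by
        let q := (p x s).linComb r (Functor.whiskerRight ((curriedTensor a).map f) Z) (p x' s')
        have : p x (r • s + Z.map f ≫ s') = q :=
          (τ.univ G H).wcocone_ext τ.dense (τ.repLeft x) fun _ _ t t' => by
            simp only [hp, q, WCocone.linComb_app, v.lin₁, Preadditive.comp_add, Linear.comp_smul,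
              Functor.whiskerRight_app, curriedTensor_map_app, ← Z.map_comp_assoc]
            congr 3
            simp
        rw [this]; rfl
      lin_right := fun r s t f t' => (p _ s).lin r t f t' }
  exact ⟨(τ.univ _ _).desc β, fun x y z s t r => by rw [(τ.univ _ _).fac]; exact hp x s t r⟩

variable (F G H)

lemma exists_assocHom : ∃ f : τ.obj (τ.obj F G) H ⟶ τ.obj F (τ.obj G H),
    ∀ ⦃x y z : a⦄ (s : Z.obj x ⟶ F) (t : Z.obj y ⟶ G) (r : Z.obj z ⟶ H),
      τ.mul (τ.mul s t) r ≫ f = Z.map (α_ x y z).hom ≫ τ.mul s (τ.mul t r) :=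
  τ.exists_desc_left_assoc
    { app := fun {x y z} s t r => Z.map (α_ x y z).hom ≫ τ.mul s (τ.mul t r)
      lin₁ := fun c s f s' t r => by
        simp only [mul, (τ.tm _ _).lin_left, Preadditive.comp_add, Linear.comp_smul,
          ← Z.map_comp_assoc]
        congr 3
        simp
      lin₂ := fun c s t f t' r => by
        simp only [mul, (τ.tm _ _).lin_left, (τ.tm _ _).lin_right, Preadditive.comp_add,
          Linear.comp_smul, ← Z.map_comp_assoc]
        congr 3
        simp
      lin₃ := fun c s t r f r' => by
        simp only [mul, (τ.tm _ _).lin_right, Preadditive.comp_add, Linear.comp_smul,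
          ← Z.map_comp_assoc]
        congr 3
        simp }

lemma exists_assocInv : ∃ f : τ.obj F (τ.obj G H) ⟶ τ.obj (τ.obj F G) H,
    ∀ ⦃x y z : a⦄ (s : Z.obj x ⟶ F) (t : Z.obj y ⟶ G) (r : Z.obj z ⟶ H),
      τ.mul s (τ.mul t r) ≫ f = Z.map (α_ x y z).inv ≫ τ.mul (τ.mul s t) r :=
  τ.exists_desc_right_assoc
    { app := fun {x y z} s t r => τ.mul (τ.mul s t) r
      lin₁ := fun c s f s' t r => by simp only [mul, (τ.tm _ _).lin_left]
      lin₂ := fun c s t f t' r => by simp only [mul, (τ.tm _ _).lin_left, (τ.tm _ _).lin_right]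
      lin₃ := fun c s t r f r' => by simp only [mul, (τ.tm _ _).lin_right] }

/-- The class of all sections. -/
def all (F : D) : Sections Z F := fun _ _ => True

include τ in
lemma generates_all : (all (Z := Z) F).Generates := τ.dense.generates_all F

/-- The associator. -/
def assoc : τ.obj (τ.obj F G) H ≅ τ.obj F (τ.obj G H) where
  hom := (τ.exists_assocHom F G H).choose
  inv := (τ.exists_assocInv F G H).choose
  hom_inv_id := by
    refine τ.generates_tm (τ.generates_tm (τ.generates_all F) (τ.generates_all G))
      (τ.generates_all H) _ _ ?_
    rintro _ _ ⟨⟨-, -⟩, -⟩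
    rw [← Category.assoc, (τ.exists_assocHom F G H).choose_spec, Category.assoc,
      (τ.exists_assocInv F G H).choose_spec, ← Category.assoc, ← Z.map_comp]
    simp
  inv_hom_id := by
    refine τ.generates_tm (τ.generates_all F)
      (τ.generates_tm (τ.generates_all G) (τ.generates_all H)) _ _ ?_
    rintro _ _ ⟨-, ⟨-, -⟩⟩
    rw [← Category.assoc, (τ.exists_assocInv F G H).choose_spec, Category.assoc,
      (τ.exists_assocHom F G H).choose_spec, ← Category.assoc, ← Z.map_comp]
    simp

variable {F G H}

@[simp]
lemma mul_assoc_hom {x y z : a} (s : Z.obj x ⟶ F) (t : Z.obj y ⟶ G) (r : Z.obj z ⟶ H) :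
    τ.mul (τ.mul s t) r ≫ (τ.assoc F G H).hom = Z.map (α_ x y z).hom ≫ τ.mul s (τ.mul t r) :=
  (τ.exists_assocHom F G H).choose_spec s t r

@[simp]
lemma mul_assoc_hom_assoc {x y z : a} (s : Z.obj x ⟶ F) (t : Z.obj y ⟶ G) (r : Z.obj z ⟶ H)
    (p : τ.obj F (τ.obj G H) ⟶ K) : τ.mul (τ.mul s t) r ≫ (τ.assoc F G H).hom ≫ p =
      Z.map (α_ x y z).hom ≫ τ.mul s (τ.mul t r) ≫ p := by
  rw [← Category.assoc, mul_assoc_hom, Category.assoc]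

variable (F)

lemma exists_leftUnitor : ∃ f : τ.obj (Z.obj (𝟙_ a)) F ⟶ F, ∀ ⦃y : a⦄ (t : Z.obj y ⟶ F),
    τ.mul (𝟙 _) t ≫ f = Z.map (λ_ y).hom ≫ t :=
  τ.exists_desc_left
    { app := fun {y} t => Z.map (λ_ y).hom ≫ t
      lin := fun r s f t => by
        simp only [Preadditive.comp_add, Linear.comp_smul, ← Z.map_comp_assoc, Functor.comp_map]
        congr 3
        simp }

lemma exists_rightUnitor : ∃ f : τ.obj F (Z.obj (𝟙_ a)) ⟶ F, ∀ ⦃x : a⦄ (s : Z.obj x ⟶ F),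
    τ.mul s (𝟙 _) ≫ f = Z.map (ρ_ x).hom ≫ s :=
  τ.exists_desc_right
    { app := fun {y} t => Z.map (ρ_ y).hom ≫ t
      lin := fun r s f t => by
        simp only [Preadditive.comp_add, Linear.comp_smul, ← Z.map_comp_assoc, Functor.comp_map]
        congr 3
        simp }

/-- The inverse of the left unitor on sections. -/
@[simps]
def leftUnitorInv : WCocone k Z Z F (τ.obj (Z.obj (𝟙_ a)) F) where
  app {y} t := Z.map (λ_ y).inv ≫ τ.mul (𝟙 _) t
  lin r s f t := by
    simp only [mul, (τ.tm _ _).lin_right, Preadditive.comp_add, Linear.comp_smul,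
      ← Z.map_comp_assoc]
    congr 3
    simp

/-- The left unitor. -/
def leftUnitor : τ.obj (Z.obj (𝟙_ a)) F ≅ F where
  hom := (τ.exists_leftUnitor F).choose
  inv := (τ.dense F).desc (τ.leftUnitorInv F)
  hom_inv_id := by
    refine τ.generates_tm (Sections.generates_id _) (τ.generates_all F) _ _ ?_
    rintro _ _ ⟨⟨⟩, -⟩
    rename_i s
    have := (τ.dense F).fac (τ.leftUnitorInv F) s
    simp only [WCocone.refl_app] at this
    rw [← Category.assoc, (τ.exists_leftUnitor F).choose_spec, Category.assoc, this,
      leftUnitorInv_app, ← Category.assoc, ← Z.map_comp]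
    simp
  inv_hom_id := τ.dense.hom_ext fun x s => by
    have := (τ.dense F).fac (τ.leftUnitorInv F) s
    simp only [WCocone.refl_app] at this
    rw [← Category.assoc, this, leftUnitorInv_app, Category.assoc, (τ.exists_leftUnitor F).choose_spec,
      ← Category.assoc, ← Z.map_comp]
    simp

/-- The inverse of the right unitor on sections. -/
@[simps]
def rightUnitorInv : WCocone k Z Z F (τ.obj F (Z.obj (𝟙_ a))) where
  app {y} t := Z.map (ρ_ y).inv ≫ τ.mul t (𝟙 _)
  lin r s f t := by
    simp only [mul, (τ.tm _ _).lin_left, Preadditive.comp_add, Linear.comp_smul,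
      ← Z.map_comp_assoc]
    congr 3
    simp

/-- The right unitor. -/
def rightUnitor : τ.obj F (Z.obj (𝟙_ a)) ≅ F where
  hom := (τ.exists_rightUnitor F).choose
  inv := (τ.dense F).desc (τ.rightUnitorInv F)
  hom_inv_id := by
    refine τ.generates_tm (τ.generates_all F) (Sections.generates_id _) _ _ ?_
    rintro _ _ ⟨-, ⟨⟩⟩
    rename_i s
    have := (τ.dense F).fac (τ.rightUnitorInv F) s
    simp only [WCocone.refl_app] at this
    rw [← Category.assoc, (τ.exists_rightUnitor F).choose_spec, Category.assoc, this,
      rightUnitorInv_app, ← Category.assoc, ← Z.map_comp]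
    simp
  inv_hom_id := τ.dense.hom_ext fun x s => by
    have := (τ.dense F).fac (τ.rightUnitorInv F) s
    simp only [WCocone.refl_app] at this
    rw [← Category.assoc, this, rightUnitorInv_app, Category.assoc, (τ.exists_rightUnitor F).choose_spec,
      ← Category.assoc, ← Z.map_comp]
    simp

variable {F}

@[simp]
lemma mul_leftUnitor_hom {y : a} (t : Z.obj y ⟶ F) :
    τ.mul (𝟙 _) t ≫ (τ.leftUnitor F).hom = Z.map (λ_ y).hom ≫ t :=
  (τ.exists_leftUnitor F).choose_spec t

@[simp]
lemma mul_rightUnitor_hom {y : a} (t : Z.obj y ⟶ F) :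
    τ.mul t (𝟙 _) ≫ (τ.rightUnitor F).hom = Z.map (ρ_ y).hom ≫ t :=
  (τ.exists_rightUnitor F).choose_spec t

/-- The monoidal structure of a tensor system. -/
abbrev monoidalCategory : MonoidalCategory D :=
  letI : MonoidalCategoryStruct D :=
    { tensorObj := τ.obj
      whiskerLeft := fun F _ _ g => τ.map (𝟙 F) g
      whiskerRight := fun f G => τ.map f (𝟙 G)
      tensorHom := τ.map
      tensorUnit := Z.obj (𝟙_ a)
      associator := τ.assoc
      leftUnitor := τ.leftUnitor
      rightUnitor := τ.rightUnitor }
  -- All axioms are compared on products of sections. There they reduce to bifunctoriality on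
  -- sections or to the corresponding axiom of `a` transported by `Z`. For a factor `Z (𝟙_ a)` the
  -- identity section alone suffices.
  MonoidalCategory.ofTensorHom
    (id_tensorHom_id := fun F G => (τ.univ F G).hom_ext fun x y s t => by
      change τ.mul s t ≫ τ.map (𝟙 _) (𝟙 _) = τ.mul s t ≫ 𝟙 _
      simp)
    (tensorHom_comp_tensorHom := fun f g f' g' => (τ.univ _ _).hom_ext fun x y s t => by
      change τ.mul s t ≫ τ.map _ _ ≫ τ.map _ _ = τ.mul s t ≫ τ.map _ _
      simp)
    (associator_naturality := fun f g h => by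
      refine τ.generates_tm (τ.generates_tm (τ.generates_all _) (τ.generates_all _))
        (τ.generates_all _) _ _ ?_
      rintro _ _ ⟨⟨-, -⟩, -⟩
      change τ.mul _ _ ≫ τ.map (τ.map _ _) _ ≫ (τ.assoc _ _ _).hom =
        τ.mul _ _ ≫ (τ.assoc _ _ _).hom ≫ τ.map _ (τ.map _ _)
      simp)
    (leftUnitor_naturality := fun {X Y} f => by
      refine τ.generates_tm (Sections.generates_id _) (τ.generates_all _) _ _ ?_
      rintro _ _ ⟨⟨⟩, -⟩
      change τ.mul _ _ ≫ τ.map (𝟙 _) _ ≫ (τ.leftUnitor _).hom = τ.mul _ _ ≫ (τ.leftUnitor _).hom ≫ f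
      rw [mul_map_assoc, Category.comp_id, mul_leftUnitor_hom, ← Category.assoc, ← Category.assoc,
        mul_leftUnitor_hom])
    (rightUnitor_naturality := fun {X Y} f => by
      refine τ.generates_tm (τ.generates_all _) (Sections.generates_id _) _ _ ?_
      rintro _ _ ⟨-, ⟨⟩⟩
      change τ.mul _ _ ≫ τ.map _ (𝟙 _) ≫ (τ.rightUnitor _).hom =
        τ.mul _ _ ≫ (τ.rightUnitor _).hom ≫ f
      rw [mul_map_assoc, Category.comp_id, mul_rightUnitor_hom, ← Category.assoc, ← Category.assoc,
        mul_rightUnitor_hom])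
    (pentagon := fun W X Y V => by
      refine τ.generates_tm (τ.generates_tm (τ.generates_tm (τ.generates_all _)
        (τ.generates_all _)) (τ.generates_all _)) (τ.generates_all _) _ _ ?_
      rintro _ _ ⟨⟨⟨-, -⟩, -⟩, -⟩
      change τ.mul _ _ ≫ τ.map (τ.assoc _ _ _).hom (𝟙 _) ≫ (τ.assoc _ _ _).hom ≫
        τ.map (𝟙 _) (τ.assoc _ _ _).hom = τ.mul _ _ ≫ (τ.assoc _ _ _).hom ≫ (τ.assoc _ _ _).hom
      simp only [mul_map_assoc, mul_assoc_hom, mul_assoc_hom_assoc, mul_map, Category.comp_id,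
        map_comp_mul_left, map_comp_mul_right, ← Z.map_comp_assoc, Category.assoc]
      simp only [← MonoidalCategory.pentagon])
    (triangle := fun X Y => by
      refine τ.generates_tm (τ.generates_tm (τ.generates_all _)
        (Sections.generates_id _)) (τ.generates_all _) _ _ ?_
      rintro _ _ ⟨⟨-, ⟨⟩⟩, -⟩
      change τ.mul _ _ ≫ (τ.assoc _ _ _).hom ≫ τ.map (𝟙 _) (τ.leftUnitor _).hom =
        τ.mul _ _ ≫ τ.map (τ.rightUnitor _).hom (𝟙 _)
      rw [mul_assoc_hom_assoc, mul_map, mul_map, Category.comp_id, Category.comp_id,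
        mul_leftUnitor_hom, mul_rightUnitor_hom, map_comp_mul_left, map_comp_mul_right,
        ← Z.map_comp_assoc, MonoidalCategory.triangle])

end TensorSystem

end TensorSystem

end LinearSite

end
-- Monoidality of `Z` and adjoints of the tensor functors
noncomputable section

namespace LinearSite

/-- A functor is a left adjoint if each object admits a universal morphism from its values. -/
lemma isLeftAdjoint_of_exists_couniversal {C C' : Type*} [Category* C] [Category* C'] (L : C ⥤ C')
    (H : ∀ K : C', ∃ (R : C) (ε : L.obj R ⟶ K), ∀ G : C,
      Function.Bijective fun g : G ⟶ R => L.map g ≫ ε) : L.IsLeftAdjoint := by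
  refine Functor.isLeftAdjoint_of_rightAdjointObjIsDefined_eq_top ?_
  ext K
  obtain ⟨R, ε, h⟩ := H K
  have hr : (L.op ⋙ yoneda.obj K).RepresentableBy R :=
    { homEquiv := fun {G} => Equiv.ofBijective _ (h G)
      homEquiv_comp := fun f g => by simp }
  exact iff_of_true hr.isRepresentable trivial

namespace TensorSystem

variable {k : Type w} [CommRing k] {a : Type u} [Category.{w} a] [MonoidalCategory a]
  {D : Type u₁} [Category.{v₁} D] [Preadditive D] [Linear k D] {Z : a ⥤ D} (τ : TensorSystem k Z)

/-- Extending the identity of `Z (x ⊗ y)` to a weighted cocone gives the morphism back. The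
remaining composite is tested on the product of the two identity sections, which generates by
itself. -/
lemma mul_id_id_inv (x y : a) :
    ∃ f : τ.obj (Z.obj x) (Z.obj y) ⟶ Z.obj (x ⊗ y),
      τ.mul (𝟙 (Z.obj x)) (𝟙 (Z.obj y)) ≫ f = 𝟙 _ ∧
        f ≫ τ.mul (𝟙 (Z.obj x)) (𝟙 (Z.obj y)) = 𝟙 _ := by
  obtain ⟨w, hw⟩ := (τ.repRight y).exists_app_id (x := x) (𝟙 (Z.obj (x ⊗ y)))
  obtain ⟨f, hf⟩ := τ.exists_desc_right w
  have h : τ.mul (𝟙 (Z.obj x)) (𝟙 (Z.obj y)) ≫ f = 𝟙 _ := by rw [hf, hw]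
  refine ⟨f, h, τ.generates_tm (Sections.generates_id _) (Sections.generates_id _) _ _ ?_⟩
  rintro _ _ ⟨⟨⟩, ⟨⟩⟩
  rw [← Category.assoc, h]
  simp

/-- The isomorphism `Z x ⊗ Z y ≅ Z (x ⊗ y)`. -/
def mulIso (x y : a) : τ.obj (Z.obj x) (Z.obj y) ≅ Z.obj (x ⊗ y) where
  hom := (τ.mul_id_id_inv x y).choose
  inv := τ.mul (𝟙 _) (𝟙 _)
  hom_inv_id := (τ.mul_id_id_inv x y).choose_spec.2
  inv_hom_id := (τ.mul_id_id_inv x y).choose_spec.1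

/-- The functor `Z` is monoidal for the monoidal structure of a tensor system. -/
abbrev monoidalFunctor : letI := τ.monoidalCategory; Z.Monoidal :=
  letI := τ.monoidalCategory
  (Functor.CoreMonoidal.mk' (F := Z) (Iso.refl _) τ.mulIso
    (fun {X Y} f X' => by
      change τ.mul _ _ ≫ τ.map _ (𝟙 _) = _ ≫ τ.mul _ _
      have := τ.map_comp_mul_left f (𝟙 _) (𝟙 (Z.obj X'))
      rw [Category.comp_id] at this
      simpa using this)
    (fun {X Y} X' f => by
      change τ.mul _ _ ≫ τ.map (𝟙 _) _ = _ ≫ τ.mul _ _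
      have := τ.map_comp_mul_right f (𝟙 (Z.obj X')) (𝟙 _)
      rw [Category.comp_id] at this
      simpa using this)
    (fun X Y W => by
      change τ.mul _ _ ≫ τ.map (τ.mul _ _) (𝟙 _) ≫ (τ.assoc _ _ _).hom =
        _ ≫ τ.mul _ _ ≫ τ.map (𝟙 _) (τ.mul _ _)
      simp)
    (fun X => by
      change (τ.leftUnitor _).inv = _ ≫ τ.mul _ _ ≫ τ.map (𝟙 _) (𝟙 _)
      rw [← cancel_mono (τ.leftUnitor _).hom, Category.assoc, Category.assoc, mul_map_assoc,
        Category.comp_id, Category.comp_id, mul_leftUnitor_hom, Iso.inv_hom_id, ← Category.assoc,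
        ← Z.map_comp]
      simp)
    (fun X => by
      change (τ.rightUnitor _).inv = _ ≫ τ.mul _ _ ≫ τ.map (𝟙 _) (𝟙 _)
      rw [← cancel_mono (τ.rightUnitor _).hom, Category.assoc, Category.assoc, mul_map_assoc,
        Category.comp_id, Category.comp_id, mul_rightUnitor_hom, Iso.inv_hom_id, ← Category.assoc,
        ← Z.map_comp]
      simp)).toMonoidal

lemma monoidalPreadditive : letI := τ.monoidalCategory; MonoidalPreadditive D :=
  letI := τ.monoidalCategory
  { whiskerLeft_zero := fun {X _ _} => (τ.univ _ _).hom_ext fun x y s t => by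
      change τ.mul s t ≫ τ.map _ _ = _
      rw [mul_map, comp_zero, comp_zero]
      exact ((τ.tm _ _).atLeft _).app_zero _
    zero_whiskerRight := fun {X _ _} => (τ.univ _ _).hom_ext fun x y s t => by
      change τ.mul s t ≫ τ.map _ _ = _
      rw [mul_map, comp_zero, comp_zero]
      exact ((τ.tm _ _).atRight _).app_zero _
    whiskerLeft_add := fun {X _ _} f g => (τ.univ _ _).hom_ext fun x y s t => by
      change τ.mul s t ≫ τ.map _ _ = τ.mul s t ≫ (τ.map _ _ + τ.map _ _)
      rw [Preadditive.comp_add, mul_map, mul_map, mul_map, Preadditive.comp_add]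
      exact ((τ.tm _ _).atLeft _).app_add _ _
    add_whiskerRight := fun {X _ _} f g => (τ.univ _ _).hom_ext fun x y s t => by
      change τ.mul s t ≫ τ.map _ _ = τ.mul s t ≫ (τ.map _ _ + τ.map _ _)
      rw [Preadditive.comp_add, mul_map, mul_map, mul_map, Preadditive.comp_add]
      exact ((τ.tm _ _).atRight _).app_add _ _ }

lemma monoidalLinear : letI := τ.monoidalCategory; letI := τ.monoidalPreadditive;
    MonoidalLinear k D :=
  letI := τ.monoidalCategory
  letI := τ.monoidalPreadditive
  { whiskerLeft_smul := fun X _ _ r f => (τ.univ _ _).hom_ext fun x y s t => by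
      change τ.mul s t ≫ τ.map _ _ = τ.mul s t ≫ (r • τ.map _ _)
      rw [Linear.comp_smul, mul_map, mul_map, Linear.comp_smul]
      exact ((τ.tm _ _).atLeft _).app_smul _ _
    smul_whiskerRight := fun r _ _ f X => (τ.univ _ _).hom_ext fun x y s t => by
      change τ.mul s t ≫ τ.map _ _ = τ.mul s t ≫ (r • τ.map _ _)
      rw [Linear.comp_smul, mul_map, mul_map, Linear.comp_smul]
      exact ((τ.tm _ _).atRight _).app_smul _ _ }

variable (k Z) in
/-- The presheaves of weighted cocones under the functors `K y` are represented. -/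
def HasInternalHom (K : a ⥤ a ⥤ D) : Prop :=
  ∀ F G : D, ∃ (R : D) (e : ∀ y : a, (Z.obj y ⟶ R) → WCocone k Z (K.obj y) F G),
    (∀ y, Function.Bijective (e y)) ∧
    ∀ {y y' : a} (r : k) (t : Z.obj y ⟶ R) (f : y ⟶ y') (t' : Z.obj y' ⟶ R),
      e y (r • t + Z.map f ≫ t') = (e y t).linComb r (K.map f) (e y' t')

/-- Currying: a morphism `F ⊗ G ⟶ K` is a bilinear cocone, and fixing a section `t` of `G` at `y`
leaves a weighted cocone under `Z (- ⊗ y)`, hence a section of `R` at `y`. Linearity in `t` matches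
the linearity of `e`, and density assembles these sections into `G ⟶ R`. -/
lemma isLeftAdjoint_tensorLeft
    (H : HasInternalHom k Z ((curriedTensor a).flip ⋙ (Functor.whiskeringRight a a D).obj Z)) (F : D) :
    letI := τ.monoidalCategory; (tensorLeft F).IsLeftAdjoint := by
  let := τ.monoidalCategory
  refine isLeftAdjoint_of_exists_couniversal _ fun K => ?_
  obtain ⟨R, e, he, hl⟩ := H F K
  let β : BCocone k Z Z F R K :=
    { app := fun {x y} s t => (e y t).app s
      lin_left := fun r s f s' t => (e _ t).lin r s f s'
      lin_right := fun r s t f t' => by rw [hl]; rfl }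
  have hβ : ∀ {x y : a} (s : Z.obj x ⟶ F) (t : Z.obj y ⟶ R),
      τ.mul s t ≫ (τ.univ F R).desc β = (e y t).app s := fun s t => (τ.univ F R).fac _ _ _
  refine ⟨R, (τ.univ F R).desc β, fun G => ⟨fun g g' h => ?_, fun f => ?_⟩⟩
  · refine τ.dense.hom_ext fun y t => (he y).injective ?_
    ext x s
    have : τ.mul s t ≫ τ.map (𝟙 F) g ≫ (τ.univ F R).desc β =
        τ.mul s t ≫ τ.map (𝟙 F) g' ≫ (τ.univ F R).desc β := congrArg (τ.mul s t ≫ ·) h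
    simpa [hβ] using this
  · choose p hp using fun (y : a) (t : Z.obj y ⟶ G) => (he y).surjective
      (((τ.tm F G).postcomp f).atRight t)
    let w : WCocone k Z Z G R :=
      { app := fun {y} t => p y t
        lin := fun {y y'} r t g t' => (he y).injective (by
          rw [hl, hp, hp, hp]
          ext x s
          exact ((τ.tm F G).postcomp f).lin_right r s t g t') }
    refine ⟨(τ.dense G).desc w, (τ.univ F G).hom_ext fun x y s t => ?_⟩
    change τ.mul s t ≫ τ.map (𝟙 F) _ ≫ (τ.univ F R).desc β = τ.mul s t ≫ f
    have ht : t ≫ (τ.dense G).desc w = p y t := (τ.dense G).fac w t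
    rw [mul_map_assoc, hβ, ht, hp, Category.comp_id]
    rfl

lemma isLeftAdjoint_tensorRight
    (H : HasInternalHom k Z (curriedTensor a ⋙ (Functor.whiskeringRight a a D).obj Z)) (G : D) :
    letI := τ.monoidalCategory; (tensorRight G).IsLeftAdjoint := by
  let := τ.monoidalCategory
  refine isLeftAdjoint_of_exists_couniversal _ fun K => ?_
  obtain ⟨R, e, he, hl⟩ := H G K
  let β : BCocone k Z Z R G K :=
    { app := fun {x y} s t => (e x s).app t
      lin_left := fun r s f s' t => by rw [hl]; rfl
      lin_right := fun r s t f t' => (e _ s).lin r t f t' }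
  have hβ : ∀ {x y : a} (s : Z.obj x ⟶ R) (t : Z.obj y ⟶ G),
      τ.mul s t ≫ (τ.univ R G).desc β = (e x s).app t := fun s t => (τ.univ R G).fac _ _ _
  refine ⟨R, (τ.univ R G).desc β, fun F => ⟨fun g g' h => ?_, fun f => ?_⟩⟩
  · refine τ.dense.hom_ext fun x s => (he x).injective ?_
    ext y t
    have : τ.mul s t ≫ τ.map g (𝟙 G) ≫ (τ.univ R G).desc β =
        τ.mul s t ≫ τ.map g' (𝟙 G) ≫ (τ.univ R G).desc β := congrArg (τ.mul s t ≫ ·) h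
    simpa [hβ] using this
  · choose p hp using fun (x : a) (s : Z.obj x ⟶ F) => (he x).surjective
      (((τ.tm F G).postcomp f).atLeft s)
    let w : WCocone k Z Z F R :=
      { app := fun {x} s => p x s
        lin := fun {x x'} r s g s' => (he x).injective (by
          rw [hl, hp, hp, hp]
          ext y t
          exact ((τ.tm F G).postcomp f).lin_left r s g s' t) }
    refine ⟨(τ.dense F).desc w, (τ.univ F G).hom_ext fun x y s t => ?_⟩
    change τ.mul s t ≫ τ.map _ (𝟙 G) ≫ (τ.univ R G).desc β = τ.mul s t ≫ f
    have hs : s ≫ (τ.dense F).desc w = p x s := (τ.dense F).fac w s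
    rw [mul_map_assoc, hβ, hs, hp, Category.comp_id]
    rfl

end TensorSystem

end LinearSite

end
noncomputable section

namespace LinearSite

/-! ### Tensor products of universal weighted cocones -/

section TensorUniversal

variable {k : Type w} [CommRing k] {a : Type u} [Category.{w} a] [EssentiallySmall.{w} a]
  {D : Type u₁} [Category.{v₁} D] [Preadditive D] [Linear k D] [LocallySmall.{w} D]
  {C : Type u₂} [Category.{v₂} C] [Preadditive C] [Linear k C] [HasColimitsOfSize.{w, w} C]
  [MonoidalCategory C] [MonoidalPreadditive C] [MonoidalLinear k C]
  [∀ X : C, PreservesColimitsOfSize.{w, w} (tensorLeft X)]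
  [∀ X : C, PreservesColimitsOfSize.{w, w} (tensorRight X)]
  {Z : a ⥤ D} {h h' h'' : a ⥤ C} {F G K : D} {b c c' c'' : C}
  {u : WCocone k Z h F c} {u' : WCocone k Z h' G c'} {u'' : WCocone k Z h'' K c''}

namespace WCocone.IsUniversal

/-- Tensoring with a fixed object preserves universal weighted cocones, so sections can be inserted
in one factor at a time. -/
lemma tensor_hom_ext (hu : u.IsUniversal) (hu' : u'.IsUniversal) {f g : c ⊗ c' ⟶ b}
    (H : ∀ ⦃x y : a⦄ (s : Z.obj x ⟶ F) (t : Z.obj y ⟶ G),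
      (u.app s ⊗ₘ u'.app t) ≫ f = (u.app s ⊗ₘ u'.app t) ≫ g) : f = g := by
  refine (hu.mapFunctor (tensorRight c')).hom_ext fun x s => ?_
  refine (hu'.mapFunctor (tensorLeft (h.obj x))).hom_ext fun y t => ?_
  have := H s t
  rw [MonoidalCategory.tensorHom_def'] at this
  simpa using this

lemma tensor_hom_ext₃ (hu : u.IsUniversal) (hu' : u'.IsUniversal) (hu'' : u''.IsUniversal)
    {f g : (c ⊗ c') ⊗ c'' ⟶ b}
    (H : ∀ ⦃x y z : a⦄ (s : Z.obj x ⟶ F) (t : Z.obj y ⟶ G) (r : Z.obj z ⟶ K),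
      ((u.app s ⊗ₘ u'.app t) ⊗ₘ u''.app r) ≫ f = ((u.app s ⊗ₘ u'.app t) ⊗ₘ u''.app r) ≫ g) :
    f = g := by
  refine (hu''.mapFunctor (tensorLeft (c ⊗ c'))).hom_ext fun z r => ?_
  refine (hu'.mapFunctor (tensorLeft c ⋙ tensorRight (h''.obj z))).hom_ext fun y t => ?_
  refine (hu.mapFunctor (tensorRight (h'.obj y) ⋙ tensorRight (h''.obj z))).hom_ext fun x s => ?_
  have := H s t r
  rw [MonoidalCategory.tensorHom_def, MonoidalCategory.tensorHom_def, comp_whiskerRight] at this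
  simpa using this

/-- The morphism is built in two stages, over the second factor for each fixed `s` and then over the
first. Linearity in `s` is verified through the universal property of the second factor. -/
lemma exists_tensor_desc (hu : u.IsUniversal) (hu' : u'.IsUniversal)
    (v : ∀ {x y : a} (_ : Z.obj x ⟶ F) (_ : Z.obj y ⟶ G), h.obj x ⊗ h'.obj y ⟶ b)
    (hl : ∀ {x x' y : a} (r : k) (s : Z.obj x ⟶ F) (f : x ⟶ x') (s' : Z.obj x' ⟶ F)
      (t : Z.obj y ⟶ G), v (r • s + Z.map f ≫ s') t = r • v s t + h.map f ▷ _ ≫ v s' t)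
    (hr : ∀ {x y y' : a} (r : k) (s : Z.obj x ⟶ F) (t : Z.obj y ⟶ G) (f : y ⟶ y')
      (t' : Z.obj y' ⟶ G), v s (r • t + Z.map f ≫ t') = r • v s t + _ ◁ h'.map f ≫ v s t') :
    ∃ g : c ⊗ c' ⟶ b, ∀ ⦃x y : a⦄ (s : Z.obj x ⟶ F) (t : Z.obj y ⟶ G),
      (u.app s ⊗ₘ u'.app t) ≫ g = v s t := by
  let p {x : a} (s : Z.obj x ⟶ F) : h.obj x ⊗ c' ⟶ b :=
    (hu'.mapFunctor (tensorLeft (h.obj x))).desc ⟨fun t => v s t, fun r t f t' => hr r s t f t'⟩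
  have hp : ∀ {x y : a} (s : Z.obj x ⟶ F) (t : Z.obj y ⟶ G), h.obj x ◁ u'.app t ≫ p s = v s t :=
    fun {x y} s t => (hu'.mapFunctor (tensorLeft (h.obj x))).fac _ t
  refine ⟨(hu.mapFunctor (tensorRight c')).desc ⟨fun s => p s, fun {x x'} r s f s' =>
    (hu'.mapFunctor (tensorLeft (h.obj x))).hom_ext fun y t => ?_⟩, fun x y s t => ?_⟩
  · change h.obj x ◁ u'.app t ≫ p _ = h.obj x ◁ u'.app t ≫ (r • p s + h.map f ▷ c' ≫ p s')
    rw [Preadditive.comp_add, Linear.comp_smul, hp, hp, whisker_exchange_assoc, hp, hl]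
  · rw [MonoidalCategory.tensorHom_def', Category.assoc, ← hp s t]
    congr 1
    exact (hu.mapFunctor (tensorRight c')).fac _ s

end WCocone.IsUniversal

variable [MonoidalCategory a] [h.Monoidal]

lemma smul_tensorHom (k : Type*) [CommRing k] {C : Type*} [Category* C] [Preadditive C]
    [Linear k C] [MonoidalCategory C] [MonoidalPreadditive C] [MonoidalLinear k C] {X Y X' Y' : C}
    (r : k) (f : X ⟶ Y) (g : X' ⟶ Y') : (r • f) ⊗ₘ g = r • (f ⊗ₘ g) := by
  simp [MonoidalCategory.tensorHom_def]

lemma tensorHom_smul (k : Type*) [CommRing k] {C : Type*} [Category* C] [Preadditive C]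
    [Linear k C] [MonoidalCategory C] [MonoidalPreadditive C] [MonoidalLinear k C] {X Y X' Y' : C}
    (r : k) (f : X ⟶ Y) (g : X' ⟶ Y') : f ⊗ₘ (r • g) = r • (f ⊗ₘ g) := by
  simp [MonoidalCategory.tensorHom_def]

open Functor.OplaxMonoidal Functor.LaxMonoidal

/-- The tensor product of weighted cocones under a monoidal functor. -/
@[simps]
def WCocone.tensor (u : WCocone k Z h F c) (u' : WCocone k Z h G c') :
    BCocone k Z h F G (c ⊗ c') where
  app {x y} s t := δ h x y ≫ (u.app s ⊗ₘ u'.app t)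
  lin_left {x x' y} r s f s' t := by
    rw [u.lin, MonoidalPreadditive.add_tensor, smul_tensorHom k, Preadditive.comp_add,
      Linear.comp_smul, ← δ_natural_left_assoc, MonoidalCategory.whiskerRight_comp_tensorHom]
  lin_right {x y y'} r s t f t' := by
    rw [u'.lin, MonoidalPreadditive.tensor_add, tensorHom_smul k, Preadditive.comp_add,
      Linear.comp_smul, ← δ_natural_right_assoc, MonoidalCategory.whiskerLeft_comp_tensorHom]

/-- The tensor product commutes with both weighted colimits, and `μ` and `δ` identify the diagram `h
x ⊗ h y` with `h (x ⊗ y)`. -/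
lemma WCocone.IsUniversal.tensor {u : WCocone k Z h F c} {u' : WCocone k Z h G c'}
    (hu : u.IsUniversal) (hu' : u'.IsUniversal) : (u.tensor u').IsUniversal := by
  intro b v
  obtain ⟨g, hg⟩ := hu.exists_tensor_desc hu' (fun {x y} s t => μ h x y ≫ v.app s t)
    (fun r s f s' t => by
      rw [v.lin_left, Preadditive.comp_add, Linear.comp_smul, μ_natural_left_assoc])
    (fun r s t f t' => by
      rw [v.lin_right, Preadditive.comp_add, Linear.comp_smul, μ_natural_right_assoc])
  refine ⟨g, fun x y s t => ?_, fun g' hg' => hu.tensor_hom_ext hu' fun x y s t => ?_⟩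
  · rw [tensor_app, Category.assoc, hg]
    simp
  · rw [hg, ← hg' s t]
    simp

end TensorUniversal

/-! ### Extension of functors along a linearly dense functor -/

section Extension

variable {k : Type w} [CommRing k] {a : Type u} [Category.{w} a]
  {D : Type u₁} [Category.{v₁} D] [Preadditive D] [Linear k D]
  {E : Type u₂} [Category.{v₂} E] [Preadditive E] [Linear k E]

variable (k) in
/-- Universal weighted cocones under `h`, for all weights `Hom(Z -, F)`. -/
structure Extension (Z : a ⥤ D) (h : a ⥤ E) where
  obj (F : D) : E
  cocone (F : D) : WCocone k Z h F (obj F)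
  univ (F : D) : (cocone F).IsUniversal

namespace Extension

variable {Z : a ⥤ D} {h : a ⥤ E} (L : Extension k Z h)

lemma nonempty [EssentiallySmall.{w} a] [LocallySmall.{w} D] [HasColimitsOfSize.{w, w} E]
    (Z : a ⥤ D) (h : a ⥤ E) : Nonempty (Extension k Z h) := by
  choose o u hu using fun F : D => exists_universal_wcocone (k := k) Z h F
  exact ⟨⟨o, u, hu⟩⟩

/-- The component of the universal weighted cocone at a section. -/
abbrev ι {F : D} {x : a} (s : Z.obj x ⟶ F) : h.obj x ⟶ L.obj F := (L.cocone F).app s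

lemma map_ι {F : D} {x y : a} (f : x ⟶ y) (s : Z.obj y ⟶ F) :
    h.map f ≫ L.ι s = L.ι (Z.map f ≫ s) :=
  ((L.cocone F).app_comp f s).symm

/-- The action of the extension of `h` on morphisms. -/
def map {F G : D} (f : F ⟶ G) : L.obj F ⟶ L.obj G := (L.univ F).desc ((L.cocone G).precomp f)

lemma ι_map {F G : D} (f : F ⟶ G) {x : a} (s : Z.obj x ⟶ F) : L.ι s ≫ L.map f = L.ι (s ≫ f) :=
  (L.univ F).fac _ _

lemma ι_map_assoc {F G : D} (f : F ⟶ G) {x : a} (s : Z.obj x ⟶ F) {b : E} (g : L.obj G ⟶ b) :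
    L.ι s ≫ L.map f ≫ g = L.ι (s ≫ f) ≫ g := by
  rw [← L.ι_map, Category.assoc]

/-- The extension of `h`, as a functor. -/
def functor : D ⥤ E where
  obj := L.obj
  map := L.map
  map_id F := (L.univ F).hom_ext fun x s => by rw [L.ι_map, Category.comp_id, Category.comp_id]
  map_comp f g := (L.univ _).hom_ext fun x s => by
    rw [L.ι_map, L.ι_map_assoc, L.ι_map, Category.assoc]

instance : L.functor.Additive where
  map_add {F G} {f g} := (L.univ F).hom_ext fun x s => by
    change L.ι s ≫ L.map (f + g) = L.ι s ≫ (L.map f + L.map g)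
    rw [Preadditive.comp_add, L.ι_map, L.ι_map, L.ι_map, Preadditive.comp_add]
    exact (L.cocone G).app_add _ _

instance : L.functor.Linear k where
  map_smul {F G} f r := (L.univ F).hom_ext fun x s => by
    change L.ι s ≫ L.map (r • f) = L.ι s ≫ (r • L.map f)
    rw [Linear.comp_smul, L.ι_map, L.ι_map, Linear.comp_smul]
    exact (L.cocone G).app_smul _ _

/-- Morphisms out of `L G` are weighted cocones, which are morphisms from `G` to the object
representing `Hom(h -, b)`. That object is the value of the right adjoint. -/
lemma isLeftAdjoint (hZ : IsLinDense k Z) (hh : HasRep k Z h) : L.functor.IsLeftAdjoint :=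
  isLeftAdjoint_of_exists_couniversal _ fun b => by
    obtain ⟨R, ρ, hρ⟩ := hh b
    refine ⟨R, (L.univ R).desc ρ, fun G => ⟨fun g g' H => hZ.hom_ext fun x s => ?_, fun f => ?_⟩⟩
    · refine (hρ x).injective ?_
      have : L.ι s ≫ L.map g ≫ (L.univ R).desc ρ = L.ι s ≫ L.map g' ≫ (L.univ R).desc ρ :=
        L.ι s ≫= H
      rw [L.ι_map_assoc, L.ι_map_assoc, (L.univ R).fac, (L.univ R).fac] at this
      exact this
    · obtain ⟨g, hg⟩ := hρ.exists_lift hZ ((L.cocone G).postcomp f)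
      refine ⟨g, (L.univ G).hom_ext fun x s => ?_⟩
      change L.ι s ≫ L.map g ≫ (L.univ R).desc ρ = _
      rw [L.ι_map_assoc, (L.univ R).fac]
      exact congrArg (fun v : WCocone k Z h G b => v.app s) hg

/-- Cocones under `h` weighted by `Hom(Z -, Z x)` can be prescribed at the identity section and are
determined by it. So `h x` already has the universal property of the weighted colimit. -/
lemma exists_inv_ι_id (hZ : IsLinDense k Z) (hh : HasRep k Z h) (x : a) :
    ∃ f : L.obj (Z.obj x) ⟶ h.obj x, L.ι (𝟙 (Z.obj x)) ≫ f = 𝟙 _ ∧ f ≫ L.ι (𝟙 (Z.obj x)) = 𝟙 _ := by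
  obtain ⟨v, hv⟩ := hh.exists_app_id (x := x) (𝟙 (h.obj x))
  have h₁ : L.ι (𝟙 (Z.obj x)) ≫ (L.univ _).desc v = 𝟙 _ := by rw [(L.univ _).fac, hv]
  refine ⟨(L.univ _).desc v, h₁, (L.univ _).hom_ext fun y s => ?_⟩
  have : (L.cocone (Z.obj x)).postcomp ((L.univ _).desc v ≫ L.ι (𝟙 (Z.obj x))) =
      (L.cocone (Z.obj x)).postcomp (𝟙 _) :=
    hh.wcocone_ext hZ (Sections.generates_id x) fun y s hs => by
      cases hs
      simp only [WCocone.postcomp_app, ← Category.assoc]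
      rw [h₁]
      simp
  exact congrArg (fun v : WCocone k Z h (Z.obj x) _ => v.app s) this

/-- The extension of `h` restricts to `h`. -/
def restrictIso (hZ : IsLinDense k Z) (hh : HasRep k Z h) : h ≅ Z ⋙ L.functor :=
  NatIso.ofComponents
    (fun x => ⟨L.ι (𝟙 _), (L.exists_inv_ι_id hZ hh x).choose,
      (L.exists_inv_ι_id hZ hh x).choose_spec.1, (L.exists_inv_ι_id hZ hh x).choose_spec.2⟩)
    (fun {x y} f => by
      change h.map f ≫ L.ι (𝟙 _) = L.ι (𝟙 _) ≫ L.map (Z.map f)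
      rw [L.map_ι, L.ι_map, Category.comp_id, Category.id_comp])

end Extension

end Extension

/-! ### Monoidal extensions -/

section MonoidalExtension

open Functor.OplaxMonoidal Functor.LaxMonoidal

variable {k : Type w} [CommRing k] {a : Type u} [Category.{w} a] [EssentiallySmall.{w} a]
  [MonoidalCategory a]
  {D : Type u₁} [Category.{v₁} D] [Preadditive D] [Linear k D] [LocallySmall.{w} D]
  [HasColimitsOfSize.{w, w} D] [MonoidalCategory D] [MonoidalPreadditive D] [MonoidalLinear k D]
  [∀ X : D, PreservesColimitsOfSize.{w, w} (tensorLeft X)]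
  [∀ X : D, PreservesColimitsOfSize.{w, w} (tensorRight X)]
  {E : Type u₂} [Category.{v₂} E] [Preadditive E] [Linear k E] [HasColimitsOfSize.{w, w} E]
  [MonoidalCategory E] [MonoidalPreadditive E] [MonoidalLinear k E]
  [∀ X : E, PreservesColimitsOfSize.{w, w} (tensorLeft X)]
  [∀ X : E, PreservesColimitsOfSize.{w, w} (tensorRight X)]
  {Z : a ⥤ D} [Z.Monoidal] {h : a ⥤ E} [h.Monoidal]

/-- The tensor product of two sections. -/
def secMul {F G : D} {x y : a} (s : Z.obj x ⟶ F) (t : Z.obj y ⟶ G) : Z.obj (x ⊗ y) ⟶ F ⊗ G :=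
  δ Z x y ≫ (s ⊗ₘ t)

lemma secMul_comp {F F' G G' : D} {x y : a} (s : Z.obj x ⟶ F) (t : Z.obj y ⟶ G) (f : F ⟶ F')
    (g : G ⟶ G') : secMul s t ≫ (f ⊗ₘ g) = secMul (s ≫ f) (t ≫ g) := by
  simp [secMul]

lemma secMul_assoc {F G K : D} {x y z : a} (s : Z.obj x ⟶ F) (t : Z.obj y ⟶ G)
    (r : Z.obj z ⟶ K) : secMul (secMul s t) r ≫ (α_ F G K).hom =
      Z.map (α_ x y z).hom ≫ secMul s (secMul t r) := by
  have h₁ : ((δ Z x y ≫ (s ⊗ₘ t)) ⊗ₘ r) = δ Z x y ▷ Z.obj z ≫ ((s ⊗ₘ t) ⊗ₘ r) :=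
    (MonoidalCategory.whiskerRight_comp_tensorHom _ _ _).symm
  have h₂ : (s ⊗ₘ (δ Z y z ≫ (t ⊗ₘ r))) = Z.obj x ◁ δ Z y z ≫ (s ⊗ₘ (t ⊗ₘ r)) :=
    (MonoidalCategory.whiskerLeft_comp_tensorHom _ _ _).symm
  simp only [secMul, h₁, h₂, Category.assoc, MonoidalCategory.associator_naturality]
  rw [Functor.OplaxMonoidal.associativity_assoc]

namespace Extension

variable (L : Extension k Z h) (hZ : IsLinDense k Z) (hh : HasRep k Z h)

/-- The bilinear cocone of the tensor products of sections. -/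
@[simps]
def mulCocone (F G : D) : BCocone k Z h F G (L.obj (F ⊗ G)) where
  app s t := L.ι (secMul s t)
  lin_left r s f s' t := by
    have := ((WCocone.refl k Z F).tensor (WCocone.refl k Z G)).lin_left r s f s' t
    exact (congrArg (L.cocone (F ⊗ G)).app this).trans ((L.cocone (F ⊗ G)).lin _ _ _ _)
  lin_right r s t f t' := by
    have := ((WCocone.refl k Z F).tensor (WCocone.refl k Z G)).lin_right r s t f t'
    exact (congrArg (L.cocone (F ⊗ G)).app this).trans ((L.cocone (F ⊗ G)).lin _ _ _ _)

include hZ hh in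
-- By density `F ⊗ G` is the universal vertex of bilinear cocones under `Z`. Since `Hom(h -, b)` is
-- represented in `D`, a bilinear cocone under `h` factors uniquely through a weighted cocone on `F
-- ⊗ G`, hence through `L (F ⊗ G)`.
lemma mulCocone_isUniversal (F G : D) : (L.mulCocone F G).IsUniversal := by
  intro b v
  have hu : ((WCocone.refl k Z F).tensor (WCocone.refl k Z G)).IsUniversal :=
    (hZ F).tensor (hZ G)
  obtain ⟨w, hw⟩ := hu.exists_wcocone hh v
  refine ⟨(L.univ _).desc w, fun x y s t => ?_, fun g hg => (L.univ _).hom_ext fun x e => ?_⟩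
  · rw [mulCocone_app, (L.univ _).fac, ← hw]
    rfl
  · rw [(L.univ _).fac]
    have : (L.cocone (F ⊗ G)).postcomp g = w := hu.wcocone_ext hZ hh fun x y s t => by
      rw [hw, ← hg]
      rfl
    exact congrArg (fun v : WCocone k Z h (F ⊗ G) _ => v.app e) this

include hZ hh in
-- Both sides are universal for bilinear cocones under `h`. The displayed formula is the one that
-- drives all coherence computations.
lemma exists_mulIso (F G : D) : ∃ e : L.obj F ⊗ L.obj G ≅ L.obj (F ⊗ G),
    ∀ ⦃x y : a⦄ (s : Z.obj x ⟶ F) (t : Z.obj y ⟶ G),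
      (L.ι s ⊗ₘ L.ι t) ≫ e.hom = μ h x y ≫ L.ι (secMul s t) := by
  have h₁ := (L.univ F).tensor (L.univ G)
  have h₂ := L.mulCocone_isUniversal hZ hh F G
  refine ⟨⟨h₁.desc (L.mulCocone F G), h₂.desc ((L.cocone F).tensor (L.cocone G)),
    h₁.hom_ext fun x y s t => ?_, h₂.hom_ext fun x y s t => ?_⟩, fun x y s t => ?_⟩
  · rw [h₁.fac_assoc, h₂.fac, Category.comp_id]
  · rw [h₂.fac_assoc, h₁.fac, Category.comp_id]
  · have := h₁.fac (L.mulCocone F G) s t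
    rw [WCocone.tensor_app, Category.assoc, mulCocone_app] at this
    rw [← this]
    simp

/-- The tensorator of the extension. -/
def mulIso (F G : D) : L.obj F ⊗ L.obj G ≅ L.obj (F ⊗ G) := (L.exists_mulIso hZ hh F G).choose

lemma ι_mulIso {F G : D} {x y : a} (s : Z.obj x ⟶ F) (t : Z.obj y ⟶ G) :
    (L.ι s ⊗ₘ L.ι t) ≫ (L.mulIso hZ hh F G).hom = μ h x y ≫ L.ι (secMul s t) :=
  (L.exists_mulIso hZ hh F G).choose_spec s t

lemma ι_mulIso_assoc {F G : D} {x y : a} (s : Z.obj x ⟶ F) (t : Z.obj y ⟶ G) {b : E}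
    (g : L.obj (F ⊗ G) ⟶ b) : (L.ι s ⊗ₘ L.ι t) ≫ (L.mulIso hZ hh F G).hom ≫ g =
      μ h x y ≫ L.ι (secMul s t) ≫ g := by
  rw [← Category.assoc, ι_mulIso, Category.assoc]

end Extension

end MonoidalExtension

end LinearSite

end
-- Coherence of the monoidal structure on the extension
noncomputable section

namespace LinearSite

section ExtensionMonoidal

open Functor.OplaxMonoidal Functor.LaxMonoidal

variable {k : Type w} [CommRing k] {a : Type u} [Category.{w} a] [EssentiallySmall.{w} a]
  [MonoidalCategory a]
  {D : Type u₁} [Category.{v₁} D] [Preadditive D] [Linear k D] [LocallySmall.{w} D]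
  [HasColimitsOfSize.{w, w} D] [MonoidalCategory D] [MonoidalPreadditive D] [MonoidalLinear k D]
  [∀ X : D, PreservesColimitsOfSize.{w, w} (tensorLeft X)]
  [∀ X : D, PreservesColimitsOfSize.{w, w} (tensorRight X)]
  {E : Type u₂} [Category.{v₂} E] [Preadditive E] [Linear k E] [HasColimitsOfSize.{w, w} E]
  [MonoidalCategory E] [MonoidalPreadditive E] [MonoidalLinear k E]
  [∀ X : E, PreservesColimitsOfSize.{w, w} (tensorLeft X)]
  [∀ X : E, PreservesColimitsOfSize.{w, w} (tensorRight X)]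
  {Z : a ⥤ D} [Z.Monoidal] {h : a ⥤ E} [h.Monoidal]

lemma secMul_leftUnitor {F : D} {x : a} (s : Z.obj x ⟶ F) :
    secMul (η Z) s ≫ (λ_ F).hom = Z.map (λ_ x).hom ≫ s := by
  rw [secMul, Category.assoc, MonoidalCategory.tensorHom_def, Category.assoc,
    leftUnitor_naturality, Functor.OplaxMonoidal.left_unitality_hom_assoc]

lemma secMul_rightUnitor {F : D} {x : a} (s : Z.obj x ⟶ F) :
    secMul s (η Z) ≫ (ρ_ F).hom = Z.map (ρ_ x).hom ≫ s := by
  rw [secMul, Category.assoc, MonoidalCategory.tensorHom_def', Category.assoc,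
    rightUnitor_naturality, Functor.OplaxMonoidal.right_unitality_hom_assoc]

namespace Extension

variable (L : Extension k Z h) (hZ : IsLinDense k Z) (hh : HasRep k Z h)

/-- The unit isomorphism of the extension. -/
def unitIso : 𝟙_ E ≅ L.obj (𝟙_ D) :=
  Functor.Monoidal.εIso h ≪≫ (L.restrictIso hZ hh).app (𝟙_ a) ≪≫
    L.functor.mapIso (Functor.Monoidal.εIso Z).symm

lemma unitIso_hom : (L.unitIso hZ hh).hom = ε h ≫ L.ι (η Z) := by
  change ε h ≫ L.ι (𝟙 _) ≫ L.map (η Z) = _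
  rw [L.ι_map, Category.id_comp]

lemma tensor_map_mulIso {F F' G G' : D} (f : F ⟶ F') (g : G ⟶ G') :
    (L.map f ⊗ₘ L.map g) ≫ (L.mulIso hZ hh F' G').hom =
      (L.mulIso hZ hh F G).hom ≫ L.map (f ⊗ₘ g) :=
  (L.univ F).tensor_hom_ext (L.univ G) fun x y s t => by
    rw [tensorHom_comp_tensorHom_assoc, L.ι_map, L.ι_map, ι_mulIso, ι_mulIso_assoc, L.ι_map,
      secMul_comp]

/-- On triple products of sections both composites reduce to the associativity of `μ h` combined
with that of products of sections. -/
lemma mulIso_assoc (F G K : D) :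
    (L.mulIso hZ hh F G).hom ▷ L.obj K ≫ (L.mulIso hZ hh (F ⊗ G) K).hom ≫ L.map (α_ F G K).hom =
      (α_ (L.obj F) (L.obj G) (L.obj K)).hom ≫ L.obj F ◁ (L.mulIso hZ hh G K).hom ≫
        (L.mulIso hZ hh F (G ⊗ K)).hom :=
  (L.univ F).tensor_hom_ext₃ (L.univ G) (L.univ K) fun x y z s t r => by
    rw [associator_naturality_assoc, ← tensorHom_id, ← id_tensorHom,
      tensorHom_comp_tensorHom_assoc, tensorHom_comp_tensorHom_assoc, ι_mulIso, ι_mulIso,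
      Category.comp_id, Category.comp_id, ← MonoidalCategory.whiskerRight_comp_tensorHom,
      ← MonoidalCategory.whiskerLeft_comp_tensorHom, Category.assoc, Category.assoc,
      ι_mulIso_assoc, ι_mulIso, L.ι_map, secMul_assoc, ← L.map_ι,
      Functor.LaxMonoidal.associativity_assoc]

/-- The unit object needs no presentation as a colimit, so it is enough to insert sections of `F`.
-/
lemma mulIso_leftUnitor (F : D) : (λ_ (L.obj F)).hom =
    (L.unitIso hZ hh).hom ▷ L.obj F ≫ (L.mulIso hZ hh (𝟙_ D) F).hom ≫ L.map (λ_ F).hom :=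
  ((L.univ F).mapFunctor (tensorLeft (𝟙_ E))).hom_ext fun x s => by
    change 𝟙_ E ◁ L.ι s ≫ (λ_ (L.obj F)).hom = 𝟙_ E ◁ L.ι s ≫ _
    rw [unitIso_hom, whisker_exchange_assoc, comp_whiskerRight, Category.assoc,
      ← MonoidalCategory.tensorHom_def_assoc, ι_mulIso_assoc, L.ι_map, secMul_leftUnitor,
      ← L.map_ι, leftUnitor_naturality, Functor.LaxMonoidal.left_unitality]
    simp only [Category.assoc]

lemma mulIso_rightUnitor (F : D) : (ρ_ (L.obj F)).hom =
    L.obj F ◁ (L.unitIso hZ hh).hom ≫ (L.mulIso hZ hh F (𝟙_ D)).hom ≫ L.map (ρ_ F).hom :=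
  ((L.univ F).mapFunctor (tensorRight (𝟙_ E))).hom_ext fun x s => by
    change L.ι s ▷ 𝟙_ E ≫ (ρ_ (L.obj F)).hom = L.ι s ▷ 𝟙_ E ≫ _
    rw [unitIso_hom, ← whisker_exchange_assoc, MonoidalCategory.whiskerLeft_comp, Category.assoc,
      ← MonoidalCategory.tensorHom_def'_assoc, ι_mulIso_assoc, L.ι_map, secMul_rightUnitor,
      ← L.map_ι, rightUnitor_naturality, Functor.LaxMonoidal.right_unitality]
    simp only [Category.assoc]

/-- The strong monoidal structure of the extension. -/
abbrev coreMonoidal : L.functor.CoreMonoidal where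
  εIso := L.unitIso hZ hh
  μIso := L.mulIso hZ hh
  μIso_hom_natural_left {F G} f K := by
    have := L.tensor_map_mulIso hZ hh f (𝟙 K)
    rw [show L.map (𝟙 K) = 𝟙 _ from L.functor.map_id K] at this
    rwa [tensorHom_id, tensorHom_id] at this
  μIso_hom_natural_right {F G} K f := by
    have := L.tensor_map_mulIso hZ hh (𝟙 K) f
    rw [show L.map (𝟙 K) = 𝟙 _ from L.functor.map_id K] at this
    rwa [id_tensorHom, id_tensorHom] at this
  associativity := L.mulIso_assoc hZ hh
  left_unitality := L.mulIso_leftUnitor hZ hh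
  right_unitality := L.mulIso_rightUnitor hZ hh

/-- The strong monoidal structure of the extension. -/
abbrev monoidal : L.functor.Monoidal := (L.coreMonoidal hZ hh).toMonoidal

lemma restrictIso_hom_isMonoidal : let _ := L.monoidal hZ hh
    NatTrans.IsMonoidal (L.restrictIso hZ hh).hom := by
  let _ := L.monoidal hZ hh
  refine ⟨?_, fun x y => ?_⟩
  · change ε h ≫ L.ι (𝟙 _) = (L.unitIso hZ hh).hom ≫ L.map (ε Z)
    rw [unitIso_hom, Category.assoc, L.ι_map, Functor.Monoidal.η_ε]
  · change μ h x y ≫ L.ι (𝟙 _) = (L.ι (𝟙 _) ⊗ₘ L.ι (𝟙 _)) ≫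
      (L.mulIso hZ hh (Z.obj x) (Z.obj y)).hom ≫ L.map (μ Z x y)
    rw [ι_mulIso_assoc, L.ι_map]
    simp [secMul]

end Extension

end ExtensionMonoidal

/-! ### The universal property of linearly dense monoidal functors -/

section Restriction

open Functor.OplaxMonoidal Functor.LaxMonoidal

variable {k : Type w} [CommRing k] {a : Type u} [Category.{w} a] [EssentiallySmall.{w} a]
  [MonoidalCategory a]
  {D : Type u₁} [Category.{v₁} D] [Preadditive D] [Linear k D] [LocallySmall.{w} D]
  [HasColimitsOfSize.{w, w} D] [MonoidalCategory D]
  {E : Type u₂} [Category.{v₂} E] [Preadditive E] [Linear k E] [HasColimitsOfSize.{w, w} E]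
  [MonoidalCategory E] [MonoidalPreadditive E] [MonoidalLinear k E]
  [∀ X : E, PreservesColimitsOfSize.{w, w} (tensorLeft X)]
  [∀ X : E, PreservesColimitsOfSize.{w, w} (tensorRight X)]
  {Z : a ⥤ D} [Z.Monoidal]

lemma IsLinDense.map_isUniversal (hZ : IsLinDense k Z) (H : D ⥤ E) [H.Additive] [H.Linear k]
    [PreservesColimitsOfSize.{w, w} H] (F : D) : ((WCocone.refl k Z F).mapFunctor H).IsUniversal :=
  (hZ F).mapFunctor H

/-- A cocontinuous linear `H₁` carries the density presentation of `F` to a presentation of `H₁ F`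
by the objects `H₁ (Z x)`, so components at the objects `Z x` determine all others. -/
lemma IsLinDense.natTrans_ext (hZ : IsLinDense k Z) {H₁ H₂ : D ⥤ E} [H₁.Additive] [H₁.Linear k]
    [PreservesColimitsOfSize.{w, w} H₁] {η η' : H₁ ⟶ H₂}
    (hη : Functor.whiskerLeft Z η = Functor.whiskerLeft Z η') : η = η' := by
  ext F
  refine (hZ.map_isUniversal H₁ F).hom_ext fun x s => ?_
  change H₁.map s ≫ _ = H₁.map s ≫ _
  rw [η.naturality, η'.naturality]
  exact congrArg (· ≫ _) (NatTrans.congr_app hη x)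

/-- The component at `F` is induced by the cocone of `H₂ F` composed with `θ`. Only the source has
to be cocontinuous, since only its values are mapped out of. -/
lemma IsLinDense.exists_natTrans (hZ : IsLinDense k Z) {H₁ H₂ : D ⥤ E} [H₁.Additive]
    [H₁.Linear k] [PreservesColimitsOfSize.{w, w} H₁] [H₂.Additive] [H₂.Linear k]
    (θ : Z ⋙ H₁ ⟶ Z ⋙ H₂) : ∃ η : H₁ ⟶ H₂, Functor.whiskerLeft Z η = θ := by
  let e (F : D) : H₁.obj F ⟶ H₂.obj F := (hZ.map_isUniversal H₁ F).desc
    (((WCocone.refl k Z F).mapFunctor H₂).ofNatTrans θ)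
  have he {F : D} {x : a} (s : Z.obj x ⟶ F) : H₁.map s ≫ e F = θ.app x ≫ H₂.map s :=
    (hZ.map_isUniversal H₁ F).fac _ s
  refine ⟨{ app := e, naturality := fun F G f => ?_ }, ?_⟩
  · refine (hZ.map_isUniversal H₁ F).hom_ext fun x s => ?_
    change H₁.map s ≫ H₁.map f ≫ e G = H₁.map s ≫ e F ≫ H₂.map f
    rw [← H₁.map_comp_assoc, he, ← Category.assoc, he, H₂.map_comp, Category.assoc]
  · ext x
    simpa using he (𝟙 (Z.obj x))

/-- Compatibility with `μ` is tested on `H₁ s ⊗ H₁ t`, where naturality reduces it to the objects `Z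
x` and `Z y`. There it follows from the hypothesis, because the images of `ε Z` and `μ Z` are
invertible and can be cancelled. -/
lemma IsLinDense.isMonoidal_of_whiskerLeft (hZ : IsLinDense k Z) {H₁ H₂ : D ⥤ E}
    [H₁.Additive] [H₁.Linear k] [PreservesColimitsOfSize.{w, w} H₁] [H₁.LaxMonoidal]
    [H₂.LaxMonoidal] (η : H₁ ⟶ H₂) [NatTrans.IsMonoidal (Functor.whiskerLeft Z η)] :
    NatTrans.IsMonoidal η := by
  have nat {F G : D} (f : F ⟶ G) : H₁.map f ≫ η.app G = η.app F ≫ H₂.map f := η.naturality f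
  refine ⟨?_, fun F G => ?_⟩
  · have h₁ := NatTrans.IsMonoidal.unit (τ := Functor.whiskerLeft Z η)
    have h₂ : (ε H₁ ≫ H₁.map (ε Z)) ≫ η.app _ = ε H₂ ≫ H₂.map (ε Z) := h₁
    rw [Category.assoc, nat, ← Category.assoc] at h₂
    exact (cancel_mono (H₂.map (ε Z))).1 h₂
  · refine (hZ.map_isUniversal H₁ F).tensor_hom_ext (hZ.map_isUniversal H₁ G) fun x y s t => ?_
    change (H₁.map s ⊗ₘ H₁.map t) ≫ _ = (H₁.map s ⊗ₘ H₁.map t) ≫ _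
    have h₁ := NatTrans.IsMonoidal.tensor (τ := Functor.whiskerLeft Z η) x y
    have h₂ : (μ H₁ _ _ ≫ H₁.map (μ Z x y)) ≫ η.app _ =
      (η.app (Z.obj x) ⊗ₘ η.app (Z.obj y)) ≫ μ H₂ _ _ ≫ H₂.map (μ Z x y) := h₁
    rw [Category.assoc, nat, ← Category.assoc, ← Category.assoc] at h₂
    have h₃ := (cancel_mono (H₂.map (μ Z x y))).1 h₂
    rw [Functor.LaxMonoidal.μ_natural_assoc, nat, tensorHom_comp_tensorHom_assoc, nat, nat,
      ← tensorHom_comp_tensorHom_assoc, Functor.LaxMonoidal.μ_natural, ← reassoc_of% h₃]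

end Restriction

end LinearSite

end
-- Restriction along a dense monoidal functor as an equivalence
noncomputable section

namespace LinearSite

section Equivalence

open Functor.OplaxMonoidal Functor.LaxMonoidal

variable {k : Type w} [CommRing k] {a : Type u} [Category.{w} a] [EssentiallySmall.{w} a]
  [MonoidalCategory a] [Preadditive a] [Linear k a]
  {D : Type u₁} [Category.{v₁} D] [Preadditive D] [Linear k D] [LocallySmall.{w} D]
  [HasColimitsOfSize.{w, w} D] [MonoidalCategory D] [MonoidalPreadditive D] [MonoidalLinear k D]
  {E : Type u₂} [Category.{v₂} E] [Preadditive E] [Linear k E] [HasColimitsOfSize.{w, w} E]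
  [MonoidalCategory E] [MonoidalPreadditive E] [MonoidalLinear k E]
  [∀ X : E, PreservesColimitsOfSize.{w, w} (tensorLeft X)]
  [∀ X : E, PreservesColimitsOfSize.{w, w} (tensorRight X)]
  {Z : a ⥤ D} [Z.Monoidal]

/-- A linearly dense monoidal functor `Z` is universal among the monoidal functors `h` for which the
presheaves `Hom(h -, b)` are represented by objects of `D`. -/
theorem IsLinDense.isEquivalence_lift_precomp
    [∀ X : D, PreservesColimitsOfSize.{w, w} (tensorLeft X)]
    [∀ X : D, PreservesColimitsOfSize.{w, w} (tensorRight X)]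
    (hZ : IsLinDense k Z)
    (P : ObjectProperty (LaxMonoidalFunctor a E))
    (hP : ∀ h, P h → IsLinearMonoidal k h ∧ HasRep k Z h.toFunctor)
    (hw : ∀ H : (IsCocontinuousMonoidal.{w} k (D := D) (E := E)).FullSubcategory,
      P ((precomp Z).obj H.obj)) :
    (ObjectProperty.lift P ((IsCocontinuousMonoidal.{w} k (D := D) (E := E)).ι ⋙ precomp Z)
      hw).IsEquivalence where
  faithful := ⟨fun {H₁ H₂} η η' e => by
    have := H₁.property.1.1
    have := H₁.property.1.2.1
    have := H₁.property.2
    apply ObjectProperty.hom_ext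
    apply LaxMonoidalFunctor.hom_ext
    refine hZ.natTrans_ext ?_
    exact congrArg (fun f => f.hom.hom) e⟩
  full := ⟨fun {H₁ H₂} θ => by
    have := H₁.property.1.1
    have := H₁.property.1.2.1
    have := H₁.property.2
    have := H₂.property.1.1
    have := H₂.property.1.2.1
    obtain ⟨η, hη⟩ := hZ.exists_natTrans (H₁ := H₁.obj.toFunctor) (H₂ := H₂.obj.toFunctor)
      θ.hom.hom
    have h₁ : NatTrans.IsMonoidal (Functor.whiskerLeft Z η) := by
      rw [hη]
      exact θ.hom.isMonoidal
    have := hZ.isMonoidal_of_whiskerLeft η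
    refine ⟨ObjectProperty.homMk ⟨η, this⟩, ?_⟩
    apply ObjectProperty.hom_ext
    apply LaxMonoidalFunctor.hom_ext
    exact hη⟩
  essSurj := ⟨fun h => by
    -- A preimage of `h` is its weighted extension: representability makes it a left adjoint, hence
    -- cocontinuous, and it restricts to `h` as a monoidal functor.
    obtain ⟨⟨hadd, hlin, _, _⟩, hh⟩ := hP h.obj h.property
    let _ : h.obj.toFunctor.Monoidal := Functor.Monoidal.ofLaxMonoidal _
    obtain ⟨L⟩ := Extension.nonempty (k := k) Z h.obj.toFunctor
    let _ : L.functor.Monoidal := L.monoidal hZ hh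
    have := L.isLeftAdjoint hZ hh
    have hm := L.restrictIso_hom_isMonoidal hZ hh
    let H : (IsCocontinuousMonoidal.{w} k (D := D) (E := E)).FullSubcategory :=
      ⟨LaxMonoidalFunctor.of L.functor, ⟨inferInstanceAs L.functor.Additive,
        inferInstanceAs (L.functor.Linear k), inferInstanceAs (IsIso (ε L.functor)),
        fun X Y => inferInstanceAs (IsIso (μ L.functor X Y))⟩,
        (Adjunction.ofIsLeftAdjoint L.functor).leftAdjoint_preservesColimits⟩
    let e : h.obj ≅ (precomp Z).obj H.obj :=
      @LaxMonoidalFunctor.isoMk _ _ _ _ _ _ h.obj ((precomp Z).obj H.obj) (L.restrictIso hZ hh) hm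
    exact ⟨H, ⟨ObjectProperty.isoMk _ e.symm⟩⟩⟩

end Equivalence

end LinearSite

end
noncomputable section

namespace LinearSite

/-! ### Sheaf conditions for the presheaves `Hom(h -, b)` -/

section SheafAt

variable {k : Type w} [CommRing k] {a : Type u} [Category.{w} a] [Preadditive a] [Linear k a]
  {E : Type u₂} [Category.{v₂} E] [Preadditive E] [Linear k E]

/-- A `k`-linear compatible family on a sieve with values in the presheaf `Hom(h -, b)`. Its values
outside of the sieve are irrelevant. -/
structure SieveFam {X : a} (R : LinSieve k X) (h : a ⥤ E) (b : E) where
  app {V : a} (g : V ⟶ X) : h.obj V ⟶ b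
  lin {V W : a} (r : k) {g : V ⟶ X} (hg : g ∈ R.arrows V) (f : V ⟶ W) {g' : W ⟶ X}
    (hg' : g' ∈ R.arrows W) : app (r • g + f ≫ g') = r • app g + h.map f ≫ app g'

namespace SieveFam

variable {X : a} {R : LinSieve k X} {h : a ⥤ E} {b : E} (ψ : SieveFam R h b)

lemma app_zero (V : a) : ψ.app (0 : V ⟶ X) = 0 := by
  have := ψ.lin (1 : k) (R.arrows V).zero_mem (𝟙 V) (R.arrows V).zero_mem
  simpa using this

lemma app_comp {V W : a} (f : V ⟶ W) {g : W ⟶ X} (hg : g ∈ R.arrows W) :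
    ψ.app (f ≫ g) = h.map f ≫ ψ.app g := by
  have := ψ.lin (0 : k) (R.arrows V).zero_mem f hg
  simpa using this

/-- Restriction to a smaller sieve. -/
@[simps]
def restrict {R' : LinSieve k X} (hR : R' ≤ R) : SieveFam R' h b where
  app g := ψ.app g
  lin r _ hg f _ hg' := ψ.lin r (hR _ hg) f (hR _ hg')

/-- Restriction along a morphism that maps a sieve into another one. -/
@[simps]
def comap {Y : a} (f : Y ⟶ X) {R' : LinSieve k Y}
    (hR : ∀ ⦃V : a⦄ (g : V ⟶ Y), g ∈ R'.arrows V → g ≫ f ∈ R.arrows V) : SieveFam R' h b where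
  app g := ψ.app (g ≫ f)
  lin r g hg e g' hg' := by
    rw [Preadditive.add_comp, Linear.smul_comp, Category.assoc, ψ.lin r (hR _ hg) e (hR _ hg')]

end SieveFam

/-- A section of `Hom(h -, b)` is determined by its restriction to the sieve `R`. -/
def LinSieve.Separates {X : a} (R : LinSieve k X) (h : a ⥤ E) (b : E) : Prop :=
  ∀ ⦃ξ ξ' : h.obj X ⟶ b⦄,
    (∀ ⦃V : a⦄ (g : V ⟶ X), g ∈ R.arrows V → h.map g ≫ ξ = h.map g ≫ ξ') → ξ = ξ'

/-- Compatible families on the sieve `R` glue to sections of `Hom(h -, b)`. -/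
def LinSieve.Glues {X : a} (R : LinSieve k X) (h : a ⥤ E) (b : E) : Prop :=
  ∀ ψ : SieveFam R h b, ∃ ξ : h.obj X ⟶ b,
    ∀ ⦃V : a⦄ (g : V ⟶ X), g ∈ R.arrows V → h.map g ≫ ξ = ψ.app g

/-- The presheaf `Hom(h -, b)` is a sheaf. -/
def IsSheafAt (T : Topology k a) (h : a ⥤ E) (b : E) : Prop :=
  ∀ ⦃X : a⦄ ⦃R : LinSieve k X⦄, R ∈ T.covers X → R.Separates h b ∧ R.Glues h b

/-- The presheaf `Hom(h -, b)` is left exact on the sequence `σ`. -/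
def IsExactAt (h : a ⥤ E) (b : E) (σ : FormalSequence a) : Prop :=
  ∀ φ : ∀ β, h.obj (σ.q.obj β) ⟶ b, (∀ γ, ∑ᶠ β, h.map (σ.p.app γ β) ≫ φ β = 0) →
    ∃! ξ : h.obj σ.X ⟶ b, ∀ β, h.map (σ.q.map β) ≫ ξ = φ β

variable {T : Topology k a} {h : a ⥤ E} {b : E}

/-- Gluing is local: it suffices to extend a family locally to a larger covering sieve. -/
lemma glues_of_local [h.Additive] [h.Linear k]
    (hsep : ∀ ⦃X : a⦄ ⦃R : LinSieve k X⦄, R ∈ T.covers X → R.Separates h b)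
    {X : a} {v : Family X} {W : LinSieve k X} (hW : W ∈ T.covers X) (hWv : W ≤ v.sieve k)
    (hv : (v.sieve k).Glues h b) (t : ∀ α, LinSieve k (v.obj α))
    (ht : ∀ α, t α ∈ T.covers (v.obj α)) (htg : ∀ α, (t α).Glues h b)
    (htW : ∀ α ⦃V : a⦄ (g : V ⟶ v.obj α), g ∈ (t α).arrows V → g ≫ v.map α ∈ W.arrows V) :
    W.Glues h b := by
  intro ψ
  -- `Good f η` says that `η` has the values prescribed by `ψ` on the sieve `f⁻¹ W`. As `W` covers,
  -- there is at most one such `η`. Finding one for each `f` in the sieve of `v` extends `ψ` to that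
  -- sieve.
  let Good {V : a} (f : V ⟶ X) (η : h.obj V ⟶ b) : Prop :=
    ∀ ⦃U : a⦄ (g : U ⟶ V), g ≫ f ∈ W.arrows U → h.map g ≫ η = ψ.app (g ≫ f)
  have uniq {V : a} {f : V ⟶ X} {η η' : h.obj V ⟶ b} (h₁ : Good f η) (h₂ : Good f η') :
      η = η' :=
    hsep (T.pullback_mem hW f) fun U g hg => (h₁ g hg).trans (h₂ g hg).symm
  have lin {V V' : a} (r : k) {f : V ⟶ X} {η : h.obj V ⟶ b} (h₁ : Good f η) (e : V ⟶ V')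
      {f' : V' ⟶ X} {η' : h.obj V' ⟶ b} (h₂ : Good f' η') :
      Good (r • f + e ≫ f') (r • η + h.map e ≫ η') := by
    intro U g hg
    -- Membership of the combination in `W` does not put its two terms in `W`. Passing to two
    -- successive covers brings both into `W`, where `ψ` is linear.
    refine hsep (T.pullback_mem hW (g ≫ f)) fun U₁ g₁ hg₁ => ?_
    refine hsep (T.pullback_mem hW (g₁ ≫ g ≫ e ≫ f')) fun U₂ g₂ hg₂ => ?_
    have m₁ : (g₂ ≫ g₁ ≫ g) ≫ f ∈ W.arrows U₂ := by
      simpa using W.precomp_mem g₂ hg₁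
    have m₂ : (g₂ ≫ g₁ ≫ g ≫ e) ≫ f' ∈ W.arrows U₂ := by
      have : g₂ ≫ g₁ ≫ g ≫ e ≫ f' ∈ W.arrows U₂ := hg₂
      simpa using this
    have m₃ := W.precomp_mem g₁ hg
    have e₁ := h₁ _ m₁
    have e₂ := h₂ _ m₂
    rw [← ψ.app_comp g₁ hg, ← ψ.app_comp g₂ m₃]
    have e₃ := ψ.lin r m₁ (𝟙 _) m₂
    simp only [Category.id_comp, ← e₁, ← e₂] at e₃
    simp only [Category.assoc, Preadditive.comp_add, Linear.comp_smul, Functor.map_comp,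
      CategoryTheory.Functor.map_id, Category.id_comp] at e₃ ⊢
    exact e₃.symm
  choose ξ hξ using fun α => htg α (ψ.comap (v.map α) (htW α))
  simp only [SieveFam.comap_app] at hξ
  have zero (V : a) : Good (0 : V ⟶ X) 0 := fun U g _ => by simp [ψ.app_zero]
  have ex {V : a} {f : V ⟶ X} (hf : f ∈ (v.sieve k).arrows V) : ∃ η, Good f η := by
    refine Submodule.span_induction ?_ ⟨0, zero V⟩ ?_ ?_ hf
    · rintro _ ⟨α, g₀, rfl⟩
      refine ⟨h.map g₀ ≫ ξ α, fun U g hg => ?_⟩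
      -- The section `ξ α` is known to agree with `ψ` only on `t α`, so the equality is tested on
      -- the covering sieve `(g ≫ g₀)⁻¹ (t α)`.
      refine hsep (T.pullback_mem (ht α) (g ≫ g₀)) fun U₁ g₁ hg₁ => ?_
      have := hξ α _ hg₁
      rw [← ψ.app_comp g₁ hg]
      simpa using this
    · rintro f f' - - ⟨η, hη⟩ ⟨η', hη'⟩
      exact ⟨η + η', by simpa using lin 1 hη (𝟙 V) hη'⟩
    · rintro r f - ⟨η, hη⟩
      exact ⟨r • η, by simpa using lin r hη (𝟙 V) (zero V)⟩
  classical
  let Ψ : SieveFam (v.sieve k) h b :=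
    { app := fun {V} f => if hf : f ∈ (v.sieve k).arrows V then (ex hf).choose else 0
      lin := fun {V V'} r f hf e f' hf' => by
        have hm := Submodule.add_mem _ (Submodule.smul_mem _ r hf) ((v.sieve k).precomp_mem e hf')
        rw [dif_pos hf, dif_pos hf', dif_pos hm]
        exact uniq (ex hm).choose_spec (lin r (ex hf).choose_spec e (ex hf').choose_spec) }
  obtain ⟨ζ, hζ⟩ := hv Ψ
  refine ⟨ζ, fun V f hf => ?_⟩
  have hf' := hWv V hf
  rw [hζ f hf']
  change (if hf : f ∈ (v.sieve k).arrows V then (ex hf).choose else 0) = _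
  rw [dif_pos hf']
  simpa using (ex hf').choose_spec (𝟙 V) (by simpa using hf)

end SheafAt

/-! #### Row-finite vectors -/

section Rows

variable {k : Type w} [CommRing k] {a : Type u} [Category.{w} a] [Preadditive a] [Linear k a]
  {E : Type u₂} [Category.{v₂} E] [Preadditive E] [Linear k E] {h : a ⥤ E} [h.Additive]
  {b : E} {ι : Type*} {Y : ι → a}

lemma finite_row {A : a} {f : ∀ β, A ⟶ Y β} (hf : {β | f β ≠ 0}.Finite)
    (φ : ∀ β, h.obj (Y β) ⟶ b) : (Function.support fun β => h.map (f β) ≫ φ β).Finite :=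
  hf.subset fun β hβ H => hβ (by simp [H])

lemma finite_lin {A A' : a} (r : k) {f : ∀ β, A ⟶ Y β} (hf : {β | f β ≠ 0}.Finite) (e : A ⟶ A')
    {f' : ∀ β, A' ⟶ Y β} (hf' : {β | f' β ≠ 0}.Finite) :
    {β | r • f β + e ≫ f' β ≠ 0}.Finite := by
  refine (hf.union hf').subset fun β hβ => ?_
  by_contra H
  simp only [Set.mem_union, Set.mem_ofPred_eq, not_or, not_not] at H
  exact hβ (by simp [H.1, H.2])

lemma comp_finsum_row {A : a} {f : ∀ β, A ⟶ Y β} (hf : {β | f β ≠ 0}.Finite)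
    (φ : ∀ β, h.obj (Y β) ⟶ b) {c : E} (g : c ⟶ h.obj A) :
    g ≫ ∑ᶠ β, h.map (f β) ≫ φ β = ∑ᶠ β, g ≫ h.map (f β) ≫ φ β :=
  (Preadditive.leftComp b g).map_finsum (finite_row hf φ)

lemma finsum_row_comp {A : a} {f : ∀ β, A ⟶ Y β} (hf : {β | f β ≠ 0}.Finite)
    (φ : ∀ β, h.obj (Y β) ⟶ b) {c : E} (g : b ⟶ c) :
    (∑ᶠ β, h.map (f β) ≫ φ β) ≫ g = ∑ᶠ β, h.map (f β) ≫ φ β ≫ g := by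
  refine ((Preadditive.rightComp (h.obj A) g).map_finsum (finite_row hf φ)).trans ?_
  exact finsum_congr fun β => Category.assoc _ _ _

lemma finsum_lin [h.Linear k] {A A' : a} (r : k) {f : ∀ β, A ⟶ Y β} (hf : {β | f β ≠ 0}.Finite)
    (e : A ⟶ A') {f' : ∀ β, A' ⟶ Y β} (hf' : {β | f' β ≠ 0}.Finite) (φ : ∀ β, h.obj (Y β) ⟶ b) :
    ∑ᶠ β, h.map (r • f β + e ≫ f' β) ≫ φ β =
      r • ∑ᶠ β, h.map (f β) ≫ φ β + h.map e ≫ ∑ᶠ β, h.map (f' β) ≫ φ β := by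
  have h₁ : (Function.support fun β => r • h.map (f β) ≫ φ β).Finite :=
    hf.subset fun β hβ H => hβ (by simp [H])
  have h₂ : (Function.support fun β => h.map e ≫ h.map (f' β) ≫ φ β).Finite :=
    hf'.subset fun β hβ H => hβ (by simp [H])
  rw [comp_finsum_row hf' φ, smul_finsum' r (finite_row hf φ), ← finsum_add_distrib h₁ h₂]
  simp

lemma comp_finsum_map {A : a} {f : ∀ β, A ⟶ Y β} (hf : {β | f β ≠ 0}.Finite) {X : a}
    (q : ∀ β, Y β ⟶ X) : h.map (∑ᶠ β, f β ≫ q β) = ∑ᶠ β, h.map (f β) ≫ h.map (q β) := by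
  have : (Function.support fun β => f β ≫ q β).Finite :=
    hf.subset fun β hβ H => hβ (by simp [H])
  have := (h.mapAddHom (X := A) (Y := X)).map_finsum this
  simpa using this

lemma SieveFam.app_finsum {X : a} {R : LinSieve k X} (ψ : SieveFam R h b) {A : a}
    {f : ∀ β, A ⟶ Y β} (hf : {β | f β ≠ 0}.Finite) {q : ∀ β, Y β ⟶ X}
    (hq : ∀ β, q β ∈ R.arrows (Y β)) :
    ψ.app (∑ᶠ β, f β ≫ q β) = ∑ᶠ β, h.map (f β) ≫ ψ.app (q β) := by
  have h₁ : (Function.support fun β => f β ≫ q β) ⊆ hf.toFinset :=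
    fun β hβ => by simpa using fun H => hβ (by simp [H])
  have h₂ : (Function.support fun β => h.map (f β) ≫ ψ.app (q β)) ⊆ hf.toFinset :=
    fun β hβ => by simpa using fun H => hβ (by simp [H])
  rw [finsum_eq_sum_of_support_subset _ h₁, finsum_eq_sum_of_support_subset _ h₂]
  generalize hf.toFinset = s
  -- The family is linear only inside `R`, so membership of the partial sums is carried along in the
  -- induction.
  have : ∀ s : Finset ι, (∑ β ∈ s, f β ≫ q β) ∈ R.arrows A ∧
      ψ.app (∑ β ∈ s, f β ≫ q β) = ∑ β ∈ s, h.map (f β) ≫ ψ.app (q β) := by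
    classical
    intro s
    induction s using Finset.induction_on with
    | empty => exact ⟨by simp, by simp [ψ.app_zero]⟩
    | insert β s hβ ih =>
      rw [Finset.sum_insert hβ, Finset.sum_insert hβ, add_comm, ← ih.2]
      refine ⟨Submodule.add_mem _ ih.1 (R.precomp_mem _ (hq β)), ?_⟩
      have := ψ.lin (1 : k) ih.1 (f β) (hq β)
      rw [one_smul, one_smul] at this
      rw [this, add_comm]
  exact (this s).2

lemma Family.mem_sieve {X : a} (q : Family X) (β : q.ι) : q.map β ∈ (q.sieve k).arrows _ :=
  Submodule.subset_span ⟨β, 𝟙 _, by simp⟩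

lemma Family.exists_row_of_mem {X : a} (q : Family X) {A : a} {g : A ⟶ X}
    (hg : g ∈ (q.sieve k).arrows A) :
    ∃ f : ∀ β, A ⟶ q.obj β, {β | f β ≠ 0}.Finite ∧ ∑ᶠ β, f β ≫ q.map β = g := by
  classical
  -- Viewing the sum through the identity functor makes `finsum_lin` applicable to rows in `a`
  -- itself.
  have key (f : ∀ β, A ⟶ q.obj β) (g : A ⟶ X) : ∑ᶠ β, f β ≫ q.map β = g ↔
      ∑ᶠ β, (𝟭 a).map (f β) ≫ q.map β = g := Iff.rfl
  refine Submodule.span_induction ?_ ⟨fun _ => 0, by simp, by simp⟩ ?_ ?_ hg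
  · rintro _ ⟨α, g, rfl⟩
    refine ⟨Function.update (fun _ => 0) α g, (Set.finite_singleton α).subset fun β hβ => ?_, ?_⟩
    · by_contra H
      exact hβ (Function.update_of_ne (by simpa using H) _ _)
    · rw [finsum_eq_single _ α fun β hβ => by rw [Function.update_of_ne hβ, zero_comp]]
      rw [Function.update_self]
  · rintro g g' - - ⟨f, hf, rfl⟩ ⟨f', hf', rfl⟩
    refine ⟨_, finite_lin (1 : k) hf (𝟙 A) hf', (key _ _).2 ?_⟩
    rw [finsum_lin (h := 𝟭 a) (1 : k) hf (𝟙 A) hf' fun β => (q.map β : (𝟭 a).obj _ ⟶ X)]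
    simp
  · rintro r g - ⟨f, hf, rfl⟩
    have h0 : {β | (fun β => (0 : A ⟶ q.obj β)) β ≠ 0}.Finite := by simp
    refine ⟨_, finite_lin r hf (𝟙 A) h0, (key _ _).2 ?_⟩
    rw [finsum_lin (h := 𝟭 a) r hf (𝟙 A) h0 fun β => (q.map β : (𝟭 a).obj _ ⟶ X)]
    simp

end Rows

end LinearSite

end
noncomputable section

namespace LinearSite

/-! ### Sheaves for a topology that is given by a pretopology -/

section PretopologySheaf

variable {k : Type w} [CommRing k] {a : Type u} [Category.{w} a] [Preadditive a] [Linear k a]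
  {E : Type u₂} [Category.{v₂} E] [Preadditive E] [Linear k E]
  {T : Topology k a} {S : Set (FormalSequence a)} {h : a ⥤ E} [h.Additive] {b : E}

lemma sieve_mem_covers (hTS : T.covers = top k S) {X : a} {r : Family X} (hr : CoTilde S X r) :
    r.sieve k ∈ T.covers X := by
  rw [hTS]
  exact ⟨r, hr, fun _ => le_refl _⟩

/-- The components of `ξ'` along `q` satisfy the relations because `q ∘ p = 0`, so the uniqueness
part of exactness applies. -/
lemma IsExactAt.eq_of_comp_eq {σ : FormalSequence a} (hσ : IsExactAt h b σ)
    {ξ ξ' : h.obj σ.X ⟶ b} (H : ∀ β, h.map (σ.q.map β) ≫ ξ = h.map (σ.q.map β) ≫ ξ') :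
    ξ = ξ' := by
  refine (hσ (fun β => h.map (σ.q.map β) ≫ ξ') fun γ => ?_).unique H fun _ => rfl
  have := congrArg (fun f => h.map f ≫ ξ') (σ.zero γ)
  simp only [Functor.map_zero, zero_comp] at this
  rw [comp_finsum_map (σ.p.finite γ), finsum_row_comp (σ.p.finite γ)] at this
  exact this

lemma CoIter.eq_of_comp_eq (hex : ∀ σ ∈ S, IsExactAt h b σ) {n : ℕ} {X : a} {r : Family X}
    (hr : CoIter S n X r) {ξ ξ' : h.obj X ⟶ b}
    (H : ∀ i, h.map (r.map i) ≫ ξ = h.map (r.map i) ≫ ξ') : ξ = ξ' := by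
  induction hr with
  | zero X =>
    have := H PUnit.unit
    simpa [Family.id] using this
  | one hq =>
    obtain ⟨σ, hσ⟩ := hq
    exact (hex σ hσ).eq_of_comp_eq H
  | step hv t ht ih =>
    refine ih fun α => ?_
    have key : ∀ {Y : a} (q : Family Y), Co S Y q → ∀ {ζ ζ' : h.obj Y ⟶ b},
        (∀ i, h.map (q.map i) ≫ ζ = h.map (q.map i) ≫ ζ') → ζ = ζ' := by
      rintro Y q ⟨σ, hσ⟩ ζ ζ' H
      exact (hex σ hσ).eq_of_comp_eq H
    refine key _ (ht α) fun i => ?_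
    have := H ⟨α, i⟩
    simpa [Family.comp] using this

lemma separates_of_isExactAt (hTS : T.covers = top k S) (hex : ∀ σ ∈ S, IsExactAt h b σ) {X : a}
    {R : LinSieve k X} (hR : R ∈ T.covers X) : R.Separates h b := by
  rw [hTS] at hR
  obtain ⟨r, ⟨n, hr⟩, hrR⟩ := hR
  exact fun ξ ξ' H => hr.eq_of_comp_eq hex fun i => H _ (hrR _ (r.mem_sieve i))

lemma eq_on_sieve [h.Linear k] {X : a} {q : Family X} (ψ : SieveFam (q.sieve k) h b)
    {ξ : h.obj X ⟶ b} (H : ∀ i, h.map (q.map i) ≫ ξ = ψ.app (q.map i)) ⦃V : a⦄ (g : V ⟶ X)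
    (hg : g ∈ (q.sieve k).arrows V) : h.map g ≫ ξ = ψ.app g := by
  obtain ⟨f, hf, rfl⟩ := q.exists_row_of_mem hg
  rw [ψ.app_finsum hf q.mem_sieve, comp_finsum_map hf, finsum_row_comp hf]
  exact finsum_congr fun β => by rw [H]

lemma Co.glues [h.Linear k] (hex : ∀ σ ∈ S, IsExactAt h b σ) {X : a} {q : Family X}
    (hq : Co S X q) : (q.sieve k).Glues h b := by
  obtain ⟨σ, hσ⟩ := hq
  intro ψ
  obtain ⟨ξ, hξ, -⟩ := hex σ hσ (fun β => ψ.app (σ.q.map β)) fun γ => by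
    rw [← ψ.app_finsum (σ.p.finite γ) σ.q.mem_sieve, σ.zero, ψ.app_zero]
  exact ⟨ξ, eq_on_sieve ψ hξ⟩

/-- Induction over the iteration: a family on the sieve of a composite covering first extends to the
sieve of the outer covering, by gluing along the inner ones (`glues_of_local`), and then glues
there. -/
lemma CoIter.glues [h.Linear k] (hTS : T.covers = top k S) (hex : ∀ σ ∈ S, IsExactAt h b σ)
    {n : ℕ} {X : a} {r : Family X} (hr : CoIter S n X r) : (r.sieve k).Glues h b := by
  induction hr with
  | zero X =>
    refine fun ψ => ⟨ψ.app (𝟙 X), eq_on_sieve ψ fun i => ?_⟩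
    change h.map (𝟙 X) ≫ _ = ψ.app (𝟙 X)
    simp
  | one hq => exact hq.glues hex
  | @step n X v hv t ht ih =>
    refine glues_of_local (T := T) (fun _ _ => separates_of_isExactAt hTS hex)
      (sieve_mem_covers hTS ⟨_, .step hv t ht⟩) (fun V => ?_) ih (fun α => (t α).sieve k)
      (fun α => sieve_mem_covers hTS ⟨1, .one (ht α)⟩) (fun α => (ht α).glues hex)
      fun α V g hg => ?_
    · refine Submodule.span_le.2 ?_
      rintro _ ⟨⟨α, i⟩, g, rfl⟩
      exact Submodule.subset_span ⟨α, g ≫ (t α).map i, (Category.assoc _ _ _).symm⟩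
    · have : (t α).sieve k ≤ ((v.comp t).sieve k).pullback (v.map α) := fun V => by
        refine Submodule.span_le.2 ?_
        rintro _ ⟨i, g, rfl⟩
        exact Submodule.subset_span ⟨⟨α, i⟩, g, by simp [Family.comp]⟩
      exact this V hg

/-- Exactness on a pretopology implies the sheaf condition. -/
theorem isSheafAt_of_isExactAt [h.Linear k] (hTS : T.covers = top k S)
    (hex : ∀ σ ∈ S, IsExactAt h b σ) : IsSheafAt T h b := by
  intro X R hR
  refine ⟨separates_of_isExactAt hTS hex hR, fun ψ => ?_⟩
  have hR' := hR
  rw [hTS] at hR'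
  obtain ⟨r, ⟨n, hr⟩, hrR⟩ := hR'
  obtain ⟨ξ, hξ⟩ := hr.glues hTS hex (ψ.restrict hrR)
  refine ⟨ξ, fun V g hg => ?_⟩
  -- The glued section is so far controlled only on the sieve of `r`. For `g` in the larger sieve
  -- `R`, the pullback of that sieve along `g` covers, and separatedness gives the equality at `g`.
  refine separates_of_isExactAt hTS hex
    (T.pullback_mem (sieve_mem_covers hTS ⟨n, hr⟩) g) fun U e he => ?_
  rw [← ψ.app_comp e hg, ← Category.assoc, ← h.map_comp]
  exact hξ _ he

/-- The sheaf condition implies exactness on a pretopology. -/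
theorem isExactAt_of_isSheafAt [h.Linear k] (hS : IsPretopology S) (hTS : T.covers = top k S)
    (hsh : IsSheafAt T h b) {σ : FormalSequence a} (hσ : σ ∈ S) : IsExactAt h b σ := by
  classical
  intro φ hφ
  have hq : σ.q.sieve k ∈ T.covers σ.X := sieve_mem_covers hTS ⟨1, .one (.mk σ hσ)⟩
  -- If a row `f` is killed by `q`, the second pretopology axiom lifts it locally through `p`, so `φ
  -- ∘ f` is locally `φ ∘ p ∘ f' = 0` and vanishes by separatedness.
  have wd₀ {A : a} (f : ∀ β, A ⟶ σ.q.obj β) (hf : {β | f β ≠ 0}.Finite)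
      (h0 : ∑ᶠ β, f β ≫ σ.q.map β = 0) : ∑ᶠ β, h.map (f β) ≫ φ β = 0 := by
    obtain ⟨q', hq', f', hf'⟩ := hS.ptb hσ f hf h0
    refine (hsh (sieve_mem_covers hTS hq')).1 fun V g hg => ?_
    obtain ⟨e, he, rfl⟩ := q'.exists_row_of_mem hg
    rw [comp_finsum_map he, finsum_row_comp he, comp_zero]
    refine finsum_eq_zero_of_forall_eq_zero fun i => ?_
    suffices h.map (q'.map i) ≫ ∑ᶠ β, h.map (f β) ≫ φ β = 0 by rw [this, comp_zero]
    have h₁ (β) : h.map (q'.map i) ≫ h.map (f β) ≫ φ β =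
        ∑ γ ∈ (f'.finite i).toFinset, h.map (f'.app i γ) ≫ h.map (σ.p.app γ β) ≫ φ β := by
      have hsub : (Function.support fun γ => f'.app i γ ≫ σ.p.app γ β) ⊆
          (f'.finite i).toFinset := fun γ hγ => by simpa using fun H => hγ (by simp [H])
      rw [← Category.assoc, ← h.map_comp, ← hf' i β, finsum_eq_sum_of_support_subset _ hsub]
      simp [Preadditive.sum_comp]
    rw [comp_finsum_row hf, finsum_congr h₁, finsum_sum_comm _ _ fun γ _ =>
      (σ.p.finite γ).subset fun β hβ H => hβ (by simp [H])]
    refine Finset.sum_eq_zero fun γ _ => ?_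
    rw [← comp_finsum_row (σ.p.finite γ), hφ, comp_zero]
  -- Two rows with the same image in `X` differ by a row killed by `q`; the coefficient `-1` forms
  -- that difference.
  have wd {A : a} (f f' : ∀ β, A ⟶ σ.q.obj β) (hf : {β | f β ≠ 0}.Finite)
      (hf' : {β | f' β ≠ 0}.Finite) (H : ∑ᶠ β, f β ≫ σ.q.map β = ∑ᶠ β, f' β ≫ σ.q.map β) :
      ∑ᶠ β, h.map (f β) ≫ φ β = ∑ᶠ β, h.map (f' β) ≫ φ β := by
    have h₁ := finsum_lin (h := 𝟭 a) (-1 : k) hf' (𝟙 A) hf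
      fun β => (σ.q.map β : (𝟭 a).obj _ ⟶ σ.X)
    have h₂ := finsum_lin (-1 : k) hf' (𝟙 A) hf φ
    have h₃ := wd₀ _ (finite_lin (-1 : k) hf' (𝟙 A) hf) (h₁.trans (by simp [H]))
    rw [h₂] at h₃
    simp only [neg_smul, one_smul, CategoryTheory.Functor.map_id, Category.id_comp] at h₃
    exact (neg_add_eq_zero.1 h₃).symm
  choose row fin hrow using fun (A : a) (g : A ⟶ σ.X) (hg : g ∈ (σ.q.sieve k).arrows A) =>
    σ.q.exists_row_of_mem hg
  -- The value at `g` is computed from a chosen expression of `g` through `q`. By `wd` it does not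
  -- depend on the choice, and hence it is linear.
  let ψ : SieveFam (σ.q.sieve k) h b :=
    { app := fun {A} g => if hg : g ∈ (σ.q.sieve k).arrows A then
        ∑ᶠ β, h.map (row A g hg β) ≫ φ β else 0
      lin := fun {A A'} r g hg e g' hg' => by
        have hm := Submodule.add_mem _ (Submodule.smul_mem _ r hg)
          ((σ.q.sieve k).precomp_mem e hg')
        rw [dif_pos hg, dif_pos hg', dif_pos hm, ← finsum_lin r (fin _ _ hg) e (fin _ _ hg')]
        refine wd _ _ (fin _ _ _) (finite_lin r (fin _ _ hg) e (fin _ _ hg')) ?_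
        have := finsum_lin (h := 𝟭 a) r (fin _ _ hg) e (fin _ _ hg')
          fun β => (σ.q.map β : (𝟭 a).obj _ ⟶ σ.X)
        rw [hrow]
        refine Eq.trans ?_ this.symm
        simp only [Functor.id_map]
        erw [hrow, hrow] }
  have hψ (β) : ψ.app (σ.q.map β) = φ β := by
    change (if hg : σ.q.map β ∈ (σ.q.sieve k).arrows _ then
        ∑ᶠ β', h.map (row _ (σ.q.map β) hg β') ≫ φ β' else 0) = _
    -- The unit row at `β` is another expression of `q_β` through `q`, and it evaluates to `φ β`.
    let δ : ∀ β', σ.q.obj β ⟶ σ.q.obj β' := Function.update (fun _ => 0) β (𝟙 (σ.q.obj β))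
    have hδ {β'} (hβ' : β' ≠ β) : δ β' = 0 := Function.update_of_ne hβ' _ _
    have hδβ : δ β = 𝟙 _ := Function.update_self _ _ _
    have hs : {β' | δ β' ≠ 0}.Finite := (Set.finite_singleton β).subset fun β' hβ' => by
      by_contra H
      exact hβ' (hδ (by simpa using H))
    rw [dif_pos (σ.q.mem_sieve β), wd _ δ (fin _ _ _) hs,
      finsum_eq_single _ β fun β' hβ' => by
        rw [hδ hβ', h.map_zero, zero_comp]]
    · simp [hδβ]
    · rw [hrow, finsum_eq_single _ β fun β' hβ' => by rw [hδ hβ', zero_comp]]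
      simp [hδβ]
  obtain ⟨ξ, hξ⟩ := (hsh hq).2 ψ
  refine ⟨ξ, fun β => (hξ _ (σ.q.mem_sieve β)).trans (hψ β), fun ξ' hξ' => ?_⟩
  refine (hsh hq).1 fun V g hg => (eq_on_sieve ψ (fun β => ?_) g hg).trans (hξ g hg).symm
  rw [hψ]
  exact hξ' β

end PretopologySheaf

end LinearSite

end
noncomputable section

namespace LinearSite

/-! ### Functors that send a formal sequence to a cokernel diagram -/

section Exactness

variable {a : Type u} [Category.{w} a] [Preadditive a]
  {E : Type u₂} [Category.{v₂} E] [Preadditive E]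
  {E' : Type u₃} [Category.{v₃} E'] [Preadditive E']
  {h : a ⥤ E} [h.Additive] {σ τ : FormalSequence a}

lemma IsExactAt.of_natIso {b : E} (hσ : IsExactAt h b σ) {h' : a ⥤ E} (θ : h' ≅ h) :
    IsExactAt h' b σ := by
  intro φ hφ
  obtain ⟨ξ, hξ, huniq⟩ := hσ (fun β => θ.inv.app _ ≫ φ β) fun γ => by
    have := hφ γ
    rw [← cancel_epi (θ.hom.app _), comp_zero, comp_finsum_row (σ.p.finite γ)]
    simpa using this
  refine ⟨θ.hom.app _ ≫ ξ, fun β => by simp [hξ], fun ξ' hξ' => ?_⟩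
  rw [← huniq (θ.inv.app _ ≫ ξ') fun β => by simp [← hξ'], Iso.hom_inv_id_app_assoc]

lemma IsExactAt.of_iso {b : E} (hτ : IsExactAt h b τ) (e : σ.Iso τ) : IsExactAt h b σ := by
  intro φ hφ
  let φ' : ∀ j, h.obj (τ.q.obj j) ⟶ b :=
    Equiv.piCongrLeft (fun j => h.obj (τ.q.obj j) ⟶ b) e.eY
      fun β => h.map (e.isoY β).inv ≫ φ β
  have hφ' (β) : φ' (e.eY β) = h.map (e.isoY β).inv ≫ φ β :=
    Equiv.piCongrLeft_apply_apply (fun j => h.obj (τ.q.obj j) ⟶ b) e.eY _ β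
  have hp (γ β) : τ.p.app (e.eZ γ) (e.eY β) ≫ (e.isoY β).inv =
      (e.isoZ γ).inv ≫ σ.p.app γ β := by
    rw [Iso.comp_inv_eq, Category.assoc, e.commp, Iso.inv_hom_id_assoc]
  obtain ⟨ξ, hξ, huniq⟩ := hτ φ' fun j => by
    obtain ⟨γ, rfl⟩ := e.eZ.surjective j
    rw [← finsum_comp_equiv e.eY]
    have key (β) : h.map (τ.p.app (e.eZ γ) (e.eY β)) ≫ φ' (e.eY β) =
        h.map (e.isoZ γ).inv ≫ h.map (σ.p.app γ β) ≫ φ β := by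
      rw [hφ', ← Category.assoc, ← h.map_comp, hp, h.map_comp, Category.assoc]
    rw [finsum_congr key, ← comp_finsum_row (σ.p.finite γ), hφ, comp_zero]
  refine ⟨h.map e.isoX.hom ≫ ξ, fun β => ?_, fun ξ' hξ' => ?_⟩
  · rw [← Category.assoc, ← h.map_comp, e.commq, h.map_comp, Category.assoc, hξ, hφ',
      ← Category.assoc, ← h.map_comp, Iso.hom_inv_id, h.map_id, Category.id_comp]
  · rw [← huniq (h.map e.isoX.inv ≫ ξ') fun j => ?_, ← Category.assoc, ← h.map_comp,
      Iso.hom_inv_id, h.map_id, Category.id_comp]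
    obtain ⟨β, rfl⟩ := e.eY.surjective j
    have : τ.q.map (e.eY β) ≫ e.isoX.inv = (e.isoY β).inv ≫ σ.q.map β := by
      rw [Iso.comp_inv_eq, Category.assoc, e.commq, Iso.inv_hom_id_assoc]
    rw [hφ', ← hξ', ← Category.assoc, ← h.map_comp, this, h.map_comp, Category.assoc]

/-- `h` sends `σ` to a cokernel diagram, expressed without coproducts. -/
def IsExactOn (h : a ⥤ E) (σ : FormalSequence a) : Prop := ∀ b : E, IsExactAt h b σ

/-- Tuples `φ` are morphisms out of the coproduct of the `h Y_β`, and the relations say that such a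
morphism is killed by `d`. Arbitrary colimit cofans are allowed so that the criterion also applies
to images of coproducts under a functor. -/
lemma isExactOn_iff {cY : Cofan fun β => h.obj (σ.q.obj β)} (hY : IsColimit cY)
    {cZ : Cofan fun γ => h.obj (σ.Z γ)} (hZ : IsColimit cZ) (d : cZ.pt ⟶ cY.pt)
    (hd : ∀ γ, cZ.inj γ ≫ d = ∑ᶠ β, h.map (σ.p.app γ β) ≫ cY.inj β) (π : cY.pt ⟶ h.obj σ.X)
    (hπ : ∀ β, cY.inj β ≫ π = h.map (σ.q.map β)) (e : d ≫ π = 0) :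
    IsExactOn h σ ↔ Nonempty (IsColimit (CokernelCofork.ofπ π e)) := by
  have hd' {b : E} (g : cY.pt ⟶ b) (γ) :
      cZ.inj γ ≫ d ≫ g = ∑ᶠ β, h.map (σ.p.app γ β) ≫ cY.inj β ≫ g := by
    rw [← Category.assoc, hd, finsum_row_comp (σ.p.finite γ)]
  constructor
  · intro H
    have key {b : E} (g : cY.pt ⟶ b) (hg : d ≫ g = 0) := H b (fun β => cY.inj β ≫ g)
      fun γ => by rw [← hd', hg, comp_zero]
    refine ⟨CokernelCofork.IsColimit.ofπ π e (fun g hg => (key g hg).choose)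
      (fun g hg => Cofan.IsColimit.hom_ext hY _ _ fun β => ?_)
      (fun g hg m hm => (key g hg).choose_spec.2 m fun β => ?_)⟩
    · rw [← Category.assoc, hπ]
      exact (key g hg).choose_spec.1 β
    · rw [← hπ, Category.assoc, hm]
  · rintro ⟨hc⟩ b φ hφ
    have hg : d ≫ Cofan.IsColimit.desc hY φ = 0 := Cofan.IsColimit.hom_ext hZ _ _ fun γ => by
      rw [hd', comp_zero, ← hφ γ]
      exact finsum_congr fun β => by rw [Cofan.IsColimit.fac]
    have hfac : π ≫ hc.desc (CokernelCofork.ofπ _ hg) = Cofan.IsColimit.desc hY φ :=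
      hc.fac (CokernelCofork.ofπ _ hg) .one
    refine ⟨hc.desc (CokernelCofork.ofπ _ hg), fun β => ?_, fun ξ hξ => ?_⟩
    · rw [← hπ, Category.assoc, hfac, Cofan.IsColimit.fac]
    · refine Cofork.IsColimit.hom_ext hc ?_
      change π ≫ _ = π ≫ _
      rw [hfac]
      refine Cofan.IsColimit.hom_ext hY _ _ fun β => ?_
      rw [← Category.assoc, hπ, hξ, Cofan.IsColimit.fac]

lemma finsum_desc_comp [HasColimitsOfSize.{w, w} E]
    [HasCoproduct fun β => h.obj (σ.q.obj β)] [HasCoproduct fun γ => h.obj (σ.Z γ)] :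
    Sigma.desc (fun γ => ∑ᶠ β, h.map (σ.p.app γ β) ≫ Sigma.ι (fun β => h.obj (σ.q.obj β)) β) ≫
      Sigma.desc (fun β => h.map (σ.q.map β)) = (0 : ∐ (fun γ => h.obj (σ.Z γ)) ⟶ h.obj σ.X) := by
  refine Sigma.hom_ext _ _ fun γ => ?_
  rw [Sigma.ι_desc_assoc, comp_zero, finsum_row_comp (σ.p.finite γ)]
  simp only [Sigma.ι_desc]
  rw [← comp_finsum_map (σ.p.finite γ), σ.zero, h.map_zero]

lemma isExactOn_iff_isColimit [HasColimitsOfSize.{w, w} E] :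
    IsExactOn h σ ↔ Nonempty (IsColimit (CokernelCofork.ofπ _ (finsum_desc_comp (h := h)
      (σ := σ)))) :=
  isExactOn_iff (coproductIsCoproduct _) (coproductIsCoproduct _) _
    (fun _ => Sigma.ι_desc _ _) _ (fun _ => Sigma.ι_desc _ _) _

lemma sendsToCokernel_iff {B : Type u'} [Category.{w} B] [Preadditive B] [HasColimits B]
    {h : a ⥤ B} [h.Additive] : SendsToCokernel h σ ↔ IsExactOn h σ :=
  ⟨fun ⟨_, H⟩ => isExactOn_iff_isColimit.2 H, fun H => ⟨_, isExactOn_iff_isColimit.1 H⟩⟩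

/-- The functor `G` carries the coproducts and the cokernel in `E` to colimits in `E'`, and the
criterion is applied to these images, with no cocompleteness of `E'`. -/
lemma IsExactOn.comp [HasColimitsOfSize.{w, w} E] (hσ : IsExactOn h σ) (G : E ⥤ E') [G.Additive]
    [PreservesColimitsOfSize.{w, w} G] : IsExactOn (h ⋙ G) σ := by
  obtain ⟨hc⟩ := isExactOn_iff_isColimit.1 hσ
  have := preservesColimit_parallelPair_of_size.{w} G
  refine (isExactOn_iff (h := h ⋙ G)
    (isColimitCofanMkObjOfIsColimit G _ _ (coproductIsCoproduct fun β => h.obj (σ.q.obj β)))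
    (isColimitCofanMkObjOfIsColimit G _ _ (coproductIsCoproduct fun γ => h.obj (σ.Z γ)))
    (G.map (Sigma.desc fun γ =>
      ∑ᶠ β, h.map (σ.p.app γ β) ≫ Sigma.ι (fun β => h.obj (σ.q.obj β)) β)) (fun γ => ?_)
    (G.map (Sigma.desc fun β => h.map (σ.q.map β))) (fun β => ?_)
    (by rw [← G.map_comp, finsum_desc_comp, G.map_zero])).2
      ⟨CokernelCofork.mapIsColimit _ hc G⟩
  · dsimp [Cofan.inj]
    rw [← G.map_comp, Sigma.ι_desc, comp_finsum_map (h := G) (Y := fun β => h.obj (σ.q.obj β))]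
    exact (σ.p.finite γ).subset fun β hβ H => hβ (by simp [H])
  · dsimp [Cofan.inj]
    rw [← G.map_comp, Sigma.ι_desc]

lemma IsExactOn.of_natIso (hσ : IsExactOn h σ) {h' : a ⥤ E} (θ : h' ≅ h) : IsExactOn h' σ :=
  fun b => (hσ b).of_natIso θ

lemma IsExactOn.of_iso (hτ : IsExactOn h τ) (e : σ.Iso τ) : IsExactOn h σ :=
  fun b => (hτ b).of_iso e

/-- Monoidality gives `h (A ⊗ -) ≅ h A ⊗ h -`, and tensoring in `E` preserves cokernel diagrams.
This is what reduces exactness on `S` to exactness on `S₀`. -/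
lemma IsExactOn.tensor [MonoidalCategory a] [MonoidalPreadditive a]
    [HasColimitsOfSize.{w, w} E] [MonoidalCategory E] [MonoidalPreadditive E]
    [∀ X : E, PreservesColimitsOfSize.{w, w} (tensorLeft X)]
    [∀ X : E, PreservesColimitsOfSize.{w, w} (tensorRight X)]
    [h.Monoidal] (hσ : IsExactOn h σ) (A B : a) : IsExactOn h (σ.tensor A B) := by
  have h₁ : IsExactOn (tensorLeft A ⋙ h) σ :=
    (hσ.comp (tensorLeft (h.obj A))).of_natIso (Functor.Monoidal.commTensorLeft h A).symm
  -- Exactness of a composite `F ⋙ h` on a sequence is by definition exactness of `h` on the image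
  -- sequence.
  have h₂ : IsExactOn h (σ.map (tensorLeft A)) := h₁
  have h₃ : IsExactOn (tensorRight B ⋙ h) (σ.map (tensorLeft A)) :=
    (h₂.comp (tensorRight (h.obj B))).of_natIso (Functor.Monoidal.commTensorRight h B).symm
  exact h₃

end Exactness

end LinearSite

end
noncomputable section

namespace LinearSite

/-! ### Linear presheaves -/

section Presheaf

variable {k : Type w} [CommRing k] {a : Type u} [Category.{w} a] [Preadditive a] [Linear k a]

/-- Sections of a linear presheaf are morphisms out of a representable presheaf. -/
def PSh.yonedaEquiv (x : a) (F : PSh k a) :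
    ((yonedaPSh k a).obj x ⟶ F) ≃ₗ[k] F.obj.obj (op x) where
  toFun f := f.hom.app (op x) (𝟙 x)
  map_add' _ _ := rfl
  map_smul' _ _ := rfl
  invFun ξ := ObjectProperty.homMk
    { app := fun V => ModuleCat.ofHom
        { toFun := fun g => F.obj.map g.op ξ
          map_add' := fun (g g' : unop V ⟶ x) =>
            congrArg (fun φ => φ.hom ξ) (F.property.1 g g')
          map_smul' := fun r (g : unop V ⟶ x) =>
            congrArg (fun φ => φ.hom ξ) (F.property.2 r g) }
      naturality := fun V W f => by
        ext g
        have H (g : unop V ⟶ x) :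
            F.obj.map (f.unop ≫ g).op ξ = F.obj.map f (F.obj.map g.op ξ) := by
          rw [op_comp, F.obj.map_comp]
          rfl
        exact H g }
  left_inv f := by
    apply ObjectProperty.hom_ext
    ext V g
    have H (g : unop V ⟶ x) : F.obj.map g.op (f.hom.app (op x) (𝟙 x)) = f.hom.app V g := by
      refine (ConcreteCategory.congr_hom (f.hom.naturality g.op) (𝟙 x)).symm.trans ?_
      exact congrArg (fun g : unop V ⟶ x => f.hom.app V g) (Category.comp_id g)
    exact H g
  right_inv ξ := by
    change F.obj.map (𝟙 x).op ξ = ξ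
    rw [op_id, F.obj.map_id]
    rfl

lemma PSh.yonedaEquiv_map {x y : a} {F : PSh k a} (f : x ⟶ y)
    (s : (yonedaPSh k a).obj y ⟶ F) : PSh.yonedaEquiv x F ((yonedaPSh k a).map f ≫ s) =
      F.obj.map f.op (PSh.yonedaEquiv y F s) := by
  have := ConcreteCategory.congr_hom (s.hom.naturality f.op) (𝟙 y)
  refine Eq.trans ?_ this
  change s.hom.app (op x) (𝟙 x ≫ f) = s.hom.app (op x) (f ≫ 𝟙 y)
  simp

lemma PSh.yonedaEquiv_comp {x : a} {F G : PSh k a} (s : (yonedaPSh k a).obj x ⟶ F) (g : F ⟶ G) :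
    PSh.yonedaEquiv x G (s ≫ g) = g.hom.app (op x) (PSh.yonedaEquiv x F s) := rfl

instance : (yonedaPSh k a).Additive where
  map_add {x y f g} := by
    apply (PSh.yonedaEquiv x ((yonedaPSh k a).obj y)).injective
    change 𝟙 x ≫ (f + g) = 𝟙 x ≫ f + 𝟙 x ≫ g
    simp

instance : (yonedaPSh k a).Linear k where
  map_smul {x y} f r := by
    apply (PSh.yonedaEquiv x ((yonedaPSh k a).obj y)).injective
    change 𝟙 x ≫ (r • f) = r • (𝟙 x ≫ f)
    simp

/-! ### Comparison of sheaf conditions -/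

variable {E : Type u₂} [Category.{v₂} E] [Preadditive E] [Linear k E]
  {h : a ⥤ E} [h.Additive] [h.Linear k] {b : E} {G : aᵒᵖ ⥤ ModuleCat.{w} k}

variable (h b G) in
/-- An isomorphism between the presheaf `Hom(h -, b)` and the presheaf `G` of modules. -/
structure PresheafIso where
  equiv (x : a) : (h.obj x ⟶ b) ≃ₗ[k] G.obj (op x)
  nat {x y : a} (f : x ⟶ y) (ξ : h.obj y ⟶ b) :
    equiv x (h.map f ≫ ξ) = G.map f.op (equiv y ξ)

namespace PresheafIso

variable (e : PresheafIso h b G)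

/-- The morphism out of a representable presheaf that corresponds to a section. -/
def toNat {X : a} (ξ : h.obj X ⟶ b) : (linearYoneda k a).obj X ⟶ G where
  app V := ModuleCat.ofHom
    { toFun := fun (g : unop V ⟶ X) => e.equiv (unop V) (h.map g ≫ ξ)
      map_add' := fun g g' => by rw [h.map_add, Preadditive.add_comp, map_add]
      map_smul' := fun r g => by
        rw [h.map_smul, Linear.smul_comp, map_smul]
        rfl }
  naturality V W f := by
    ext g
    have H (g : unop V ⟶ X) : e.equiv (unop W) (h.map (f.unop ≫ g) ≫ ξ) =
        G.map f (e.equiv (unop V) (h.map g ≫ ξ)) := by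
      rw [h.map_comp, Category.assoc, e.nat]
      rfl
    exact H g

lemma toNat_app {X V : a} (ξ : h.obj X ⟶ b) (g : V ⟶ X) :
    (e.toNat ξ).app (op V) g = e.equiv V (h.map g ≫ ξ) := rfl

lemma toNat_bijective (X : a) : Function.Bijective (e.toNat (X := X)) := by
  refine ⟨fun ξ ξ' H => ?_, fun φ => ?_⟩
  · have := ConcreteCategory.congr_hom (NatTrans.congr_app H (op X)) (𝟙 X)
    rw [e.toNat_app, e.toNat_app] at this
    simpa using this
  · refine ⟨(e.equiv X).symm (φ.app (op X) (𝟙 X)), ?_⟩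
    ext V g
    have H (g : unop V ⟶ X) :
        e.equiv (unop V) (h.map g ≫ (e.equiv X).symm (φ.app (op X) (𝟙 X))) = φ.app V g := by
      rw [e.nat, LinearEquiv.apply_symm_apply]
      refine (ConcreteCategory.congr_hom (φ.naturality g.op) (𝟙 X)).symm.trans ?_
      exact congrArg (fun g : unop V ⟶ X => φ.app V g) (Category.comp_id g)
    exact H g

/-- The morphism out of a sieve that corresponds to a compatible family. -/
def famNat {X : a} {R : LinSieve k X} (ψ : SieveFam R h b) : R.toPresheaf ⟶ G where
  app V := ModuleCat.ofHom
    { toFun := fun (g : R.arrows (unop V)) => e.equiv (unop V) (ψ.app g.1)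
      map_add' := fun g g' => by
        have := ψ.lin (1 : k) g.2 (𝟙 _) g'.2
        rw [one_smul, one_smul, Category.id_comp, h.map_id, Category.id_comp] at this
        rw [Submodule.coe_add, this, map_add]
      map_smul' := fun r g => by
        have := ψ.lin r g.2 (𝟙 _) (Submodule.zero_mem _)
        rw [comp_zero, add_zero, ψ.app_zero, comp_zero, add_zero] at this
        rw [Submodule.coe_smul, this, map_smul]
        rfl }
  naturality V W f := by
    ext g
    change e.equiv (unop W) (ψ.app (f.unop ≫ g.1)) = G.map f (e.equiv (unop V) (ψ.app g.1))
    rw [ψ.app_comp _ g.2, e.nat]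
    rfl

lemma famNat_app {X V : a} {R : LinSieve k X} (ψ : SieveFam R h b) (g : R.arrows V) :
    (e.famNat ψ).app (op V) g = e.equiv V (ψ.app g.1) := rfl

lemma incl_comp_toNat_eq_iff {X : a} {R : LinSieve k X} (ξ : h.obj X ⟶ b)
    (χ : R.toPresheaf ⟶ G) : R.incl ≫ e.toNat ξ = χ ↔
      ∀ ⦃V : a⦄ (g : R.arrows V), e.equiv V (h.map g.1 ≫ ξ) = χ.app (op V) g := by
  refine ⟨fun H V g => by rw [← H]; rfl, fun H => ?_⟩
  ext V g
  exact H g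

lemma famNat_surjective {X : a} (R : LinSieve k X) :
    Function.Surjective (e.famNat (R := R)) := by
  classical
  intro χ
  let ψ : SieveFam R h b :=
    { app := fun {V} g => if hg : g ∈ R.arrows V then
        (e.equiv V).symm (χ.app (op V) (⟨g, hg⟩ : R.arrows V)) else 0
      lin := fun {V W} r g hg f g' hg' => by
        have hm := R.precomp_mem f hg'
        rw [dif_pos hg, dif_pos hg', dif_pos (Submodule.add_mem _ (Submodule.smul_mem _ r hg) hm)]
        apply (e.equiv V).injective
        have := ConcreteCategory.congr_hom (χ.naturality f.op) (⟨g', hg'⟩ : R.arrows W)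
        rw [map_add, map_smul, e.nat, LinearEquiv.apply_symm_apply, LinearEquiv.apply_symm_apply,
          LinearEquiv.apply_symm_apply]
        refine Eq.trans ?_ (congrArg (r • (χ.app (op V)) (⟨g, hg⟩ : R.arrows V) + ·) this)
        exact (map_add (χ.app (op V)).hom (r • (⟨g, hg⟩ : R.arrows V))
          (⟨f ≫ g', hm⟩ : R.arrows V)).trans (congrArg
            (· + (χ.app (op V)).hom (⟨f ≫ g', hm⟩ : R.arrows V))
            (map_smul (χ.app (op V)).hom r (⟨g, hg⟩ : R.arrows V))) }
  refine ⟨ψ, ?_⟩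
  ext V g
  refine (e.famNat_app ψ g).trans ?_
  change e.equiv (unop V) (if hg : g.1 ∈ R.arrows (unop V) then
    (e.equiv _).symm (χ.app V (⟨g.1, hg⟩ : R.arrows (unop V))) else 0) = _
  rw [dif_pos g.2, LinearEquiv.apply_symm_apply]
  rfl

include e

/-- Transformations out of `a(-, X)` are sections by the Yoneda lemma, and those out of `R` come
from compatible families. Injectivity of restriction then becomes separatedness, and surjectivity
becomes gluing. -/
lemma bijective_incl_iff {X : a} (R : LinSieve k X) :
    (Function.Bijective fun φ : (linearYoneda k a).obj X ⟶ G => R.incl ≫ φ) ↔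
      R.Separates h b ∧ R.Glues h b := by
  rw [← Function.Bijective.of_comp_iff _ (e.toNat_bijective X)]
  refine and_congr ⟨fun H ξ ξ' hξ => H ?_, fun H ξ ξ' hξ => H fun V g hg => ?_⟩
    ⟨fun H ψ => ?_, fun H χ => ?_⟩
  · refine (e.incl_comp_toNat_eq_iff _ _).2 fun V g => ?_
    rw [hξ _ g.2]
    rfl
  · exact (e.equiv V).injective ((e.incl_comp_toNat_eq_iff _ _).1 hξ ⟨g, hg⟩)
  · obtain ⟨ξ, hξ⟩ := H (e.famNat ψ)
    exact ⟨ξ, fun V g hg =>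
      (e.equiv V).injective ((e.incl_comp_toNat_eq_iff _ _).1 hξ ⟨g, hg⟩)⟩
  · obtain ⟨ψ, rfl⟩ := e.famNat_surjective R χ
    obtain ⟨ξ, hξ⟩ := H ψ
    exact ⟨ξ, (e.incl_comp_toNat_eq_iff _ _).2 fun V g => by rw [hξ _ g.2, e.famNat_app]⟩

lemma isSheaf_iff (T : Topology k a) : IsSheaf T G ↔ IsSheafAt T h b :=
  forall_congr' fun _ => forall_congr' fun R => imp_congr_right fun _ => e.bijective_incl_iff R

lemma isLinearPresheaf : IsLinearPresheaf k a G := by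
  refine ⟨fun x y f g => ?_, fun x y r f => ?_⟩ <;> ext ξ <;>
    obtain ⟨ξ, rfl⟩ := (e.equiv _).surjective ξ
  · change G.map _ _ = G.map _ _ + G.map _ _
    rw [← e.nat, ← e.nat, ← e.nat, h.map_add, Preadditive.add_comp, map_add]
  · change G.map _ _ = r • G.map _ _
    rw [← e.nat, ← e.nat, h.map_smul, Linear.smul_comp, map_smul]

end PresheafIso

variable (h b) in
/-- The presheaf `Hom(h -, b)`, made small. -/
def shrinkPresheaf [LocallySmall.{w} E] : aᵒᵖ ⥤ ModuleCat.{w} k where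
  obj x := ModuleCat.of k (Shrink.{w} (h.obj (unop x) ⟶ b))
  map {x y} f := ModuleCat.ofHom ((Shrink.linearEquiv k _).symm.toLinearMap.comp
    ((Linear.leftComp k b (h.map f.unop)).comp (Shrink.linearEquiv k _).toLinearMap))
  map_id x := by
    ext ξ
    simp
  map_comp f g := by
    ext ξ
    simp

variable (h b) in
/-- The comparison of `Hom(h -, b)` with its small replacement. -/
def shrinkPresheafIso [LocallySmall.{w} E] : PresheafIso (k := k) h b (shrinkPresheaf h b) where
  equiv x := (Shrink.linearEquiv k _).symm
  nat f ξ := by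
    change (Shrink.linearEquiv k _).symm _ = (Shrink.linearEquiv k _).symm
      (h.map f ≫ Shrink.linearEquiv k _ ((Shrink.linearEquiv k _).symm ξ))
    rw [LinearEquiv.apply_symm_apply]

variable (k a) in
/-- The Yoneda lemma. -/
def yonedaPresheafIso (F : PSh k a) : PresheafIso (yonedaPSh k a) F F.obj where
  equiv x := PSh.yonedaEquiv x F
  nat f s := PSh.yonedaEquiv_map f s

end Presheaf

end LinearSite

end
noncomputable section

namespace LinearSite

/-! ### Sheafification -/

section Sheafification

open WCocone (skel skelIso)

attribute [local instance] Cardinal.fact_isRegular_aleph0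

variable {k : Type w} [CommRing k] {a : Type u} [Category.{w} a] [Preadditive a] [Linear k a]

/-- Colimits of presheaves are computed objectwise, so the linearity equations can be checked on the
colimit injections. -/
instance (J : Type w) [SmallCategory J] :
    (IsLinearPresheaf k a).IsClosedUnderColimitsOfShape J where
  colimitsOfShape_le := by
    rintro F ⟨p⟩
    have hc (x : aᵒᵖ) := isColimitOfPreserves ((evaluation aᵒᵖ (ModuleCat.{w} k)).obj x) p.isColimit
    refine ⟨fun x y f g => (hc (op y)).hom_ext fun j => ?_,
      fun x y r f => (hc (op y)).hom_ext fun j => ?_⟩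
    · change (p.ι.app j).app _ ≫ _ = (p.ι.app j).app _ ≫ _
      have h₁ := (p.ι.app j).naturality (f + g).op
      have h₂ := (p.ι.app j).naturality f.op
      have h₃ := (p.ι.app j).naturality g.op
      dsimp only [Functor.const_obj_obj] at h₁ h₂ h₃ ⊢
      rw [← h₁, (p.prop_diag_obj j).1, Preadditive.comp_add, Preadditive.add_comp, h₂, h₃]
    · change (p.ι.app j).app _ ≫ _ = (p.ι.app j).app _ ≫ _
      have h₁ := (p.ι.app j).naturality (r • f).op
      have h₂ := (p.ι.app j).naturality f.op
      dsimp only [Functor.const_obj_obj] at h₁ h₂ ⊢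
      rw [← h₁, (p.prop_diag_obj j).2, Linear.comp_smul, Linear.smul_comp, h₂]

instance : HasColimitsOfSize.{w, w} (PSh k a) where

lemma PSh.hom_ext_yoneda {F G : PSh k a} {f g : F ⟶ G}
    (H : ∀ (x : a) (s : (yonedaPSh k a).obj x ⟶ F), s ≫ f = s ≫ g) : f = g := by
  apply ObjectProperty.hom_ext
  ext V ξ
  obtain ⟨s, rfl⟩ := (PSh.yonedaEquiv (unop V) F).surjective ξ
  exact congrArg (PSh.yonedaEquiv (unop V) G) (H _ s)

variable [EssentiallySmall.{w} a]

lemma PSh.hom_ext_skel {F G : PSh k a} {f g : F ⟶ G}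
    (H : ∀ (x : SmallModel.{w} a) (s : (yonedaPSh k a).obj ((skel a).obj x) ⟶ F),
      s ≫ f = s ≫ g) : f = g := by
  refine PSh.hom_ext_yoneda fun x s => ?_
  rw [← cancel_epi ((yonedaPSh k a).map (skelIso x).hom), ← Category.assoc, H, Category.assoc]

instance : LocallySmall.{w} (PSh k a) where
  hom_small F G := small_of_injective
    (β := ∀ x : SmallModel.{w} a, F.obj.obj (op ((skel a).obj x)) →
      G.obj.obj (op ((skel a).obj x)))
    (f := fun f x ξ => f.hom.app (op ((skel a).obj x)) ξ) fun f g H => by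
      refine PSh.hom_ext_skel fun x s => (PSh.yonedaEquiv _ G).injective ?_
      rw [PSh.yonedaEquiv_comp, PSh.yonedaEquiv_comp]
      exact congrFun (congrFun H x) _

/-- By the Yoneda lemma, the functor corepresented by a representable is evaluation at `x` up to a
universe lift, and evaluation preserves filtered colimits. -/
instance (κ : Cardinal.{w}) [Fact κ.IsRegular] (x : a) :
    IsCardinalPresentable ((yonedaPSh k a).obj x) κ where
  preservesColimitOfShape J _ _ := by
    have := isFiltered_of_isCardinalFiltered J κ
    let e : coyoneda.obj (op ((yonedaPSh k a).obj x)) ≅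
        (IsLinearPresheaf k a).ι ⋙ (evaluation aᵒᵖ (ModuleCat.{w} k)).obj (op x) ⋙
          forget (ModuleCat.{w} k) ⋙ uliftFunctor.{max u w} :=
      NatIso.ofComponents fun F =>
        Equiv.toIso ((PSh.yonedaEquiv x F).toEquiv.trans Equiv.ulift.symm)
    exact preservesColimitsOfShape_of_natIso e.symm

/-- The representables over a small skeleton form a strong generator of finitely presentable
objects: a monomorphism along which all their sections lift is bijective at each object, hence
invertible. -/
instance : IsCardinalLocallyPresentable (PSh k a) Cardinal.aleph0.{w} := by
  rw [IsCardinalLocallyPresentable.iff_exists_isStrongGenerator]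
  refine ⟨.ofObj fun x : SmallModel.{w} a => (yonedaPSh k a).obj ((skel a).obj x),
    inferInstance, ?_, ?_⟩
  · rw [ObjectProperty.isStrongGenerator_iff]
    refine ⟨fun F G f g H => PSh.hom_ext_skel fun x s => H _ ⟨x⟩ s, fun F G i _ H => ?_⟩
    have hb (x : a) : Function.Bijective fun s : (yonedaPSh k a).obj x ⟶ F => s ≫ i := by
      refine ⟨fun s t hst => (cancel_mono i).1 hst, fun t => ?_⟩
      obtain ⟨s, hs⟩ := H _ ⟨(equivSmallModel.{w} a).functor.obj x⟩
        ((yonedaPSh k a).map (skelIso x).hom ≫ t)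
      refine ⟨(yonedaPSh k a).map (skelIso x).inv ≫ s, ?_⟩
      dsimp only at hs ⊢
      rw [Category.assoc, hs, ← Category.assoc, ← Functor.map_comp, Iso.inv_hom_id,
        CategoryTheory.Functor.map_id, Category.id_comp]
    have : IsIso ((IsLinearPresheaf k a).ι.map i) := by
      change IsIso i.hom
      rw [NatTrans.isIso_iff_isIso_app]
      intro V
      rw [ConcreteCategory.isIso_iff_bijective]
      have e : (fun s => i.hom.app V (PSh.yonedaEquiv (unop V) F s)) =
          fun s => PSh.yonedaEquiv (unop V) G (s ≫ i) := rfl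
      have h₁ := (PSh.yonedaEquiv (unop V) G).bijective.comp (hb (unop V))
      exact (Function.Bijective.of_comp_iff (i.hom.app V)
        (PSh.yonedaEquiv (unop V) F).bijective).1 h₁
    exact isIso_of_reflects_iso i (IsLinearPresheaf k a).ι
  · rintro _ ⟨x⟩
    exact inferInstanceAs (IsCardinalPresentable _ _)

instance : IsLocallyPresentable.{w} (PSh k a) where
  exists_cardinal := ⟨_, Cardinal.fact_isRegular_aleph0, inferInstance⟩

lemma exists_isCardinalPresentable {C : Type u₁} [Category.{v₁} C] {ι : Type u₂} [Small.{w} ι]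
    (X : ι → C) [∀ i, IsPresentable.{w} (X i)] :
    ∃ (κ : Cardinal.{w}) (_ : Fact κ.IsRegular), ∀ i, IsCardinalPresentable (X i) κ := by
  have h (i : ι) : ∃ (κ : Cardinal.{w}) (_ : Fact κ.IsRegular), IsCardinalPresentable (X i) κ :=
    Functor.IsAccessible.exists_cardinal
  choose κ hκ hX using h
  -- Successors of infinite cardinals are regular, so the successor of `c` is a regular cardinal
  -- that dominates all `κ i`.
  let c := max Cardinal.aleph0 (⨆ i, κ i)
  have : Fact (Order.succ c).IsRegular := ⟨Cardinal.isRegular_succ (le_max_left _ _)⟩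
  refine ⟨_, this, fun i => isCardinalPresentable_of_le (X i) (κ := κ i) ?_⟩
  exact ((le_ciSup Cardinal.bddAbove_of_small i).trans (le_max_right _ _)).trans
    (Order.le_succ c)

lemma LinSieve.isLinearPresheaf {X : a} (R : LinSieve k X) :
    IsLinearPresheaf k a R.toPresheaf := by
  refine ⟨fun x y f g => ?_, fun x y r f => ?_⟩ <;> ext s <;> apply Subtype.ext
  · exact Preadditive.add_comp _ _ _ f g _
  · exact Linear.smul_comp _ _ _ r f _

/-- A sieve, as an object of `PSh a`. -/
abbrev LinSieve.toPSh {X : a} (R : LinSieve k X) : PSh k a := ⟨R.toPresheaf, R.isLinearPresheaf⟩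

/-- The inclusion of a sieve, as a morphism of `PSh a`. -/
abbrev LinSieve.inclPSh {X : a} (R : LinSieve k X) : R.toPSh ⟶ (yonedaPSh k a).obj X :=
  ObjectProperty.homMk R.incl

lemma LinSieve.bijective_inclPSh_iff {X : a} (R : LinSieve k X) (F : PSh k a) :
    (Function.Bijective fun φ : (yonedaPSh k a).obj X ⟶ F => R.inclPSh ≫ φ) ↔
      R.Separates (yonedaPSh k a) F ∧ R.Glues (yonedaPSh k a) F := by
  let e₁ := (IsLinearPresheaf k a).fullyFaithfulι.homEquiv (X := (yonedaPSh k a).obj X) (Y := F)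
  let e₂ := (IsLinearPresheaf k a).fullyFaithfulι.homEquiv (X := R.toPSh) (Y := F)
  have h : (e₂ ∘ fun φ : (yonedaPSh k a).obj X ⟶ F => R.inclPSh ≫ φ) =
    (fun φ : (linearYoneda k a).obj X ⟶ F.obj => R.incl ≫ φ) ∘ e₁ := rfl
  rw [← (yonedaPresheafIso k a F).bijective_incl_iff R,
    ← Function.Bijective.of_comp_iff' e₂.bijective, h]
  exact Function.Bijective.of_comp_iff _ e₁.bijective

instance (X : a) : Small.{w} (LinSieve k X) := by
  refine small_of_injective
    (β := ∀ x : SmallModel.{w} a, Set ((skel a).obj x ⟶ X))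
    (f := fun R x => (R.arrows ((skel a).obj x) : Set ((skel a).obj x ⟶ X)))
    fun R R' H => LinSieve.ext (funext fun V => ?_)
  have key (R : LinSieve k X) (g : V ⟶ X) :
      g ∈ R.arrows V ↔ (skelIso V).hom ≫ g ∈ R.arrows _ :=
    ⟨R.precomp_mem _, fun h => by simpa using R.precomp_mem (skelIso V).inv h⟩
  ext g
  rw [key R, key R']
  exact Set.ext_iff.1 (congrFun H _) _

/-- The inclusions of the covering sieves on the objects of a small skeleton. -/
def coverInclusions (T : Topology k a) : MorphismProperty (PSh k a) :=
  .ofHoms fun i : Σ x : SmallModel.{w} a, T.covers ((skel a).obj x) => i.2.1.inclPSh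

/-- A covering sieve on any object can be transported along an isomorphism to one on a skeletal
object. So a small set of inclusions detects all sheaves. -/
lemma isLocal_coverInclusions (T : Topology k a) :
    (coverInclusions T).isLocal = fun F : PSh k a => IsSheaf T F.obj := by
  ext F
  rw [(yonedaPresheafIso k a F).isSheaf_iff T]
  refine ⟨fun H X R hR => ?_, fun H => ?_⟩
  · have h₁ := (LinSieve.bijective_inclPSh_iff _ _).1 (H _ ⟨(⟨(equivSmallModel.{w} a).functor.obj X,
      R.pullback (skelIso X).hom, T.pullback_mem hR _⟩ :
        Σ x : SmallModel.{w} a, T.covers ((skel a).obj x))⟩)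
    have hmem ⦃V : a⦄ (g : V ⟶ _) (hg : g ∈ (R.pullback (skelIso X).hom).arrows V) :
        g ≫ (skelIso X).hom ∈ R.arrows V := hg
    refine ⟨fun ξ ξ' hξ => ?_, fun ψ => ?_⟩
    · rw [← cancel_epi ((yonedaPSh k a).map (skelIso X).hom)]
      refine h₁.1 fun V g hg => ?_
      have := hξ _ (hmem g hg)
      rwa [Functor.map_comp, Category.assoc, Category.assoc] at this
    · obtain ⟨ξ, hξ⟩ := h₁.2 (ψ.comap (skelIso X).hom hmem)
      refine ⟨(yonedaPSh k a).map (skelIso X).inv ≫ ξ, fun V g hg => ?_⟩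
      have hg' : (g ≫ (skelIso X).inv) ≫ (skelIso X).hom = g := by simp
      have := hξ (g ≫ (skelIso X).inv) (by
        change (g ≫ (skelIso X).inv) ≫ (skelIso X).hom ∈ R.arrows V
        rwa [hg'])
      rw [SieveFam.comap_app, hg', Functor.map_comp, Category.assoc] at this
      exact this
  · rintro _ _ _ ⟨i⟩
    exact (LinSieve.bijective_inclPSh_iff _ _).2 (H i.2.2)

/-- Sheaves are reflective in presheaves. -/
theorem isRightAdjoint_shIncl (T : Topology k a) : (shIncl T).IsRightAdjoint := by
  obtain ⟨κ, _, h₁⟩ := exists_isCardinalPresentable.{w}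
    fun i : Σ x : SmallModel.{w} a, T.covers ((skel a).obj x) => i.2.1.toPSh
  have : (coverInclusions T).IsSmall := MorphismProperty.isSmall_ofHoms _
  -- In a locally presentable category the objects local for a small set of morphisms between
  -- `κ`-presentable objects form a reflective subcategory. The sieves are presentable by the choice
  -- of `κ`, the representables for every `κ`.
  have := MorphismProperty.isRightAdjoint_ι_isLocal (coverInclusions T) κ
    (by rintro _ _ _ ⟨i⟩; exact ⟨h₁ i, inferInstance⟩)
  rw [isLocal_coverInclusions] at this
  exact this

end Sheafification

end LinearSite

end
noncomputable section

namespace LinearSite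

/-! ### The functor from a site to its category of sheaves -/

section SheafFunctor

variable {k : Type w} [CommRing k] {a : Type u} [Category.{w} a] [Preadditive a] [Linear k a]
  {T : Topology k a} {S : PSh k a ⥤ Sh T} (adj : S ⊣ shIncl T)

include adj in
lemma additive_of_adj : S.Additive := adj.left_adjoint_additive

include adj in
lemma linear_of_adj : S.Linear k where
  map_smul {F G} f r := (adj.homEquiv _ _).injective (by
    have := adj.unit.naturality (r • f)
    have h₂ := adj.unit.naturality f
    simp only [Functor.id_obj, Functor.id_map, Functor.comp_obj, Functor.comp_map] at this h₂
    rw [adj.homEquiv_unit, adj.homEquiv_unit, (shIncl T).map_smul, Linear.comp_smul, ← h₂, ← this,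
      Linear.smul_comp])

/-- Sections of a sheaf are morphisms out of a sheafified representable presheaf. -/
def sheafIso (F : Sh T) : PresheafIso (yonedaPSh k a ⋙ S) F F.obj.obj where
  equiv x :=
    { toEquiv := (adj.homEquiv ((yonedaPSh k a).obj x) F).trans (PSh.yonedaEquiv x F.obj).toEquiv
      map_add' := fun f g => by
        change PSh.yonedaEquiv x F.obj (adj.homEquiv _ _ (f + g)) =
          PSh.yonedaEquiv x F.obj (adj.homEquiv _ _ f) +
            PSh.yonedaEquiv x F.obj (adj.homEquiv _ _ g)
        rw [adj.homEquiv_unit, adj.homEquiv_unit, adj.homEquiv_unit, Functor.map_add,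
          Preadditive.comp_add, map_add]
      map_smul' := fun r f => by
        change PSh.yonedaEquiv x F.obj (adj.homEquiv _ _ (r • f)) =
          r • PSh.yonedaEquiv x F.obj (adj.homEquiv _ _ f)
        rw [adj.homEquiv_unit, adj.homEquiv_unit, Functor.map_smul, Linear.comp_smul, map_smul] }
  nat {x y} f ξ := by
    change PSh.yonedaEquiv x F.obj (adj.homEquiv _ _ (S.map ((yonedaPSh k a).map f) ≫ ξ)) =
      F.obj.obj.map f.op (PSh.yonedaEquiv y F.obj (adj.homEquiv _ _ ξ))
    rw [adj.homEquiv_naturality_left, PSh.yonedaEquiv_map]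

lemma sheafIso_comp {F G : Sh T} {x : a} (s : (yonedaPSh k a ⋙ S).obj x ⟶ F) (g : F ⟶ G) :
    (sheafIso adj G).equiv x (s ≫ g) = g.hom.hom.app (op x) ((sheafIso adj F).equiv x s) := by
  change PSh.yonedaEquiv x G.obj (adj.homEquiv _ _ (s ≫ g)) = _
  rw [adj.homEquiv_naturality_right]
  rfl

include adj in
/-- Each sheaf is the canonical colimit of sheafified representable presheaves. -/
lemma isLinDense_of_adj : IsLinDense k (yonedaPSh k a ⋙ S) := by
  have := additive_of_adj adj
  have := linear_of_adj adj
  intro F K v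
  let e (F : Sh T) := sheafIso adj F
  -- Sections out of `Z x` are the elements of `F x`. Through this identification the cocone `v` is
  -- literally a morphism of presheaves.
  let g₀ : F.obj.obj ⟶ K.obj.obj :=
    { app := fun x => ModuleCat.ofHom
        { toFun := fun ξ => (e K).equiv (unop x) (v.app (((e F).equiv (unop x)).symm ξ))
          map_add' := fun ξ ξ' => by rw [map_add, v.app_add, map_add]
          map_smul' := fun r ξ => by
            rw [map_smul, v.app_smul, map_smul]
            rfl }
      naturality := fun x y f => by
        ext ξ
        obtain ⟨s, rfl⟩ := ((e F).equiv (unop x)).surjective ξ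
        change (e K).equiv (unop y) (v.app (((e F).equiv (unop y)).symm
          (F.obj.obj.map f.unop.op ((e F).equiv (unop x) s)))) = K.obj.obj.map f.unop.op
            ((e K).equiv (unop x) (v.app (((e F).equiv (unop x)).symm ((e F).equiv (unop x) s))))
        rw [← (e F).nat, ← (e K).nat, LinearEquiv.symm_apply_apply, LinearEquiv.symm_apply_apply,
          v.app_comp] }
  let g : F ⟶ K := ObjectProperty.homMk (ObjectProperty.homMk g₀)
  refine ⟨g, fun x s => ((e K).equiv x).injective ?_, fun g' hg' => ?_⟩
  · rw [WCocone.refl_app, sheafIso_comp]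
    change (e K).equiv x (v.app (((e F).equiv x).symm ((e F).equiv x s))) = _
    rw [LinearEquiv.symm_apply_apply]
  · apply ObjectProperty.hom_ext
    apply ObjectProperty.hom_ext
    ext x ξ
    obtain ⟨s, rfl⟩ := ((e F).equiv (unop x)).surjective ξ
    have h₁ := sheafIso_comp adj s g'
    have h₂ := hg' s
    rw [WCocone.refl_app] at h₂
    rw [h₂] at h₁
    refine h₁.symm.trans ?_
    change _ = (e K).equiv (unop x) (v.app (((e F).equiv (unop x)).symm ((e F).equiv (unop x) s)))
    rw [LinearEquiv.symm_apply_apply]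

include adj in
/-- If `Hom(h -, b)` is a sheaf, it is represented by an object of the category of sheaves. -/
lemma IsSheafAt.exists_isRep {E : Type u₂} [Category.{v₂} E] [Preadditive E] [Linear k E]
    [LocallySmall.{w} E] {h : a ⥤ E} [h.Additive] [h.Linear k] {b : E} (hb : IsSheafAt T h b) :
    ∃ (R : Sh T) (u : WCocone k (yonedaPSh k a ⋙ S) h R b), u.IsRep := by
  let e := shrinkPresheafIso (k := k) h b
  let R : Sh T := ⟨⟨shrinkPresheaf h b, e.isLinearPresheaf⟩, (e.isSheaf_iff T).2 hb⟩
  let e' : PresheafIso (yonedaPSh k a ⋙ S) R (shrinkPresheaf h b) := sheafIso adj R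
  refine ⟨R, ⟨fun {x} s => (e.equiv x).symm (e'.equiv x s), fun {x y} r s f t => ?_⟩, fun x =>
    ((e'.equiv x).trans (e.equiv x).symm).bijective⟩
  apply (e.equiv x).injective
  rw [map_add, map_smul, e'.nat, map_add, map_smul, map_add (e.equiv x) (r • _) (h.map f ≫ _),
    map_smul, e.nat, map_add, map_smul]
  simp only [LinearEquiv.apply_symm_apply]

include adj in
lemma isSheafAt_sheaf (F : Sh T) : IsSheafAt T (yonedaPSh k a ⋙ S) F := by
  have := additive_of_adj adj
  have := linear_of_adj adj
  exact ((sheafIso adj F).isSheaf_iff T).1 F.property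

include adj in
lemma hasColimitsOfSize_sheaf : HasColimitsOfSize.{w, w} (Sh T) where
  has_colimits_of_shape J _ := by
    let _ : Reflective (shIncl T) := ⟨S, adj⟩
    exact hasColimitsOfShape_of_reflective (shIncl T)

variable [MonoidalCategory a] [MonoidalPreadditive a] [MonoidalLinear k a]

instance (A : a) : (tensorLeft A).Linear k := ⟨fun f r => MonoidalLinear.whiskerLeft_smul A r f⟩

instance (A : a) : (tensorRight A).Linear k := ⟨fun f r => MonoidalLinear.smul_whiskerRight r f A⟩

include adj in
-- The presheaf `Hom(Z (A ⊗ -), F)` is identified with `F(A ⊗ -)`, to which the definition of a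
-- monoidal topology applies.
lemma isSheafAt_tensorLeft (hT : T.IsMonoidal) (A : a) (F : Sh T) :
    IsSheafAt T (tensorLeft A ⋙ yonedaPSh k a ⋙ S) F := by
  have := additive_of_adj adj
  have := linear_of_adj adj
  let e : PresheafIso (tensorLeft A ⋙ yonedaPSh k a ⋙ S) F ((tensorLeft A).op ⋙ F.obj.obj) :=
    ⟨fun x => (sheafIso adj F).equiv (A ⊗ x), fun f ξ => (sheafIso adj F).nat (A ◁ f) ξ⟩
  exact (e.isSheaf_iff T).1 (hT F A).1

include adj in
lemma isSheafAt_tensorRight (hT : T.IsMonoidal) (A : a) (F : Sh T) :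
    IsSheafAt T (tensorRight A ⋙ yonedaPSh k a ⋙ S) F := by
  have := additive_of_adj adj
  have := linear_of_adj adj
  let e : PresheafIso (tensorRight A ⋙ yonedaPSh k a ⋙ S) F ((tensorRight A).op ⋙ F.obj.obj) :=
    ⟨fun x => (sheafIso adj F).equiv (x ⊗ A), fun f ξ => (sheafIso adj F).nat (f ▷ A) ξ⟩
  exact (e.isSheaf_iff T).1 (hT F A).2

end SheafFunctor

end LinearSite

end
noncomputable section

namespace LinearSite

/-! ### The monoidal structure on sheaves -/

section InternalHom

variable {k : Type w} [CommRing k] {a : Type u} [Category.{w} a] [Preadditive a] [Linear k a]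
  {D : Type u₁} [Category.{v₁} D] [Preadditive D] [Linear k D] {Z : a ⥤ D} {F : D}

variable (k Z F) in
/-- Universal weighted cocones under the functors `K y`, for a fixed weight. -/
structure WeightedColimits (K : a ⥤ a ⥤ D) where
  obj (y : a) : D
  cocone (y : a) : WCocone k Z (K.obj y) F (obj y)
  univ (y : a) : (cocone y).IsUniversal

namespace WeightedColimits

variable {K : a ⥤ a ⥤ D} (L : WeightedColimits k Z F K)

/-- The functoriality of the weighted colimits. -/
def map {y y' : a} (f : y ⟶ y') : L.obj y ⟶ L.obj y' :=
  (L.univ y).desc ((L.cocone y').ofNatTrans (K.map f))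

lemma app_map {y y' x : a} (f : y ⟶ y') (s : Z.obj x ⟶ F) :
    (L.cocone y).app s ≫ L.map f = (K.map f).app x ≫ (L.cocone y').app s :=
  (L.univ y).fac _ s

lemma app_map_assoc {y y' x : a} (f : y ⟶ y') (s : Z.obj x ⟶ F) {c : D} (g : L.obj y' ⟶ c) :
    (L.cocone y).app s ≫ L.map f ≫ g = (K.map f).app x ≫ (L.cocone y').app s ≫ g := by
  rw [← Category.assoc, app_map, Category.assoc]

/-- The weighted colimits, as a functor. -/
def functor : a ⥤ D where
  obj := L.obj
  map := L.map
  map_id y := (L.univ y).hom_ext fun x s => by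
    rw [L.app_map, K.map_id, NatTrans.id_app, Category.id_comp, Category.comp_id]
  map_comp f g := (L.univ _).hom_ext fun x s => by
    rw [L.app_map, L.app_map_assoc, L.app_map, K.map_comp, NatTrans.comp_app, Category.assoc]

lemma additive (hK : ∀ x, (K.flip.obj x).Additive) : L.functor.Additive where
  map_add {y y' f g} := (L.univ y).hom_ext fun x s => by
    change (L.cocone y).app s ≫ L.map (f + g) = (L.cocone y).app s ≫ (L.map f + L.map g)
    have : (K.map (f + g)).app x = (K.map f).app x + (K.map g).app x :=
      (hK x).map_add (f := f) (g := g)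
    rw [Preadditive.comp_add, L.app_map, L.app_map, L.app_map, this, Preadditive.add_comp]

lemma linear (hK : ∀ x, (K.flip.obj x).Linear k) : L.functor.Linear k where
  map_smul {y y'} f r := (L.univ y).hom_ext fun x s => by
    change (L.cocone y).app s ≫ L.map (r • f) = (L.cocone y).app s ≫ (r • L.map f)
    have : (K.map (r • f)).app x = r • (K.map f).app x := (hK x).map_smul f r
    rw [Linear.comp_smul, L.app_map, L.app_map, this, Linear.smul_comp]

/-- Morphisms out of `L y` are weighted cocones, so `Hom(L -, G)` is a limit of the sheaves `y ↦
Hom((K y) x, G)`. Families glue separately for each section `s`, and separatedness makes the glued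
morphisms linear in `s`. -/
lemma isSheafAt {T : Topology k a} {G : D} (hK : ∀ x, IsSheafAt T (K.flip.obj x) G) :
    IsSheafAt T L.functor G := by
  refine fun X R hR => ⟨fun (ξ ξ' : L.obj X ⟶ G) H => (L.univ X).hom_ext fun x s => ?_,
    fun ψ => ?_⟩
  · refine (hK x hR).1 fun V g hg => ?_
    have : L.map g ≫ ξ = L.map g ≫ ξ' := H g hg
    change (K.map g).app x ≫ _ = (K.map g).app x ≫ _
    rw [← L.app_map_assoc, ← L.app_map_assoc, this]
  · let φ {V : a} (g : V ⟶ X) : L.obj V ⟶ G := ψ.app g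
    have hφ {V W : a} (r : k) {g : V ⟶ X} (hg : g ∈ R.arrows V) (f : V ⟶ W) {g' : W ⟶ X}
        (hg' : g' ∈ R.arrows W) : φ (r • g + f ≫ g') = r • φ g + L.map f ≫ φ g' :=
      ψ.lin r hg f hg'
    let ψ' {x : a} (s : Z.obj x ⟶ F) : SieveFam R (K.flip.obj x) G :=
      { app := fun {V} g => (L.cocone V).app s ≫ φ g
        lin := fun {V W} r g hg f g' hg' => by
          rw [hφ r hg f hg', Preadditive.comp_add, Linear.comp_smul, L.app_map_assoc]
          rfl }
    choose ξ hξ using fun (x : a) (s : Z.obj x ⟶ F) => (hK x hR).2 (ψ' s)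
    let θ {x : a} (s : Z.obj x ⟶ F) : (K.obj X).obj x ⟶ G := ξ x s
    have hθ {x V : a} (s : Z.obj x ⟶ F) (g : V ⟶ X) (hg : g ∈ R.arrows V) :
        (K.map g).app x ≫ θ s = (L.cocone V).app s ≫ φ g := hξ x s g hg
    let v : WCocone k Z (K.obj X) F G :=
      { app := fun {x} s => θ s
        lin := fun {x y} r s f t => (hK x hR).1 fun V g hg => by
          change (K.map g).app x ≫ _ = (K.map g).app x ≫ _
          rw [hθ _ g hg, (L.cocone V).lin, Preadditive.comp_add, Linear.comp_smul,
            Preadditive.add_comp, Linear.smul_comp, hθ s g hg, ← NatTrans.naturality_assoc,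
            hθ t g hg, Category.assoc] }
    refine ⟨(L.univ X).desc v, fun V g hg => (L.univ V).hom_ext fun x s => ?_⟩
    change (L.cocone V).app s ≫ L.map g ≫ _ = (L.cocone V).app s ≫ φ g
    rw [L.app_map_assoc, (L.univ X).fac]
    exact hθ s g hg

end WeightedColimits

variable [EssentiallySmall.{w} a] [LocallySmall.{w} D] [HasColimitsOfSize.{w, w} D]

/-- The weighted cocones under `K y` with vertex `G` are the morphisms `L y ⟶ G` out of the weighted
colimit. As a presheaf in `y` these form a sheaf, whose representing object is the internal hom. -/
lemma hasInternalHom_of_isSheafAt {T : Topology k a} {K : a ⥤ a ⥤ D}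
    (hrep : ∀ {h : a ⥤ D} [h.Additive] [h.Linear k] {G : D}, IsSheafAt T h G →
      ∃ (R : D) (u : WCocone k Z h R G), u.IsRep)
    (hadd : ∀ x, (K.flip.obj x).Additive) (hlin : ∀ x, (K.flip.obj x).Linear k)
    (hK : ∀ x G, IsSheafAt T (K.flip.obj x) G) : TensorSystem.HasInternalHom k Z K := by
  intro F G
  choose o c hc using fun y : a => exists_universal_wcocone (k := k) Z (K.obj y) F
  let L : WeightedColimits k Z F K := ⟨o, c, hc⟩
  have := L.additive hadd
  have := L.linear hlin
  obtain ⟨R, u, hu⟩ := hrep (L.isSheafAt fun x => hK x G)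
  let φ {y : a} (t : Z.obj y ⟶ R) : L.obj y ⟶ G := u.app t
  have hφ {y y' : a} (r : k) (t : Z.obj y ⟶ R) (f : y ⟶ y') (t' : Z.obj y' ⟶ R) :
      φ (r • t + Z.map f ≫ t') = r • φ t + L.map f ≫ φ t' := u.lin r t f t'
  have hφb (y : a) : Function.Bijective fun t : Z.obj y ⟶ R => φ t := hu y
  refine ⟨R, fun y t => (L.cocone y).postcomp (φ t), fun y => ⟨fun t t' H => ?_, fun v => ?_⟩,
    fun {y y'} r t f t' => ?_⟩
  · refine (hφb y).injective ((L.univ y).hom_ext fun x s => ?_)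
    exact congrArg (fun v : WCocone k Z (K.obj y) F G => v.app s) H
  · obtain ⟨t, ht⟩ := (hφb y).surjective ((L.univ y).desc v)
    refine ⟨t, ?_⟩
    ext x s
    dsimp only at ht ⊢
    rw [WCocone.postcomp_app, ht]
    exact (L.univ y).fac v s
  · ext x s
    dsimp only
    rw [WCocone.postcomp_app, hφ, WCocone.linComb_app, WCocone.postcomp_app,
      WCocone.postcomp_app, Preadditive.comp_add, Linear.comp_smul, L.app_map_assoc]

end InternalHom

section SheafTensor

variable {k : Type w} [CommRing k] {a : Type u} [Category.{w} a] [EssentiallySmall.{w} a]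
  [Preadditive a] [Linear k a] [MonoidalCategory a] [MonoidalPreadditive a] [MonoidalLinear k a]

/-- Sheafification, with a biclosed monoidal structure on the category of sheaves. -/
theorem nonempty_monoidalSheafification (T : Topology k a) (hT : T.IsMonoidal) :
    Nonempty (MonoidalSheafification T) := by
  have := isRightAdjoint_shIncl T
  let adj := Adjunction.ofIsRightAdjoint (shIncl T)
  have := hasColimitsOfSize_sheaf adj
  have := additive_of_adj adj
  have := linear_of_adj adj
  let Z : a ⥤ Sh T := yonedaPSh k a ⋙ (shIncl T).leftAdjoint
  choose o u hu using fun F G : Sh T => exists_universal_bcocone (k := k) Z Z F G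
  let τ : TensorSystem k Z :=
    { dense := isLinDense_of_adj adj
      repLeft := fun x F => (isSheafAt_tensorLeft adj hT x F).exists_isRep adj
      repRight := fun x F => (isSheafAt_tensorRight adj hT x F).exists_isRep adj
      obj := o
      tm := u
      univ := hu }
  have hl : TensorSystem.HasInternalHom k Z
      ((curriedTensor a).flip ⋙ (Functor.whiskeringRight a a (Sh T)).obj Z) :=
    hasInternalHom_of_isSheafAt (fun h => h.exists_isRep adj)
      (fun x => inferInstanceAs (tensorLeft x ⋙ Z).Additive)
      (fun x => inferInstanceAs ((tensorLeft x ⋙ Z).Linear k))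
      (fun x G => isSheafAt_tensorLeft adj hT x G)
  have hr : TensorSystem.HasInternalHom k Z (curriedTensor a ⋙ (Functor.whiskeringRight a a (Sh T)).obj Z) :=
    hasInternalHom_of_isSheafAt (fun h => h.exists_isRep adj)
      (fun x => inferInstanceAs (tensorRight x ⋙ Z).Additive)
      (fun x => inferInstanceAs ((tensorRight x ⋙ Z).Linear k))
      (fun x G => isSheafAt_tensorRight adj hT x G)
  exact ⟨{
    S := (shIncl T).leftAdjoint
    adj := adj
    monoidalCategory := τ.monoidalCategory
    monoidalPreadditive := τ.monoidalPreadditive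
    monoidalLinear := τ.monoidalLinear
    leftClosed := τ.isLeftAdjoint_tensorLeft hl
    rightClosed := τ.isLeftAdjoint_tensorRight hr
    monoidalZ := τ.monoidalFunctor }⟩

end SheafTensor

end LinearSite

end
noncomputable section

namespace LinearSite

/-! ### The universal property -/

section UniversalProperty

variable {k : Type w} [CommRing k] {a : Type u} [Category.{w} a] [EssentiallySmall.{w} a]
  [Preadditive a] [Linear k a] {T : Topology k a} {S S₀ : Set (FormalSequence a)}
  {L : PSh k a ⥤ Sh T} (adj : L ⊣ shIncl T)
  {B : Type u'} [Category.{w} B] [Preadditive B] [Linear k B]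

include adj in
/-- Sheafified representables send the sequences of a pretopology to cokernel diagrams. -/
lemma isExactOn_sheaf (hS : IsPretopology S) (hTS : T.covers = top k S) {σ : FormalSequence a}
    (hσ : σ ∈ S) : IsExactOn (yonedaPSh k a ⋙ L) σ := by
  have := additive_of_adj adj
  have := linear_of_adj adj
  exact fun F => isExactAt_of_isSheafAt hS hTS (isSheafAt_sheaf adj F) hσ

variable [MonoidalCategory a] [MonoidalPreadditive a] [MonoidalLinear k a]
  [HasColimits B] [MonoidalCategory B] [MonoidalPreadditive B] [MonoidalLinear k B]

/-- Restriction is well defined because `Z` sends all sequences of `S` to cokernel diagrams, which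
cocontinuous functors preserve. -/
lemma isCokernelMonoidal_precomp [MonoidalCategory (Sh T)] [(yonedaPSh k a ⋙ L).Monoidal]
    (adj : L ⊣ shIncl T) (hS : IsPretopology S) (hTS : T.covers = top k S) (hS₀ : S₀ ⊆ S)
    {H : LaxMonoidalFunctor (Sh T) B} (hH : IsCocontinuousMonoidal.{w} k H) :
    IsCokernelMonoidal k S₀ ((precomp (yonedaPSh k a ⋙ L)).obj H) := by
  obtain ⟨⟨_, _, _, _⟩, _⟩ := hH
  have := additive_of_adj adj
  have := linear_of_adj adj
  have := hasColimitsOfSize_sheaf adj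
  let _ : H.toFunctor.Monoidal := Functor.Monoidal.ofLaxMonoidal _
  let G := (yonedaPSh k a ⋙ L) ⋙ H.toFunctor
  exact ⟨⟨inferInstanceAs G.Additive, inferInstanceAs (G.Linear k),
    inferInstanceAs (IsIso (Functor.Monoidal.εIso G).hom),
    fun X Y => inferInstanceAs (IsIso (Functor.Monoidal.μIso G X Y).hom)⟩,
    fun σ hσ => (sendsToCokernel_iff (h := G)).2
      ((isExactOn_sheaf adj hS hTS (hS₀ hσ)).comp H.toFunctor)⟩

lemma IsCokernelMonoidal.isExactOn
    [∀ X : B, PreservesColimitsOfSize.{w, w} (tensorLeft X)]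
    [∀ X : B, PreservesColimitsOfSize.{w, w} (tensorRight X)]
    (hgen : ∀ σ ∈ S, ∃ σ' ∈ S₀, ∃ A B : a, Nonempty (σ.Iso (FormalSequence.tensor A σ' B)))
    {h : LaxMonoidalFunctor a B} (hh : IsCokernelMonoidal k S₀ h) {σ : FormalSequence a}
    (hσ : σ ∈ S) : IsExactOn h.toFunctor σ := by
  obtain ⟨⟨_, _, _, _⟩, hex⟩ := hh
  let _ : h.toFunctor.Monoidal := Functor.Monoidal.ofLaxMonoidal _
  obtain ⟨σ', hσ', A, B, ⟨e⟩⟩ := hgen σ hσ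
  exact ((sendsToCokernel_iff.1 (hex σ' hσ')).tensor A B).of_iso e

/-- This links the site to the formal argument: exactness on `S₀` spreads to `S`, exactness on `S`
makes each `Hom(h -, b)` a sheaf, and sheaves are represented in `Sh T`. -/
lemma IsCokernelMonoidal.hasRep
    [∀ X : B, PreservesColimitsOfSize.{w, w} (tensorLeft X)]
    [∀ X : B, PreservesColimitsOfSize.{w, w} (tensorRight X)]
    (adj : L ⊣ shIncl T) (hTS : T.covers = top k S)
    (hgen : ∀ σ ∈ S, ∃ σ' ∈ S₀, ∃ A B : a, Nonempty (σ.Iso (FormalSequence.tensor A σ' B)))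
    {h : LaxMonoidalFunctor a B} (hh : IsCokernelMonoidal k S₀ h) :
    HasRep k (yonedaPSh k a ⋙ L) h.toFunctor := by
  have := hh.1.1
  have := hh.1.2.1
  exact fun b => (isSheafAt_of_isExactAt hTS fun σ hσ => hh.isExactOn hgen hσ b).exists_isRep adj

end UniversalProperty

end LinearSite

end
open LinearSite in
theorem mainTheorem12 {k : Type w} [CommRing k]
    {a : Type u} [Category.{w} a] [EssentiallySmall.{w} a] [Preadditive a] [Linear k a]
    [MonoidalCategory a] [MonoidalPreadditive a] [MonoidalLinear k a]
    (T : LinearSite.Topology k a) (hT : T.IsMonoidal)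
    (S : Set (FormalSequence a)) (hS : IsPretopology S)
    (hTS : T.covers = LinearSite.top k S)
    (S₀ : Set (FormalSequence a)) (hS₀ : S₀ ⊆ S)
    (hgen : ∀ σ ∈ S, ∃ σ' ∈ S₀, ∃ A B : a, Nonempty (σ.Iso (FormalSequence.tensor A σ' B))) :
    Nonempty (MonoidalSheafification T) ∧
    ∀ M : MonoidalSheafification T,
      letI := M.monoidalCategory
      letI := M.monoidalZ
      ∀ {B : Type u'} [Category.{w} B] [Preadditive B] [Linear k B] [HasColimits B]
        [MonoidalCategory B] [MonoidalPreadditive B] [MonoidalLinear k B]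
        (_ : ∀ X : B, PreservesColimits (tensorLeft X))
        (_ : ∀ X : B, PreservesColimits (tensorRight X)),
        ∃ h : ∀ H : (IsCocontinuousMonoidal.{w} k (D := Sh T) (E := B)).FullSubcategory,
            IsCokernelMonoidal k S₀ ((precomp M.Z).obj H.obj),
          (ObjectProperty.lift (IsCokernelMonoidal k S₀ (B := B))
            ((IsCocontinuousMonoidal.{w} k (D := Sh T) (E := B)).ι ⋙ precomp M.Z) h).IsEquivalence := by
  refine ⟨nonempty_monoidalSheafification T hT, fun M => ?_⟩
  let _ := M.monoidalCategory
  let _ := M.monoidalZ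
  intro B _ _ _ _ _ _ _ hl hr
  have := M.monoidalPreadditive
  have := M.monoidalLinear
  have := hasColimitsOfSize_sheaf M.adj
  -- Of the given monoidal structure on sheaves, biclosedness is used only to make the tensor
  -- product cocontinuous in each variable. Density of `Z` and representability depend on the
  -- adjunction alone, so the argument applies to every choice of `M`.
  have (F : Sh T) : PreservesColimitsOfSize.{w, w} (tensorLeft F) :=
    have := M.leftClosed F
    (Adjunction.ofIsLeftAdjoint (tensorLeft F)).leftAdjoint_preservesColimits
  have (F : Sh T) : PreservesColimitsOfSize.{w, w} (tensorRight F) :=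
    have := M.rightClosed F
    (Adjunction.ofIsLeftAdjoint (tensorRight F)).leftAdjoint_preservesColimits
  have hw (H : (IsCocontinuousMonoidal.{w} k (D := Sh T) (E := B)).FullSubcategory) :
      IsCokernelMonoidal k S₀ ((precomp M.Z).obj H.obj) :=
    isCokernelMonoidal_precomp M.adj hS hTS hS₀ H.property
  exact ⟨hw, (isLinDense_of_adj M.adj).isEquivalence_lift_precomp _
    (fun h hh => ⟨hh.1, hh.hasRep M.adj hTS hgen⟩) hw⟩
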